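/- Let $\Omega=(-1,1)$ and $m>1$. Mobility. Let $g:[-1,1]\to[0,1]$ be continuous, of class $C^2$ and positive in $\Omega$, with maximum $g(0)=1$, $g(\pm1)=0$, $\int_0^1 \frac{dz}{g(z)}=+\infty$, and $0\le (g')^2-g\,g''\le C_g$ in $\Omega$ for some $C_g>0$. Put $\alpha(x)=\int_0^x\frac{dz}{g(z)}$ (a bijection of $\Omega$ onto $\mathbb R$) and $a(y)=1/g(\alpha^{-1}(y))$, $y\in\mathbb R$. Internal energy. Let $\varphi:[0,\infty)\to[0,\infty)$ be lower semicontinuous, convex and twice differentiable on $(0,\infty)$, and assume that for some $\nu\in[m,3m)$ and constants $c_m>0$, $C_\nu\ge 0$ we have $c_m s^{m-2}\le\varphi''(s)\le C_\nu s^{\nu-2}$ for every $s>0$. Potential. Let $W:\Omega\to[0,\infty)$ be of class $C^2$ with $g^2W''+g\,g'W'\ge\lambda$ in $\Omega$ for some $\lambda\in\mathbb R$ and $(g^2W')'\le L$ in $\Omega$ for some $L>0$. Put $V(y)=W(\alpha^{-1}(y))$. Scheme. Let $\mathcal P_2(\mathbb R)$ be the set of Borel probability measures on $\mathbb R$ with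 finite second moment and $W_2$ the quadratic Wasserstein distance. For a probability measure with Lebesgue density $\rho$ put $$\mathcal F^a[\rho]=\int_{\mathbb R}\frac{\varphi(a(y)\rho(y))}{a(y)}\,dy+\int_{\mathbb R}V(y)\rho(y)\,dy,$$ and $\mathcal F^a=+\infty$ on measures that are not absolutely continuous. Let $\rho^0\in\mathcal P_2(\mathbb R)$ with $\mathcal F^a[\rho^0]<\infty$. For $\tau>0$ let $\rho_\tau^0=\rho^0$, let $\rho_\tau^n$ ($n\ge1$) be a minimiser over $\rho\in\mathcal P_2(\mathbb R)$ of $\frac1{2\tau}W_2^2(\rho,\rho_\tau^{n-1})+\mathcal F^a[\rho]$, and let $\bar\rho_\tau(0)=\rho^0$, $\bar\rho_\tau(t)=\rho_\tau^n$ for $t\in((n-1)\tau,n\tau]$. Proposition 3.5. Let $\tau_k>0$, $\tau_k\to0$, be any sequence along which $\bar\rho_{\tau_k}(t)$ converges narrowly to a probability measure $\rho(t)$ for every $t\ge0$. Then the measures $\rho(t)$, $t\ge 0$, have a density $\rho(t,y)\geq 0$ that is jointly measurable in $(t,y)$, and for every $T>0$ and every $\mu\in[1,3m)$ (in particular for $\mu=m$)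 the densities of all $\bar\rho_{\tau_k}$ and of $\rho$ belong to $L^\mu([0,T]\times\mathbb R)$ and $$\bar\rho_{\tau_k}\to\rho\quad\text{strongly in }L^\mu([0,T]\times\mathbb R)\text{ as }k\to\infty .$$ -/

import Mathlib

open Set Filter Topology MeasureTheory
open scoped ENNReal

namespace DegenerateMobility

/-- Mobilities with fast decay on the interval `(-1, 1)`: `g` is positive and `C²` in the interior,
has its maximum `1` at `0`, vanishes (continuously) at the two end points, satisfies the Osgood
condition, and `0 ≤ (g')² - g g'' ≤ C_g`. -/
structure IsMobility (g : ℝ → ℝ) : Prop where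
  contDiffOn : ContDiffOn ℝ 2 g (Ioo (-1) 1)
  continuousOn : ContinuousOn g (Icc (-1) 1)
  pos : ∀ x ∈ Ioo (-1 : ℝ) 1, 0 < g x
  le_one : ∀ x ∈ Ioo (-1 : ℝ) 1, g x ≤ 1
  map_zero : g 0 = 1
  map_neg_one : g (-1) = 0
  map_one : g 1 = 0
  osgood : ∫⁻ z in Ioo (0 : ℝ) 1, ENNReal.ofReal (1 / g z) = ⊤
  curvature : ∃ C : ℝ, 0 < C ∧ ∀ x ∈ Ioo (-1 : ℝ) 1,
    0 ≤ (deriv g x) ^ 2 - g x * deriv (deriv g) x ∧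
      (deriv g x) ^ 2 - g x * deriv (deriv g) x ≤ C

/-- Internal energy densities `φ : [0, ∞) → [0, ∞)`: lower semicontinuous, convex, twice
differentiable on `(0, ∞)`, with `c s ^ (m - 2) ≤ φ'' s ≤ C s ^ (ν - 2)` for `s > 0`. -/
structure IsInternalEnergy (m ν : ℝ) (φ : ℝ → ℝ) : Prop where
  nonneg : ∀ s ∈ Ici (0 : ℝ), 0 ≤ φ s
  lowerSemicontinuousOn : LowerSemicontinuousOn φ (Ici 0)
  convexOn : ConvexOn ℝ (Ici 0) φ
  differentiableOn : DifferentiableOn ℝ φ (Ioi 0)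
  differentiableOn_deriv : DifferentiableOn ℝ (deriv φ) (Ioi 0)
  growth : ∃ c C : ℝ, 0 < c ∧ 0 ≤ C ∧ ∀ s : ℝ, 0 < s →
    c * s ^ (m - 2) ≤ deriv (deriv φ) s ∧ deriv (deriv φ) s ≤ C * s ^ (ν - 2)

/-- External potentials `W : (-1, 1) → [0, ∞)` of class `C²` that are compatible with the
mobility `g`: `λ ≤ g² W'' + g g' W'` for some real `λ`, and `(g² W')' ≤ L` for some `L > 0`. -/
structure IsPotential (g W : ℝ → ℝ) : Prop where
  contDiffOn : ContDiffOn ℝ 2 W (Ioo (-1) 1)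
  nonneg : ∀ x ∈ Ioo (-1 : ℝ) 1, 0 ≤ W x
  lower : ∃ l : ℝ, ∀ x ∈ Ioo (-1 : ℝ) 1,
    l ≤ (g x) ^ 2 * deriv (deriv W) x + g x * deriv g x * deriv W x
  upper : ∃ L : ℝ, 0 < L ∧ ∀ x ∈ Ioo (-1 : ℝ) 1,
    deriv (fun z => (g z) ^ 2 * deriv W z) x ≤ L

/-- The change of variables `α(x) = ∫₀ˣ dz / g(z)` from `(-1, 1)` to the real line. -/
noncomputable def alpha (g : ℝ → ℝ) (x : ℝ) : ℝ := ∫ z in (0 : ℝ)..x, 1 / g z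

/-- The inverse of `α : (-1, 1) → ℝ`. -/
noncomputable def alphaInv (g : ℝ → ℝ) : ℝ → ℝ := Function.invFunOn (alpha g) (Ioo (-1) 1)

/-- The coefficient `a(y) = 1 / g(α⁻¹(y))`. -/
noncomputable def coeff (g : ℝ → ℝ) (y : ℝ) : ℝ := 1 / g (alphaInv g y)

/-- The transformed potential `V(y) = W(α⁻¹(y))`. -/
noncomputable def potential (g W : ℝ → ℝ) (y : ℝ) : ℝ := W (alphaInv g y)

/-- The Lebesgue density of (the absolutely continuous part of) a probability measure. -/
noncomputable def density (μ : ProbabilityMeasure ℝ) (y : ℝ) : ℝ :=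
  ((μ : Measure ℝ).rnDeriv volume y).toReal

/-- Membership in `𝒫₂(ℝ)`: the second moment is finite. -/
def FiniteSecondMoment (μ : ProbabilityMeasure ℝ) : Prop :=
  ∫⁻ x, ENNReal.ofReal (x ^ 2) ∂(μ : Measure ℝ) < ⊤

/-- The squared quadratic Wasserstein distance, as the infimum of the transport cost
`∫ |x - y|² dγ(x, y)` over all transport plans `γ` with marginals `μ` and `η`. -/
noncomputable def W2sq (μ η : ProbabilityMeasure ℝ) : ℝ≥0∞ :=
  ⨅ (γ : Measure (ℝ × ℝ)) (_ : γ.map Prod.fst = (μ : Measure ℝ))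
    (_ : γ.map Prod.snd = (η : Measure ℝ)), ∫⁻ p, ENNReal.ofReal ((p.1 - p.2) ^ 2) ∂γ

open Classical in
/-- The energy `∫ φ(a ρ) / a dy + ∫ V ρ dy` of a measure with density `ρ`; it is `+∞` on measures
that are not absolutely continuous. Both integrands are nonnegative. -/
noncomputable def energy (g φ W : ℝ → ℝ) (μ : ProbabilityMeasure ℝ) : ℝ≥0∞ :=
  if (μ : Measure ℝ) ≪ volume then
    (∫⁻ y, ENNReal.ofReal (φ (coeff g y * density μ y) / coeff g y)) +
      ∫⁻ y, ENNReal.ofReal (potential g W y * density μ y)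
  else ⊤

/-- The penalised energy `W₂²(μ, η) / (2 τ) + ℱ[μ]` of one step of the scheme. -/
noncomputable def penalized (g φ W : ℝ → ℝ) (τ : ℝ) (μ η : ProbabilityMeasure ℝ) : ℝ≥0∞ :=
  W2sq μ η / ENNReal.ofReal (2 * τ) + energy g φ W μ

/-- `σ 0, σ 1, …` is a sequence produced by the JKO scheme with time step `τ` started at `ρ₀`:
each `σ (n + 1)` minimises `μ ↦ W₂²(μ, σ n) / (2 τ) + ℱ[μ]` over `𝒫₂(ℝ)`. -/
structure IsJKOSequence (g φ W : ℝ → ℝ) (ρ₀ : ProbabilityMeasure ℝ) (τ : ℝ)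
    (σ : ℕ → ProbabilityMeasure ℝ) : Prop where
  init : σ 0 = ρ₀
  mem : ∀ n, FiniteSecondMoment (σ (n + 1))
  isMin : ∀ n, ∀ μ : ProbabilityMeasure ℝ, FiniteSecondMoment μ →
    penalized g φ W τ (σ (n + 1)) (σ n) ≤ penalized g φ W τ μ (σ n)

/-- The piecewise constant interpolation: its value is `σ n` for `t ∈ ((n - 1) τ, n τ]`. -/
noncomputable def interpolant (τ : ℝ) (σ : ℕ → ProbabilityMeasure ℝ) (t : ℝ) :
    ProbabilityMeasure ℝ := σ ⌈t / τ⌉₊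

/-- Lebesgue measure on the strip `[0, T] × ℝ` of points `(t, y)`. -/
noncomputable def strip (T : ℝ) : Measure (ℝ × ℝ) :=
  ((volume : Measure ℝ).restrict (Icc 0 T)).prod volume

end DegenerateMobility

open DegenerateMobility

namespace DegenerateMobility

/-! Each step of the scheme regularises. Let `ρ` minimise the penalised energy started from `η`, and
let `γ` be an optimal plan between them. Moving to a place `q` a little of the mass that `γ` couples
as `(p, z)` cannot lower the functional. Hence, for almost all `(p, z)` and `q`, `H p + (z / τ) (q -
p) ≤ H q` with `H = D (a ρ) + V + y² / (2 τ)`, where `D` extends `φ'`. The supremum `f` of these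
affine functions is convex, lies almost everywhere below `H`, and touches it almost everywhere on
`{ρ > 0}`. So `κ = f - V - y² / (2 τ)` is a continuous chemical potential: `a ρ = S κ` almost
everywhere, and its right derivative is `v - V'`, where `v = (z - y) / τ` along the plan and
therefore `∫ ρ v² = W₂² / τ²`. This is `exists_chemical_potential`.

The pressure `Q κ` has slope `a ρ (v - V')` when `a ρ` is read as `S κ`. It is integrated away from
a point near the origin where the density is at most `2`. On each half-line `a` increases outwards
and `-V'` pushes outwards at most linearly, so `Q (κ y)` is at most a constant plus `R a(y)` times
an integral of `|v| + C |y| + C` against `ρ`. Since `Q` dominates `c S ^ m` and `a ≤ a ^ m`, the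
factor `a` cancels, and `sup ρ ^ (2 m)` is bounded linearly in `∫ ρ v²` and `∫ ρ y²`
(`exists_density_bound`). The same slope formula gives a local modulus of continuity that depends
only on bounds for these two integrals (`exists_density_modulus`).

Along the scheme `∫ ρ v²` is the squared discrete speed, whose integral in time is at most twice the
initial energy, and second moments are controlled by a discrete Grönwall argument. The energy bounds
`∫ ρ ^ m` at every time. Writing `ρ ^ (3 m) = ρ ^ m ρ ^ (2 m)` gives the `L ^ (3 m)` bound on strips
(`exists_strip_bound`); this is the origin of the exponent `3 m`.

Narrow convergence is given at every time, so no compactness in time is needed. Among the indices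
whose speed at time `t` is at most `N`, the densities are locally equicontinuous, narrow convergence
becomes pointwise, and Scheffé's lemma turns it into `L¹` convergence
(`tendsto_density_of_equicontinuous`). The faster times contribute `O(1 / N)` by Chebyshev's
inequality (`tendsto_lintegral_strip`). Interpolation with the `L ^ (3 m)` bound reaches every
exponent below `3 m`. -/

/-! ### Duality for the internal energy -/

/-- The dual objects of an internal energy density `φ`: `D` is an increasing homeomorphism of `ℝ`
that extends `φ'`, `S` is the nonnegative part of its inverse, and `Q` is a primitive of `S`
(so that `Q (D s) = s φ' s - φ s + φ 0` is the pressure). -/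
structure EnergyDual (m : ℝ) (φ D S Q : ℝ → ℝ) (c K : ℝ) : Prop where
  one_lt : 1 < m
  c_pos : 0 < c
  K_pos : 0 < K
  phi_nonneg : ∀ s, 0 ≤ s → 0 ≤ φ s
  phi_cont : ContinuousOn φ (Ici 0)
  D_cont : Continuous D
  D_mono : StrictMono D
  subgrad : ∀ s r, 0 ≤ s → 0 ≤ r → φ s - φ r ≤ D s * (s - r)
  S_cont : Continuous S
  S_nonneg : ∀ k, 0 ≤ S k
  S_D : ∀ s, 0 ≤ s → S (D s) = s
  S_of_le : ∀ k, k ≤ D 0 → S k = 0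
  Q_deriv : ∀ k, HasDerivAt Q (S k) k
  Q_of_le : ∀ k, k ≤ D 0 → Q k = 0
  Q_eq : ∀ k, Q k = Q (D (S k))
  coercive : ∀ k k', c * |S k - S k'| ^ m ≤ |Q k - Q k'|
  growth : ∀ s, 0 ≤ s → s ^ m ≤ K * (φ s + s)

section
variable {m ν : ℝ} {φ : ℝ → ℝ}

/-- Only the point `0` is delicate: there lower semicontinuity gives one half, and the chord from
`0` to `1`, which lies above the convex function, gives the other. -/
theorem IsInternalEnergy.continuousOn (hφ : IsInternalEnergy m ν φ) :
    ContinuousOn φ (Ici 0) := by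
  intro x hx
  rcases eq_or_lt_of_le (show (0:ℝ) ≤ x from hx) with rfl | hx0
  · rw [ContinuousWithinAt, tendsto_order]
    constructor
    · intro b hb
      exact hφ.lowerSemicontinuousOn 0 hx b hb
    · intro b hb
      have h1 : Tendsto (fun s : ℝ => (1 - s) * φ 0 + s * φ 1) (𝓝[Ici 0] 0) (𝓝 (φ 0)) := by
        have : Continuous (fun s : ℝ => (1 - s) * φ 0 + s * φ 1) := by fun_prop
        have h := this.tendsto 0
        simp only [sub_zero, one_mul, zero_mul, add_zero] at h
        exact h.mono_left nhdsWithin_le_nhds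
      have h2 : ∀ᶠ s : ℝ in 𝓝[Ici 0] 0, s < 1 :=
        nhdsWithin_le_nhds (Iio_mem_nhds one_pos)
      filter_upwards [h1.eventually (gt_mem_nhds hb), h2, self_mem_nhdsWithin] with s hs hs1 hs0
      refine lt_of_le_of_lt ?_ hs
      have := hφ.convexOn.2 (show (0 : ℝ) ∈ Ici 0 by simp) (show (1 : ℝ) ∈ Ici 0 by simp)
        (show 0 ≤ 1 - s by linarith) hs0 (by ring)
      simpa using this
  · exact ((hφ.differentiableOn x hx0).differentiableAt (Ioi_mem_nhds hx0)).continuousAt.continuousWithinAt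

/-- The upper bound on `φ''` is integrable at `0` because `ν > 1`, so `φ'` has a finite limit `D0`
there; the lower bound makes `φ'` strictly increasing and unbounded. Hence `φ'` extends to a
homeomorphism of the line, and `Q` is the primitive of `S` based at `D0`. -/
theorem IsInternalEnergy.exists_dual (hm : 1 < m) (hν : m ≤ ν) (hφ : IsInternalEnergy m ν φ) :
    ∃ (D S Q : ℝ → ℝ) (c K : ℝ), EnergyDual m φ D S Q c K := by
  obtain ⟨c, C, hc, hC, hgr⟩ := hφ.growth
  have hcont := hφ.continuousOn
  have hd1 : ∀ s, 0 < s → HasDerivAt φ (deriv φ s) s := fun s hs =>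
    ((hφ.differentiableOn s hs).differentiableAt (Ioi_mem_nhds hs)).hasDerivAt
  have hd2 : ∀ s, 0 < s → HasDerivAt (deriv φ) (deriv (deriv φ) s) s := fun s hs =>
    ((hφ.differentiableOn_deriv s hs).differentiableAt (Ioi_mem_nhds hs)).hasDerivAt
  have hpd : ∀ p s : ℝ, 0 < s → HasDerivAt (fun x : ℝ => x ^ p) (p * s ^ (p - 1)) s :=
    fun p s hs => Real.hasDerivAt_rpow_const (Or.inl hs.ne')
  -- lower and upper comparison of `φ'` with powers
  have hlow : MonotoneOn (fun s => deriv φ s - c / (m - 1) * s ^ (m - 1)) (Ioi 0) := by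
    have hder : ∀ s, 0 < s → HasDerivAt (fun s => deriv φ s - c / (m - 1) * s ^ (m - 1))
        (deriv (deriv φ) s - c * s ^ (m - 2)) s := by
      intro s hs
      refine ((hd2 s hs).sub ((hpd (m - 1) s hs).const_mul (c / (m - 1)))).congr_deriv ?_
      rw [show m - 1 - 1 = m - 2 by ring]
      have : m - 1 ≠ 0 := by linarith
      field_simp
    refine monotoneOn_of_deriv_nonneg (convex_Ioi 0)
      (fun s hs => (hder s hs).continuousAt.continuousWithinAt) ?_ ?_
    · rw [interior_Ioi]
      exact fun s hs => (hder s hs).differentiableAt.differentiableWithinAt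
    · rw [interior_Ioi]
      intro s hs
      rw [(hder s hs).deriv]
      linarith [(hgr s hs).1]
  have hupp : MonotoneOn (fun s => C / (ν - 1) * s ^ (ν - 1) - deriv φ s) (Ioi 0) := by
    have hder : ∀ s, 0 < s → HasDerivAt (fun s => C / (ν - 1) * s ^ (ν - 1) - deriv φ s)
        (C * s ^ (ν - 2) - deriv (deriv φ) s) s := by
      intro s hs
      refine (((hpd (ν - 1) s hs).const_mul (C / (ν - 1))).sub (hd2 s hs)).congr_deriv ?_
      rw [show ν - 1 - 1 = ν - 2 by ring]
      have : ν - 1 ≠ 0 := by linarith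
      field_simp
    refine monotoneOn_of_deriv_nonneg (convex_Ioi 0)
      (fun s hs => (hder s hs).continuousAt.continuousWithinAt) ?_ ?_
    · rw [interior_Ioi]
      exact fun s hs => (hder s hs).differentiableAt.differentiableWithinAt
    · rw [interior_Ioi]
      intro s hs
      rw [(hder s hs).deriv]
      linarith [(hgr s hs).2]
  have hstr : StrictMonoOn (deriv φ) (Ioi 0) := by
    intro x hx y hy hxy
    have h1 := hlow hx hy hxy.le
    have h2 : x ^ (m - 1) < y ^ (m - 1) :=
      Real.rpow_lt_rpow (le_of_lt hx) hxy (by linarith)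
    have h3 : 0 < c / (m - 1) := div_pos hc (by linarith)
    have := mul_lt_mul_of_pos_left h2 h3
    simp only at h1
    linarith
  -- the limit of `φ'` at `0`
  have hbdd : BddBelow (deriv φ '' Ioi 0) := by
    refine ⟨min (deriv φ 1) (deriv φ 1 - C / (ν - 1)), ?_⟩
    rintro _ ⟨s, hs, rfl⟩
    rcases le_total 1 s with h | h
    · exact (min_le_left _ _).trans (hstr.monotoneOn (by simp) hs h)
    · refine (min_le_right _ _).trans ?_
      have h1 := hupp hs (show (1:ℝ) ∈ Ioi 0 by simp) h
      simp only [Real.one_rpow, mul_one] at h1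
      have h2 : 0 ≤ C / (ν - 1) * s ^ (ν - 1) :=
        mul_nonneg (div_nonneg hC (by linarith)) (Real.rpow_nonneg (le_of_lt hs) _)
      linarith
  set D0 := sInf (deriv φ '' Ioi 0) with hD0
  have hlim : Tendsto (deriv φ) (𝓝[>] 0) (𝓝 D0) := hstr.monotoneOn.tendsto_nhdsGT hbdd
  have hD0lt : ∀ s, 0 < s → D0 + c / (m - 1) * s ^ (m - 1) ≤ deriv φ s := by
    intro s hs
    have h1 : Tendsto (fun x : ℝ => deriv φ x - c / (m - 1) * x ^ (m - 1)) (𝓝[>] 0)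
        (𝓝 (D0 - c / (m - 1) * (0:ℝ) ^ (m - 1))) := by
      refine hlim.sub (Tendsto.const_mul _ ?_)
      exact ((Real.continuousAt_rpow_const 0 (m - 1) (Or.inr (by linarith))).tendsto).mono_left
        nhdsWithin_le_nhds
    rw [Real.zero_rpow (by linarith), mul_zero, sub_zero] at h1
    have h2 : D0 ≤ deriv φ s - c / (m - 1) * s ^ (m - 1) := by
      refine le_of_tendsto h1 ?_
      filter_upwards [Ioo_mem_nhdsGT hs] with x hx
      exact hlow hx.1 hs hx.2.le
    linarith
  -- The slope one on the negative axis is an arbitrary way to make `D` a bijection; `S` truncates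
  -- that half of the inverse to `0`.
  set D : ℝ → ℝ := fun s => if 0 < s then deriv φ s else D0 + s with hD
  have hDpos : ∀ s, 0 < s → D s = deriv φ s := fun s hs => if_pos hs
  have hDneg : ∀ s, s ≤ 0 → D s = D0 + s := fun s hs => if_neg (not_lt.2 hs)
  have hDzero : D 0 = D0 := by rw [hDneg 0 le_rfl, add_zero]
  have hDder : ∀ s, 0 < s → HasDerivAt D (deriv (deriv φ) s) s := by
    intro s hs
    refine (hd2 s hs).congr_of_eventuallyEq ?_
    filter_upwards [Ioi_mem_nhds hs] with x hx using hDpos x hx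
  have hDlow : ∀ s, 0 ≤ s → D0 + c / (m - 1) * s ^ (m - 1) ≤ D s := by
    intro s hs
    rcases eq_or_lt_of_le hs with rfl | hs
    · rw [Real.zero_rpow (by linarith), hDzero]; simp
    · rw [hDpos s hs]; exact hD0lt s hs
  have hc1 : 0 < c / (m - 1) := div_pos hc (by linarith)
  have hDgt : ∀ s, 0 < s → D0 < D s := by
    intro s hs
    have := hDlow s hs.le
    have := mul_pos hc1 (Real.rpow_pos_of_pos hs (m - 1))
    linarith
  have hDmono : StrictMono D := by
    intro x y hxy
    rcases lt_or_ge 0 x with hx | hx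
    · rw [hDpos x hx, hDpos y (hx.trans hxy)]
      exact hstr hx (hx.trans hxy) hxy
    · rw [hDneg x hx]
      rcases lt_or_ge 0 y with hy | hy
      · linarith [hDgt y hy]
      · rw [hDneg y hy]; linarith
  have hDcont : Continuous D := by
    rw [continuous_iff_continuousAt]
    intro x
    rcases lt_trichotomy 0 x with hx | rfl | hx
    · exact (hDder x hx).continuousAt
    · rw [continuousAt_iff_continuous_left'_right']
      constructor
      · have : ContinuousWithinAt (fun s => D0 + s) (Iio 0) 0 := by fun_prop
        refine this.congr (fun y hy => hDneg y (le_of_lt hy)) (hDneg 0 le_rfl)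
      · rw [ContinuousWithinAt, hDzero]
        refine hlim.congr' ?_
        filter_upwards [self_mem_nhdsWithin] with s hs using (hDpos s hs).symm
    · have : ContinuousAt (fun s => D0 + s) x := by fun_prop
      refine this.congr ?_
      filter_upwards [Iio_mem_nhds hx] with s hs using (hDneg s (le_of_lt hs)).symm
  have hDsurj : Function.Surjective D := by
    refine hDcont.surjective ?_ ?_
    · have h1 : Tendsto (fun s : ℝ => D0 + c / (m - 1) * s ^ (m - 1)) atTop atTop :=
        tendsto_atTop_add_const_left _ _ ((tendsto_rpow_atTop (by linarith)).const_mul_atTop hc1)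
      refine tendsto_atTop_mono' _ ?_ h1
      filter_upwards [eventually_ge_atTop 0] with s hs using hDlow s hs
    · have h1 : Tendsto (fun s : ℝ => D0 + s) atBot atBot :=
        tendsto_atBot_add_const_left _ _ tendsto_id
      refine h1.congr' ?_
      filter_upwards [eventually_le_atBot 0] with s hs using (hDneg s hs).symm
  let e : ℝ ≃o ℝ := hDmono.orderIsoOfSurjective D hDsurj
  have he : ∀ s, e.symm (D s) = s := fun s => e.symm_apply_apply s
  have he' : ∀ k, D (e.symm k) = k := fun k => e.apply_symm_apply k
  set S : ℝ → ℝ := fun k => max 0 (e.symm k) with hS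
  have hScont : Continuous S := continuous_const.max e.symm.continuous
  have hSD : ∀ s, 0 ≤ s → S (D s) = s := fun s hs => by
    simp only [hS, he]; exact max_eq_right hs
  have hSle : ∀ k, k ≤ D 0 → S k = 0 := by
    intro k hk
    refine max_eq_left ?_
    have := e.symm.monotone hk
    rwa [he] at this
  set Q : ℝ → ℝ := fun k => ∫ x in D0..k, S x with hQ
  have hQder : ∀ k, HasDerivAt Q (S k) k := fun k =>
    hScont.integral_hasStrictDerivAt D0 k |>.hasDerivAt
  have hQle : ∀ k, k ≤ D 0 → Q k = 0 := by
    intro k hk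
    rw [hDzero] at hk
    simp only [hQ]
    rw [intervalIntegral.integral_congr (g := fun _ => 0), intervalIntegral.integral_zero]
    intro x hx
    rw [uIcc_of_ge hk] at hx
    exact hSle x (by rw [hDzero]; exact hx.2)
  -- `Q ∘ D` has derivative `x φ''(x) ≥ c x ^ (m - 1) ≥ c (x - r) ^ (m - 1)`, and `c / m * (x - r) ^
  -- m` is a primitive of the last term.
  have hcoer1 : ∀ r s, 0 ≤ r → r ≤ s → c / m * (s - r) ^ m ≤ Q (D s) - Q (D r) := by
    intro r s hr hrs
    have hder : ∀ x, r < x → HasDerivAt (fun x => Q (D x) - c / m * (x - r) ^ m)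
        (x * deriv (deriv φ) x - c * (x - r) ^ (m - 1)) x := by
      intro x hx
      have hx0 : 0 < x := hr.trans_lt hx
      have h1 := (hQder (D x)).comp x (hDder x hx0)
      rw [hSD x hx0.le] at h1
      have h2 := ((hpd m (x - r) (sub_pos.2 hx)).comp x ((hasDerivAt_id x).sub_const r)).const_mul
        (c / m)
      refine (h1.sub h2).congr_deriv ?_
      have : m ≠ 0 := by linarith
      field_simp
    have hmono : MonotoneOn (fun x => Q (D x) - c / m * (x - r) ^ m) (Ici r) := by
      refine monotoneOn_of_deriv_nonneg (convex_Ici r) ?_ ?_ ?_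
      · refine ContinuousOn.sub ?_ ?_
        · have hQc : Continuous Q :=
            continuous_iff_continuousAt.2 fun k => (hQder k).continuousAt
          exact (hQc.comp hDcont).continuousOn
        · refine Continuous.continuousOn ?_
          exact continuous_const.mul ((continuous_id.sub continuous_const).rpow_const
            (fun x => Or.inr (by linarith)))
      · rw [interior_Ici]
        exact fun x hx => (hder x hx).differentiableAt.differentiableWithinAt
      · rw [interior_Ici]
        intro x hx
        have hx0 : 0 < x := hr.trans_lt hx
        rw [(hder x hx).deriv]
        have h1 := (hgr x hx0).1
        have h2 : x * x ^ (m - 2) = x ^ (m - 1) := by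
          rw [← Real.rpow_one_add' hx0.le (by linarith)]; congr 1; ring
        have h3 : (x - r) ^ (m - 1) ≤ x ^ (m - 1) :=
          Real.rpow_le_rpow (sub_nonneg.2 (le_of_lt hx)) (by linarith) (by linarith)
        have h4 := mul_le_mul_of_nonneg_left h1 hx0.le
        have h5 := mul_le_mul_of_nonneg_left h3 hc.le
        have h6 : x * (c * x ^ (m - 2)) = c * x ^ (m - 1) := by rw [← h2]; ring
        linarith
    have := hmono (self_mem_Ici) hrs hrs
    simp only [sub_self, Real.zero_rpow (show m ≠ 0 by linarith), mul_zero, sub_zero] at this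
    linarith
  have hQS : ∀ k, Q k = Q (D (S k)) := by
    intro k
    rcases le_total 0 (e.symm k) with h | h
    · rw [hS]; simp only [max_eq_right h, he']
    · have hk : k ≤ D 0 := by rw [← he' k]; exact hDmono.monotone h
      rw [hSle k hk, hQle k hk, hQle _ le_rfl]
  have hS0 : ∀ k, 0 ≤ S k := fun k => le_max_left _ _
  -- The coefficient obtained by integrating `c s ^ (m - 2)` twice: `φ` exceeds its tangent line at
  -- `0` by at least `k0 s ^ m`.
  set k0 := c / (m * (m - 1)) with hk0
  have hk0pos : 0 < k0 := div_pos hc (mul_pos (by linarith) (by linarith))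
  have hlow0 : ∀ s, 0 ≤ s → φ 0 + D0 * s + k0 * s ^ m ≤ φ s := by
    intro s hs
    have hder : ∀ x, 0 < x → HasDerivAt (fun x => φ x - D0 * x - k0 * x ^ m)
        (deriv φ x - D0 - c / (m - 1) * x ^ (m - 1)) x := by
      intro x hx
      refine (((hd1 x hx).sub ((hasDerivAt_id x).const_mul D0)).sub
        ((hpd m x hx).const_mul k0)).congr_deriv ?_
      rw [hk0]
      have : m ≠ 0 := by linarith
      have : m - 1 ≠ 0 := by linarith
      field_simp
    have hmono : MonotoneOn (fun x => φ x - D0 * x - k0 * x ^ m) (Ici 0) := by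
      refine monotoneOn_of_deriv_nonneg (convex_Ici 0) ?_ ?_ ?_
      · refine (hcont.sub (by fun_prop)).sub (Continuous.continuousOn ?_)
        exact continuous_const.mul (continuous_id.rpow_const (fun x => Or.inr (by linarith)))
      · rw [interior_Ici]
        exact fun x hx => (hder x hx).differentiableAt.differentiableWithinAt
      · rw [interior_Ici]
        intro x hx
        rw [(hder x hx).deriv]
        linarith [hD0lt x hx]
    have := hmono (self_mem_Ici) hs hs
    simp only [Real.zero_rpow (show m ≠ 0 by linarith), mul_zero, sub_zero] at this
    linarith
  refine ⟨D, S, Q, c / m, (1 + |D0|) / k0, hm, div_pos hc (by linarith), by positivity,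
    fun s hs => hφ.nonneg s hs, hcont, hDcont, hDmono, ?_, hScont, hS0, hSD, hSle,
    hQder, hQle, hQS, ?_, ?_⟩
  · intro s r hs hr
    rcases eq_or_lt_of_le hs with rfl | hs
    · rw [hDzero]
      have h1 := hlow0 r hr
      have h2 : 0 ≤ k0 * r ^ m := mul_nonneg hk0pos.le (Real.rpow_nonneg hr _)
      linarith
    · rw [hDpos s hs]
      rcases lt_trichotomy r s with h | rfl | h
      · have := hφ.convexOn.slope_le_of_hasDerivAt (show r ∈ Ici (0:ℝ) from hr) hs.le h (hd1 s hs)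
        rw [slope_def_field, div_le_iff₀ (by linarith)] at this
        exact this
      · simp
      · have := hφ.convexOn.le_slope_of_hasDerivAt hs.le (show r ∈ Ici (0:ℝ) from hr) h (hd1 s hs)
        rw [slope_def_field, le_div_iff₀ (by linarith)] at this
        linarith
  · intro k k'
    rw [hQS k, hQS k']
    rcases le_total (S k) (S k') with h | h
    · rw [abs_sub_comm, abs_of_nonneg (sub_nonneg.2 h), abs_sub_comm]
      exact (hcoer1 _ _ (hS0 k) h).trans (le_abs_self _)
    · rw [abs_of_nonneg (sub_nonneg.2 h)]
      exact (hcoer1 _ _ (hS0 k') h).trans (le_abs_self _)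
  -- As `φ 0 ≥ 0`, the tangent bound gives `k0 s ^ m ≤ φ s + |D0| s`, whence the constant `(1 +
  -- |D0|) / k0`.
  · intro s hs
    have h1 := hlow0 s hs
    have h0 := hφ.nonneg 0 (by simp)
    have h2 := hφ.nonneg s hs
    rw [div_mul_eq_mul_div, le_div_iff₀ hk0pos]
    have h3 : -|D0| * s ≤ D0 * s := mul_le_mul_of_nonneg_right (neg_abs_le D0) hs
    have h4 : 0 ≤ |D0| * φ s := mul_nonneg (abs_nonneg _) h2
    nlinarith
end
-- The mobility, the change of variables and the potential
/-- The properties of the coefficient `a` used below. -/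
structure CoeffRegular (a : ℝ → ℝ) : Prop where
  cont : Continuous a
  one_le : ∀ y, 1 ≤ a y
  mono : MonotoneOn a (Ici 0)
  anti : AntitoneOn a (Iic 0)

/-- The properties of the potential `V` with derivative `V'` used below. -/
structure PotentialRegular (V V' : ℝ → ℝ) (C : ℝ) : Prop where
  nonneg : ∀ y, 0 ≤ V y
  hasDeriv : ∀ y, HasDerivAt V (V' y) y
  cont' : Continuous V'
  const_nonneg : 0 ≤ C
  lower : ∀ y, 0 ≤ y → -(C * (1 + |y|)) ≤ V' y
  upper : ∀ y, y ≤ 0 → V' y ≤ C * (1 + |y|)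

theorem hasDerivAt_of_contDiffOn_two {f : ℝ → ℝ} {s : Set ℝ} (hs : IsOpen s)
    (hf : ContDiffOn ℝ 2 f s) {x : ℝ} (hx : x ∈ s) :
    HasDerivAt f (deriv f x) x ∧ HasDerivAt (deriv f) (deriv (deriv f) x) x := by
  have h2 : (2 : WithTop ℕ∞) = 1 + 1 := by norm_num
  rw [h2, contDiffOn_succ_iff_deriv_of_isOpen hs] at hf
  exact ⟨((hf.1 x hx).differentiableAt (hs.mem_nhds hx)).hasDerivAt,
    (((hf.2.2.differentiableOn (by norm_num)) x hx).differentiableAt (hs.mem_nhds hx)).hasDerivAt⟩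

section
variable {g : ℝ → ℝ}

theorem IsMobility.deriv_zero (hg : IsMobility g) : deriv g 0 = 0 := by
  refine IsLocalMax.deriv_eq_zero ?_
  filter_upwards [Ioo_mem_nhds (show (-1:ℝ) < 0 by norm_num) one_pos] with x hx
  rw [hg.map_zero]; exact hg.le_one x hx

/-- The lower curvature bound says that `g` is log-concave, so `g' / g` decreases, and it vanishes
at the maximum point `0`. -/
theorem IsMobility.deriv_nonpos (hg : IsMobility g) :
    (∀ x ∈ Ico (0:ℝ) 1, deriv g x ≤ 0) ∧ (∀ x ∈ Ioc (-1:ℝ) 0, 0 ≤ deriv g x) := by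
  obtain ⟨C, hC, hcurv⟩ := hg.curvature
  have hd := fun x hx => hasDerivAt_of_contDiffOn_two (x := x) isOpen_Ioo hg.contDiffOn hx
  have hder : ∀ x ∈ Ioo (-1:ℝ) 1, HasDerivAt (fun x => deriv g x / g x)
      ((deriv (deriv g) x * g x - deriv g x * deriv g x) / g x ^ 2) x := fun x hx =>
    (hd x hx).2.div (hd x hx).1 (hg.pos x hx).ne'
  have hanti : AntitoneOn (fun x => deriv g x / g x) (Ioo (-1) 1) := by
    refine antitoneOn_of_deriv_nonpos (convex_Ioo _ _)
      (fun s hs => (hder s hs).continuousAt.continuousWithinAt) ?_ ?_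
    · rw [interior_Ioo]
      exact fun s hs => (hder s hs).differentiableAt.differentiableWithinAt
    · rw [interior_Ioo]
      intro s hs
      rw [(hder s hs).deriv]
      refine div_nonpos_of_nonpos_of_nonneg ?_ (sq_nonneg _)
      have := (hcurv s hs).1
      nlinarith
  have h0 : (0:ℝ) ∈ Ioo (-1:ℝ) 1 := by norm_num
  constructor
  · intro x hx
    have hx' : x ∈ Ioo (-1:ℝ) 1 := ⟨by linarith [hx.1], hx.2⟩
    have := hanti h0 hx' hx.1
    simp only [hg.deriv_zero, zero_div] at this
    by_contra hcon
    exact absurd this (not_le.2 (div_pos (not_le.1 hcon) (hg.pos x hx')))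
  · intro x hx
    have hx' : x ∈ Ioo (-1:ℝ) 1 := ⟨hx.1, by linarith [hx.2]⟩
    have := hanti hx' h0 hx.2
    simp only [hg.deriv_zero, zero_div] at this
    by_contra hcon
    exact absurd this (not_le.2 (div_neg_of_neg_of_pos (not_le.1 hcon) (hg.pos x hx')))

theorem IsMobility.antitoneOn (hg : IsMobility g) : AntitoneOn g (Ico 0 1) := by
  have hd := fun x hx => hasDerivAt_of_contDiffOn_two (x := x) isOpen_Ioo hg.contDiffOn hx
  have hsub : ∀ x ∈ Ico (0:ℝ) 1, x ∈ Ioo (-1:ℝ) 1 := fun x hx => ⟨by linarith [hx.1], hx.2⟩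
  refine antitoneOn_of_deriv_nonpos (convex_Ico _ _)
      (fun s hs => (hd s (hsub s hs)).1.continuousAt.continuousWithinAt) ?_ ?_
  · rw [interior_Ico]
    exact fun s hs => (hd s (hsub s ⟨hs.1.le, hs.2⟩)).1.differentiableAt.differentiableWithinAt
  · rw [interior_Ico]
    exact fun s hs => hg.deriv_nonpos.1 s ⟨hs.1.le, hs.2⟩

theorem IsMobility.monotoneOn (hg : IsMobility g) : MonotoneOn g (Ioc (-1) 0) := by
  have hd := fun x hx => hasDerivAt_of_contDiffOn_two (x := x) isOpen_Ioo hg.contDiffOn hx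
  have hsub : ∀ x ∈ Ioc (-1:ℝ) 0, x ∈ Ioo (-1:ℝ) 1 := fun x hx => ⟨hx.1, by linarith [hx.2]⟩
  refine monotoneOn_of_deriv_nonneg (convex_Ioc _ _)
      (fun s hs => (hd s (hsub s hs)).1.continuousAt.continuousWithinAt) ?_ ?_
  · rw [interior_Ioc]
    exact fun s hs => (hd s (hsub s ⟨hs.1, hs.2.le⟩)).1.differentiableAt.differentiableWithinAt
  · rw [interior_Ioc]
    exact fun s hs => hg.deriv_nonpos.2 s ⟨hs.1, hs.2.le⟩

/-- The quotient `(g'² - C) / g²` has derivative `2 g' (C - (g'² - g g'')) / g³`, which has the sign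
of `g'`. It is therefore largest at `0`, with value `-C`, and `g'² ≤ C (1 - g²)`. -/
theorem IsMobility.exists_deriv_bound (hg : IsMobility g) :
    ∃ B : ℝ, 0 < B ∧ ∀ x ∈ Ioo (-1:ℝ) 1, |deriv g x| ≤ B := by
  obtain ⟨C, hC, hcurv⟩ := hg.curvature
  refine ⟨√C, Real.sqrt_pos.2 hC, fun x hx => Real.abs_le_sqrt ?_⟩
  have hd := fun x hx => hasDerivAt_of_contDiffOn_two (x := x) isOpen_Ioo hg.contDiffOn hx
  have hder : ∀ x ∈ Ioo (-1:ℝ) 1, HasDerivAt (fun x => (deriv g x ^ 2 - C) / g x ^ 2)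
      (2 * deriv g x * (g x * deriv (deriv g) x - deriv g x ^ 2 + C) / g x ^ 3) x := by
    intro x hx
    have h0 := (hg.pos x hx).ne'
    refine ((((hd x hx).2.pow 2).sub_const C).div ((hd x hx).1.pow 2)
      (pow_ne_zero 2 h0)).congr_deriv ?_
    simp only [Pi.pow_apply]
    field_simp
    ring
  have h0 : (fun x => (deriv g x ^ 2 - C) / g x ^ 2) 0 = - C := by
    simp [hg.deriv_zero, hg.map_zero]
  suffices h : (deriv g x ^ 2 - C) / g x ^ 2 ≤ -C by
    have hp := pow_pos (hg.pos x hx) 2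
    rw [div_le_iff₀ hp] at h
    nlinarith [mul_pos hC hp]
  rw [← h0]
  rcases le_total 0 x with hx0 | hx0
  · have hanti : AntitoneOn (fun x => (deriv g x ^ 2 - C) / g x ^ 2) (Ico 0 1) := by
      have hsub : ∀ x ∈ Ico (0:ℝ) 1, x ∈ Ioo (-1:ℝ) 1 := fun x hx => ⟨by linarith [hx.1], hx.2⟩
      refine antitoneOn_of_deriv_nonpos (convex_Ico _ _)
        (fun s hs => (hder s (hsub s hs)).continuousAt.continuousWithinAt) ?_ ?_
      · rw [interior_Ico]
        exact fun s hs => (hder s (hsub s ⟨hs.1.le, hs.2⟩)).differentiableAt.differentiableWithinAt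
      · rw [interior_Ico]
        intro s hs
        have hs' := hsub s ⟨hs.1.le, hs.2⟩
        rw [(hder s hs').deriv]
        refine div_nonpos_of_nonpos_of_nonneg ?_ (pow_pos (hg.pos s hs') 3).le
        have := hg.deriv_nonpos.1 s ⟨hs.1.le, hs.2⟩
        have := (hcurv s hs').2
        exact mul_nonpos_of_nonpos_of_nonneg (by linarith) (by linarith)
    exact hanti (by simp) ⟨hx0, hx.2⟩ hx0
  · have hmono : MonotoneOn (fun x => (deriv g x ^ 2 - C) / g x ^ 2) (Ioc (-1) 0) := by
      have hsub : ∀ x ∈ Ioc (-1:ℝ) 0, x ∈ Ioo (-1:ℝ) 1 := fun x hx => ⟨hx.1, by linarith [hx.2]⟩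
      refine monotoneOn_of_deriv_nonneg (convex_Ioc _ _)
        (fun s hs => (hder s (hsub s hs)).continuousAt.continuousWithinAt) ?_ ?_
      · rw [interior_Ioc]
        exact fun s hs => (hder s (hsub s ⟨hs.1, hs.2.le⟩)).differentiableAt.differentiableWithinAt
      · rw [interior_Ioc]
        intro s hs
        have hs' := hsub s ⟨hs.1, hs.2.le⟩
        rw [(hder s hs').deriv]
        refine div_nonneg ?_ (pow_pos (hg.pos s hs') 3).le
        have := hg.deriv_nonpos.2 s ⟨hs.1, hs.2.le⟩
        have := (hcurv s hs').2
        exact mul_nonneg (by linarith) (by linarith)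
    exact hmono ⟨hx.1, hx0⟩ (by simp) hx0

theorem IsMobility.hasDerivAt_alpha (hg : IsMobility g) {x : ℝ} (hx : x ∈ Ioo (-1:ℝ) 1) :
    HasDerivAt (alpha g) (1 / g x) x := by
  have hc : ContinuousOn (fun z => 1 / g z) (Ioo (-1) 1) :=
    continuousOn_const.div hg.contDiffOn.continuousOn (fun z hz => (hg.pos z hz).ne')
  refine intervalIntegral.integral_hasDerivAt_right ?_
    (hc.stronglyMeasurableAtFilter isOpen_Ioo x hx) (hc.continuousAt (Ioo_mem_nhds hx.1 hx.2))
  refine (hc.mono ?_).intervalIntegrable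
  exact ordConnected_Ioo.uIcc_subset (by norm_num) hx

theorem IsMobility.strictMonoOn_alpha (hg : IsMobility g) :
    StrictMonoOn (alpha g) (Ioo (-1) 1) := by
  refine strictMonoOn_of_deriv_pos (convex_Ioo _ _)
    (fun x hx => (hg.hasDerivAt_alpha hx).continuousAt.continuousWithinAt) ?_
  rw [interior_Ioo]
  intro x hx
  rw [(hg.hasDerivAt_alpha hx).deriv]
  exact one_div_pos.2 (hg.pos x hx)

theorem alpha_zero : alpha g 0 = 0 := by simp [alpha]

/-- Since `g` vanishes at both ends and `|g'| ≤ B`, it is at most `B` times the distance to either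
end. Thus `alpha` diverges at least logarithmically on both sides, and the intermediate value
theorem applies. -/
theorem IsMobility.surjOn_alpha (hg : IsMobility g) : SurjOn (alpha g) (Ioo (-1) 1) univ := by
  obtain ⟨B, hB, hgB⟩ := hg.exists_deriv_bound
  have hd := fun x hx => (hasDerivAt_of_contDiffOn_two (x := x) isOpen_Ioo hg.contDiffOn hx).1
  have hright : ∀ x ∈ Ioo (-1:ℝ) 1, g x ≤ B * (1 - x) := by
    have hmono : MonotoneOn (fun x => g x - B * (1 - x)) (Icc (-1) 1) := by
      have hder : ∀ x ∈ Ioo (-1:ℝ) 1, HasDerivAt (fun x => g x - B * (1 - x))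
          (deriv g x + B) x := fun x hx =>
        ((hd x hx).sub (((hasDerivAt_id x).const_sub 1).const_mul B)).congr_deriv (by ring)
      refine monotoneOn_of_deriv_nonneg (convex_Icc _ _)
        (hg.continuousOn.sub (by fun_prop)) ?_ ?_
      · rw [interior_Icc]
        exact fun s hs => (hder s hs).differentiableAt.differentiableWithinAt
      · rw [interior_Icc]
        intro s hs
        rw [(hder s hs).deriv]
        linarith [(abs_le.1 (hgB s hs)).1]
    intro x hx
    have := hmono ⟨hx.1.le, hx.2.le⟩ (show (1:ℝ) ∈ Icc (-1) 1 by norm_num) hx.2.le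
    simp only [hg.map_one] at this
    linarith
  have hleft : ∀ x ∈ Ioo (-1:ℝ) 1, g x ≤ B * (1 + x) := by
    have hmono : MonotoneOn (fun x => B * (1 + x) - g x) (Icc (-1) 1) := by
      have hder : ∀ x ∈ Ioo (-1:ℝ) 1, HasDerivAt (fun x => B * (1 + x) - g x)
          (B - deriv g x) x := fun x hx =>
        ((((hasDerivAt_id x).const_add 1).const_mul B).sub (hd x hx)).congr_deriv (by ring)
      refine monotoneOn_of_deriv_nonneg (convex_Icc _ _)
        (ContinuousOn.sub (by fun_prop) hg.continuousOn) ?_ ?_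
      · rw [interior_Icc]
        exact fun s hs => (hder s hs).differentiableAt.differentiableWithinAt
      · rw [interior_Icc]
        intro s hs
        rw [(hder s hs).deriv]
        linarith [(abs_le.1 (hgB s hs)).2]
    intro x hx
    have := hmono (show (-1:ℝ) ∈ Icc (-1) 1 by norm_num) ⟨hx.1.le, hx.2.le⟩ hx.1.le
    simp only [hg.map_neg_one] at this
    linarith
  have hR : ∀ x ∈ Ico (0:ℝ) 1, -(Real.log (1 - x) / B) ≤ alpha g x := by
    have hder : ∀ x ∈ Ioo (-1:ℝ) 1, HasDerivAt (fun x => alpha g x + Real.log (1 - x) / B)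
        (1 / g x - 1 / (B * (1 - x))) x := by
      intro x hx
      have h1 : 1 - x ≠ 0 := by linarith [hx.2]
      refine ((hg.hasDerivAt_alpha hx).add
        ((((hasDerivAt_id x).const_sub 1).log h1).div_const B)).congr_deriv ?_
      have h2 := (hg.pos x hx).ne'
      simp only [id]
      field_simp
      ring
    have hmono : MonotoneOn (fun x => alpha g x + Real.log (1 - x) / B) (Ioo (-1) 1) := by
      refine monotoneOn_of_deriv_nonneg (convex_Ioo _ _)
        (fun s hs => (hder s hs).continuousAt.continuousWithinAt) ?_ ?_
      · rw [interior_Ioo]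
        exact fun s hs => (hder s hs).differentiableAt.differentiableWithinAt
      · rw [interior_Ioo]
        intro s hs
        rw [(hder s hs).deriv]
        exact sub_nonneg.2 (one_div_le_one_div_of_le (hg.pos s hs) (hright s hs))
    intro x hx
    have := hmono (show (0:ℝ) ∈ Ioo (-1) 1 by norm_num)
      (show x ∈ Ioo (-1:ℝ) 1 from ⟨by linarith [hx.1], hx.2⟩) hx.1
    simp only [alpha_zero, sub_zero, Real.log_one, zero_div, add_zero] at this
    linarith
  have hL : ∀ x ∈ Ioc (-1:ℝ) 0, alpha g x ≤ Real.log (1 + x) / B := by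
    have hder : ∀ x ∈ Ioo (-1:ℝ) 1, HasDerivAt (fun x => alpha g x - Real.log (1 + x) / B)
        (1 / g x - 1 / (B * (1 + x))) x := by
      intro x hx
      have h1 : 1 + x ≠ 0 := by linarith [hx.1]
      refine ((hg.hasDerivAt_alpha hx).sub
        ((((hasDerivAt_id x).const_add 1).log h1).div_const B)).congr_deriv ?_
      have h2 := (hg.pos x hx).ne'
      simp only [id]
      field_simp
    have hmono : MonotoneOn (fun x => alpha g x - Real.log (1 + x) / B) (Ioo (-1) 1) := by
      refine monotoneOn_of_deriv_nonneg (convex_Ioo _ _)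
        (fun s hs => (hder s hs).continuousAt.continuousWithinAt) ?_ ?_
      · rw [interior_Ioo]
        exact fun s hs => (hder s hs).differentiableAt.differentiableWithinAt
      · rw [interior_Ioo]
        intro s hs
        rw [(hder s hs).deriv]
        exact sub_nonneg.2 (one_div_le_one_div_of_le (hg.pos s hs) (hleft s hs))
    intro x hx
    have := hmono (show x ∈ Ioo (-1:ℝ) 1 from ⟨hx.1, by linarith [hx.2]⟩)
      (show (0:ℝ) ∈ Ioo (-1) 1 by norm_num) hx.2
    simp only [alpha_zero, add_zero, Real.log_one, zero_div, sub_zero] at this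
    linarith
  intro y _
  -- Chosen so that `log e / B = -|y|`: the logarithmic bounds then place the images of `e - 1` and
  -- `1 - e` on either side of `y`.
  set e := Real.exp (-(B * |y|)) with he
  have he0 : 0 < e := Real.exp_pos _
  have he1 : e ≤ 1 := Real.exp_le_one_iff.2 (by have := mul_nonneg hB.le (abs_nonneg y); linarith)
  have hlog : Real.log e / B = -|y| := by
    rw [he, Real.log_exp]; field_simp
  have h1 := hR (1 - e) ⟨by linarith, by linarith⟩
  have h2 := hL (e - 1) ⟨by linarith, by linarith⟩
  rw [show 1 - (1 - e) = e by ring, hlog, neg_neg] at h1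
  rw [show 1 + (e - 1) = e by ring, hlog] at h2
  have hsub : Icc (e - 1) (1 - e) ⊆ Ioo (-1:ℝ) 1 := fun z hz =>
    ⟨by linarith [hz.1], by linarith [hz.2]⟩
  obtain ⟨x, hx, hxy⟩ := intermediate_value_Icc (show e - 1 ≤ 1 - e by linarith)
    (f := alpha g)
    (fun z hz => (hg.hasDerivAt_alpha (hsub hz)).continuousAt.continuousWithinAt)
    (show y ∈ Icc (alpha g (e - 1)) (alpha g (1 - e)) from
      ⟨h2.trans (neg_abs_le y), (le_abs_self y).trans h1⟩)
  exact ⟨x, hsub hx, hxy⟩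

theorem IsMobility.alphaInv_mem (hg : IsMobility g) (y : ℝ) : alphaInv g y ∈ Ioo (-1:ℝ) 1 :=
  Function.invFunOn_mem (hg.surjOn_alpha (mem_univ y))

theorem IsMobility.alpha_alphaInv (hg : IsMobility g) (y : ℝ) : alpha g (alphaInv g y) = y :=
  Function.invFunOn_eq (hg.surjOn_alpha (mem_univ y))

theorem IsMobility.alphaInv_alpha (hg : IsMobility g) {x : ℝ} (hx : x ∈ Ioo (-1:ℝ) 1) :
    alphaInv g (alpha g x) = x :=
  hg.strictMonoOn_alpha.injOn (hg.alphaInv_mem _) hx (hg.alpha_alphaInv _)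

theorem IsMobility.alphaInv_mono (hg : IsMobility g) : Monotone (alphaInv g) := by
  intro x y hxy
  rw [← hg.strictMonoOn_alpha.le_iff_le (hg.alphaInv_mem x) (hg.alphaInv_mem y),
    hg.alpha_alphaInv, hg.alpha_alphaInv]
  exact hxy

theorem IsMobility.alphaInv_zero (hg : IsMobility g) : alphaInv g 0 = 0 := by
  have := hg.alphaInv_alpha (x := 0) (by norm_num)
  rwa [alpha_zero] at this

theorem IsMobility.continuous_alphaInv (hg : IsMobility g) : Continuous (alphaInv g) := by
  rw [continuous_iff_continuousAt]
  intro y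
  refine continuousAt_of_monotoneOn_of_image_mem_nhds (s := univ)
    (hg.alphaInv_mono.monotoneOn _) univ_mem ?_
  have h := hg.alphaInv_mem y
  refine mem_of_superset (Ioo_mem_nhds h.1 h.2) ?_
  intro x hx
  exact ⟨alpha g x, mem_univ _, hg.alphaInv_alpha hx⟩

theorem IsMobility.hasDerivAt_alphaInv (hg : IsMobility g) (y : ℝ) :
    HasDerivAt (alphaInv g) (g (alphaInv g y)) y := by
  have h := HasDerivAt.of_local_left_inverse (hg.continuous_alphaInv.continuousAt (x := y))
    (hg.hasDerivAt_alpha (hg.alphaInv_mem y))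
    (one_div_ne_zero (hg.pos _ (hg.alphaInv_mem y)).ne')
    (Eventually.of_forall hg.alpha_alphaInv)
  simpa using h

theorem IsMobility.coeffRegular (hg : IsMobility g) : CoeffRegular (coeff g) where
  cont := by
    refine continuous_const.div ?_ (fun y => (hg.pos _ (hg.alphaInv_mem y)).ne')
    exact hg.contDiffOn.continuousOn.comp_continuous hg.continuous_alphaInv hg.alphaInv_mem
  one_le y := (one_le_div (hg.pos _ (hg.alphaInv_mem y))).2 (hg.le_one _ (hg.alphaInv_mem y))
  mono := by
    intro x hx y hy hxy
    refine one_div_le_one_div_of_le (hg.pos _ (hg.alphaInv_mem y)) (hg.antitoneOn ?_ ?_ ?_)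
    · exact ⟨by simpa [hg.alphaInv_zero] using hg.alphaInv_mono hx, (hg.alphaInv_mem x).2⟩
    · exact ⟨by simpa [hg.alphaInv_zero] using hg.alphaInv_mono hy, (hg.alphaInv_mem y).2⟩
    · exact hg.alphaInv_mono hxy
  anti := by
    intro x hx y hy hxy
    refine one_div_le_one_div_of_le (hg.pos _ (hg.alphaInv_mem x)) (hg.monotoneOn ?_ ?_ ?_)
    · exact ⟨(hg.alphaInv_mem x).1, by simpa [hg.alphaInv_zero] using hg.alphaInv_mono hx⟩
    · exact ⟨(hg.alphaInv_mem y).1, by simpa [hg.alphaInv_zero] using hg.alphaInv_mono hy⟩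
    · exact hg.alphaInv_mono hxy

/-- As `alphaInv` has derivative `g ∘ alphaInv`, the second derivative of the transformed potential
is exactly `g² W'' + g g' W'`. It is at least `l`, so `V' - l y` increases, and comparison with `y =
0` bounds the outward force `-V'` linearly on each half-line. -/
theorem IsPotential.exists_regular {W : ℝ → ℝ} (hg : IsMobility g) (hW : IsPotential g W) :
    ∃ (V' : ℝ → ℝ) (C : ℝ), PotentialRegular (potential g W) V' C := by
  obtain ⟨l, hl⟩ := hW.lower
  have hd := fun x hx => hasDerivAt_of_contDiffOn_two (x := x) isOpen_Ioo hg.contDiffOn hx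
  have hdW := fun x hx => hasDerivAt_of_contDiffOn_two (x := x) isOpen_Ioo hW.contDiffOn hx
  set V' : ℝ → ℝ := fun y => deriv W (alphaInv g y) * g (alphaInv g y) with hV'
  have hV1 : ∀ y, HasDerivAt (potential g W) (V' y) y := fun y =>
    (hdW _ (hg.alphaInv_mem y)).1.comp y (hg.hasDerivAt_alphaInv y)
  have hV2 : ∀ y, HasDerivAt V' ((g (alphaInv g y)) ^ 2 * deriv (deriv W) (alphaInv g y) +
      g (alphaInv g y) * deriv g (alphaInv g y) * deriv W (alphaInv g y)) y := fun y =>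
    ((((hdW _ (hg.alphaInv_mem y)).2.mul (hd _ (hg.alphaInv_mem y)).1).comp y
      (hg.hasDerivAt_alphaInv y))).congr_deriv (by ring)
  have hmono : Monotone (fun y => V' y - l * y) := by
    refine monotone_of_hasDerivAt_nonneg
      (fun y => ((hV2 y).sub ((hasDerivAt_id y).const_mul l))) ?_
    intro y
    have := hl _ (hg.alphaInv_mem y)
    simp only [Pi.zero_apply, mul_one]
    linarith
  refine ⟨V', |V' 0| + |l|, fun y => hW.nonneg _ (hg.alphaInv_mem y), hV1,
    continuous_iff_continuousAt.2 fun y => (hV2 y).continuousAt, by positivity, ?_, ?_⟩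
  · intro y hy
    have := hmono hy
    simp only [mul_zero, sub_zero] at this
    rw [abs_of_nonneg hy]
    nlinarith [neg_abs_le (V' 0), mul_le_mul_of_nonneg_right (neg_abs_le l) hy,
      mul_nonneg (abs_nonneg (V' 0)) hy, abs_nonneg l]
  · intro y hy
    have := hmono hy
    simp only [mul_zero, sub_zero] at this
    rw [abs_of_nonpos hy]
    nlinarith [le_abs_self (V' 0), mul_le_mul_of_nonpos_right (neg_abs_le l) hy,
      mul_nonneg (abs_nonneg (V' 0)) (neg_nonneg.2 hy), abs_nonneg l]
end
-- The Wasserstein distance and optimal plans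
open scoped NNReal in
-- The integral is the supremum of the integrals of the truncations `min c n`, each of which is
-- continuous for narrow convergence.
theorem lowerSemicontinuous_lintegral_probabilityMeasure {X : Type*} [TopologicalSpace X]
    [MeasurableSpace X] [OpensMeasurableSpace X] {c : X → ℝ≥0} (hc : Continuous c) :
    LowerSemicontinuous (fun γ : ProbabilityMeasure X => ∫⁻ x, (c x : ℝ≥0∞) ∂(γ : Measure X)) := by
  have hle : ∀ (n : ℕ) x y, dist (min (c x) (n : ℝ≥0)) (min (c y) (n : ℝ≥0)) ≤ n := by
    intro n x y
    rw [NNReal.dist_eq, abs_le]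
    have h1 : ((min (c x) (n : ℝ≥0) : ℝ≥0) : ℝ) ≤ n := by exact_mod_cast min_le_right _ _
    have h2 : ((min (c y) (n : ℝ≥0) : ℝ≥0) : ℝ) ≤ n := by exact_mod_cast min_le_right _ _
    have h3 := (min (c x) (n : ℝ≥0)).coe_nonneg
    have h4 := (min (c y) (n : ℝ≥0)).coe_nonneg
    constructor <;> linarith
  let f : ℕ → BoundedContinuousFunction X ℝ≥0 := fun n =>
    BoundedContinuousFunction.mkOfBound ⟨fun x => min (c x) n, hc.min continuous_const⟩ n (hle n)
  have h : (fun γ : ProbabilityMeasure X => ∫⁻ x, (c x : ℝ≥0∞) ∂(γ : Measure X)) =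
      fun γ : ProbabilityMeasure X => ⨆ n, ∫⁻ x, (f n x : ℝ≥0∞) ∂(γ : Measure X) := by
    ext γ
    rw [← lintegral_iSup]
    · refine lintegral_congr fun x => ?_
      apply le_antisymm
      · obtain ⟨n, hn⟩ := exists_nat_ge (c x)
        refine le_trans ?_ (le_iSup _ n)
        rw [show f n x = min (c x) n from rfl, min_eq_left hn]
      · exact iSup_le fun n => ENNReal.coe_le_coe.2 (min_le_left _ _)
    · exact fun n => (ENNReal.continuous_coe.comp (f n).continuous).measurable
    · intro n k hnk x
      exact ENNReal.coe_le_coe.2 (min_le_min le_rfl (by exact_mod_cast hnk))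
  rw [h]
  exact lowerSemicontinuous_iSup fun n =>
    (ProbabilityMeasure.continuous_lintegral_boundedContinuousFunction (f n)).lowerSemicontinuous

theorem W2sq_le {μ η : ProbabilityMeasure ℝ} {γ : Measure (ℝ × ℝ)}
    (h1 : γ.map Prod.fst = (μ : Measure ℝ)) (h2 : γ.map Prod.snd = (η : Measure ℝ)) :
    W2sq μ η ≤ ∫⁻ p, ENNReal.ofReal ((p.1 - p.2) ^ 2) ∂γ :=
  iInf_le_of_le γ (iInf_le_of_le h1 (iInf_le_of_le h2 le_rfl))

theorem W2sq_self (μ : ProbabilityMeasure ℝ) : W2sq μ μ = 0 := by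
  have hm : Measurable (fun x : ℝ => (x, x)) := by fun_prop
  have h1 : ((μ : Measure ℝ).map (fun x => (x, x))).map Prod.fst = (μ : Measure ℝ) := by
    rw [Measure.map_map measurable_fst hm]; exact Measure.map_id
  have h2 : ((μ : Measure ℝ).map (fun x => (x, x))).map Prod.snd = (μ : Measure ℝ) := by
    rw [Measure.map_map measurable_snd hm]; exact Measure.map_id
  refine le_antisymm ((W2sq_le h1 h2).trans ?_) bot_le
  rw [lintegral_map (by fun_prop) hm]
  simp

/-- The direct method: plans with given marginals form a closed and tight set, compact by
Prokhorov's theorem and nonempty because of the product plan, and the cost is lower semicontinuous.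
-/
theorem exists_optimal_plan (μ η : ProbabilityMeasure ℝ) :
    ∃ γ : Measure (ℝ × ℝ), IsProbabilityMeasure γ ∧ γ.map Prod.fst = (μ : Measure ℝ) ∧
      γ.map Prod.snd = (η : Measure ℝ) ∧
      ∫⁻ p, ENNReal.ofReal ((p.1 - p.2) ^ 2) ∂γ = W2sq μ η := by
  set A : Set (ProbabilityMeasure (ℝ × ℝ)) :=
    {γ | γ.map continuous_fst.measurable.aemeasurable = μ ∧
      γ.map continuous_snd.measurable.aemeasurable = η} with hA
  have hmem : ∀ γ : ProbabilityMeasure (ℝ × ℝ), γ ∈ A ↔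
      (γ : Measure (ℝ × ℝ)).map Prod.fst = (μ : Measure ℝ) ∧
      (γ : Measure (ℝ × ℝ)).map Prod.snd = (η : Measure ℝ) := by
    intro γ
    rw [hA, mem_ofPred_eq, ← ProbabilityMeasure.toMeasure_injective.eq_iff,
      ← ProbabilityMeasure.toMeasure_injective.eq_iff]
    rfl
  have hclosed : IsClosed A :=
    (isClosed_eq (ProbabilityMeasure.continuous_map continuous_fst) continuous_const).inter
      (isClosed_eq (ProbabilityMeasure.continuous_map continuous_snd) continuous_const)
  have htight : IsTightMeasureSet {((γ : ProbabilityMeasure (ℝ × ℝ)) : Measure (ℝ × ℝ)) | γ ∈ A} := by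
    rw [isTightMeasureSet_iff_exists_isCompact_measure_compl_le]
    intro ε hε
    have hε2 : 0 < ε / 2 := ENNReal.half_pos hε.ne'
    obtain ⟨K1, hK1, h1⟩ := isTightMeasureSet_iff_exists_isCompact_measure_compl_le.1
      (isTightMeasureSet_singleton (μ := (μ : Measure ℝ))) _ hε2
    obtain ⟨K2, hK2, h2⟩ := isTightMeasureSet_iff_exists_isCompact_measure_compl_le.1
      (isTightMeasureSet_singleton (μ := (η : Measure ℝ))) _ hε2
    refine ⟨K1 ×ˢ K2, hK1.prod hK2, ?_⟩
    rintro _ ⟨γ, hγ, rfl⟩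
    obtain ⟨hg1, hg2⟩ := (hmem γ).1 hγ
    have hsub : (K1 ×ˢ K2)ᶜ ⊆ (Prod.fst ⁻¹' K1ᶜ) ∪ (Prod.snd ⁻¹' K2ᶜ) := by
      rintro ⟨x, y⟩ h
      simp only [mem_compl_iff, mem_prod, not_and_or] at h
      exact h
    calc (γ : Measure (ℝ × ℝ)) (K1 ×ˢ K2)ᶜ
        ≤ (γ : Measure (ℝ × ℝ)) (Prod.fst ⁻¹' K1ᶜ) + (γ : Measure (ℝ × ℝ)) (Prod.snd ⁻¹' K2ᶜ) :=
          (measure_mono hsub).trans (measure_union_le _ _)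
      _ = (μ : Measure ℝ) K1ᶜ + (η : Measure ℝ) K2ᶜ := by
          rw [← hg1, ← hg2, Measure.map_apply measurable_fst hK1.measurableSet.compl,
            Measure.map_apply measurable_snd hK2.measurableSet.compl]
      _ ≤ ε / 2 + ε / 2 := add_le_add (h1 _ rfl) (h2 _ rfl)
      _ = ε := ENNReal.add_halves ε
  have hcomp : IsCompact A := by
    have := isCompact_closure_of_isTightMeasureSet htight
    rwa [hclosed.closure_eq] at this
  have hne : A.Nonempty := by
    refine ⟨⟨(μ : Measure ℝ).prod (η : Measure ℝ), inferInstance⟩, (hmem _).2 ?_⟩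
    simp
  have hcont : Continuous (fun p : ℝ × ℝ => ((p.1 - p.2) ^ 2).toNNReal) :=
    continuous_real_toNNReal.comp (by fun_prop)
  obtain ⟨γ, hγ, hmin⟩ := LowerSemicontinuousOn.exists_isMinOn hne hcomp
    ((lowerSemicontinuous_lintegral_probabilityMeasure hcont).lowerSemicontinuousOn A)
  obtain ⟨hg1, hg2⟩ := (hmem γ).1 hγ
  refine ⟨γ, inferInstance, hg1, hg2, le_antisymm ?_ (W2sq_le hg1 hg2)⟩
  refine le_iInf fun γ' => le_iInf fun h1 => le_iInf fun h2 => ?_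
  have : IsProbabilityMeasure γ' := by
    constructor
    have : γ'.map Prod.fst univ = 1 := by rw [h1]; exact measure_univ
    rwa [Measure.map_apply measurable_fst MeasurableSet.univ, preimage_univ] at this
  exact hmin (show (⟨γ', this⟩ : ProbabilityMeasure (ℝ × ℝ)) ∈ A from (hmem _).2 ⟨h1, h2⟩)

/-! ### Densities and the energy as an integral -/

section densities
variable {α : Type*} [MeasurableSpace α] {l : Measure α}

theorem toReal_rnDeriv_eq_zero_of_null {μ : Measure α} {t : Set α} (ht : MeasurableSet t)
    (h : μ t = 0) : ∀ᵐ y ∂l, y ∈ t → (μ.rnDeriv l y).toReal = 0 := by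
  have h1 : ∫⁻ y in t, μ.rnDeriv l y ∂l = 0 :=
    le_antisymm ((Measure.setLIntegral_rnDeriv_le t).trans h.le) bot_le
  rw [lintegral_eq_zero_iff (Measure.measurable_rnDeriv _ _), Filter.EventuallyEq,
    ae_restrict_iff' ht] at h1
  filter_upwards [h1] with y hy hyt
  rw [hy hyt]; rfl
variable [SigmaFinite l]

theorem toReal_rnDeriv_add (μ ν : Measure α) [IsFiniteMeasure μ] [IsFiniteMeasure ν] :
    ∀ᵐ y ∂l, ((μ + ν).rnDeriv l y).toReal = (μ.rnDeriv l y).toReal + (ν.rnDeriv l y).toReal := by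
  filter_upwards [Measure.rnDeriv_add μ ν l, Measure.rnDeriv_lt_top μ l,
    Measure.rnDeriv_lt_top ν l] with y hy h1 h2
  rw [hy, Pi.add_apply, ENNReal.toReal_add h1.ne h2.ne]

theorem toReal_rnDeriv_smul (μ : Measure α) [IsFiniteMeasure μ] {s : ℝ} (hs : 0 ≤ s) :
    ∀ᵐ y ∂l, ((ENNReal.ofReal s • μ).rnDeriv l y).toReal = s * (μ.rnDeriv l y).toReal := by
  filter_upwards [Measure.rnDeriv_smul_left_of_ne_top μ l (ENNReal.ofReal_ne_top (r := s))]
    with y hy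
  rw [hy, Pi.smul_apply, smul_eq_mul, ENNReal.toReal_mul, ENNReal.toReal_ofReal hs]

theorem toReal_rnDeriv_mono {μ ν : Measure α} [IsFiniteMeasure μ] [IsFiniteMeasure ν]
    (h : μ ≤ ν) : ∀ᵐ y ∂l, (μ.rnDeriv l y).toReal ≤ (ν.rnDeriv l y).toReal := by
  filter_upwards [toReal_rnDeriv_add (l := l) (ν - μ) μ] with y hy
  rw [Measure.sub_add_cancel_of_le h] at hy
  rw [hy]
  linarith [ENNReal.toReal_nonneg (a := (ν - μ).rnDeriv l y)]

end densities

theorem measurable_density (μ : ProbabilityMeasure ℝ) : Measurable (density μ) :=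
  (Measure.measurable_rnDeriv _ _).ennreal_toReal

theorem density_nonneg (μ : ProbabilityMeasure ℝ) (y : ℝ) : 0 ≤ density μ y :=
  ENNReal.toReal_nonneg

theorem withDensity_density {μ : ProbabilityMeasure ℝ} (h : (μ : Measure ℝ) ≪ volume) :
    (μ : Measure ℝ) = volume.withDensity (fun y => ENNReal.ofReal (density μ y)) := by
  conv_lhs => rw [← Measure.withDensity_rnDeriv_eq _ _ h]
  refine withDensity_congr_ae ?_
  filter_upwards [Measure.rnDeriv_lt_top (μ : Measure ℝ) volume] with y hy
  rw [density, ENNReal.ofReal_toReal hy.ne]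

theorem lintegral_density {μ : ProbabilityMeasure ℝ} (h : (μ : Measure ℝ) ≪ volume)
    {f : ℝ → ℝ≥0∞} (hf : Measurable f) :
    ∫⁻ y, f y ∂(μ : Measure ℝ) = ∫⁻ y, ENNReal.ofReal (density μ y) * f y := by
  conv_lhs => rw [withDensity_density h]
  rw [lintegral_withDensity_eq_lintegral_mul _ (measurable_density μ).ennreal_ofReal hf]
  rfl

section
variable {m c K : ℝ} {φ D S Q : ℝ → ℝ} {g W : ℝ → ℝ}

theorem EnergyDual.measurable_phi_comp (hd : EnergyDual m φ D S Q c K) {f : ℝ → ℝ}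
    (hf : Measurable f) (h0 : ∀ y, 0 ≤ f y) : Measurable (fun y => φ (f y)) := by
  have h1 : Continuous (fun x => φ (max x 0)) :=
    hd.phi_cont.comp_continuous (by fun_prop) (fun x => show (0 : ℝ) ≤ max x 0 from le_max_right _ _)
  have h2 : (fun y => φ (f y)) = (fun x => φ (max x 0)) ∘ f := by
    ext y
    simp [max_eq_left (h0 y)]
  rw [h2]
  exact h1.measurable.comp hf

/-- The integrand of the energy. -/
noncomputable def energyDensity (g φ W : ℝ → ℝ) (μ : ProbabilityMeasure ℝ) (y : ℝ) : ℝ :=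
  φ (coeff g y * density μ y) / coeff g y + potential g W y * density μ y

theorem energyDensity_nonneg (hd : EnergyDual m φ D S Q c K) (ha : CoeffRegular (coeff g))
    (hV0 : ∀ y, 0 ≤ potential g W y) (μ : ProbabilityMeasure ℝ) (y : ℝ) :
    0 ≤ energyDensity g φ W μ y := by
  have h1 : 0 < coeff g y := one_pos.trans_le (ha.one_le y)
  exact add_nonneg (div_nonneg (hd.phi_nonneg _ (mul_nonneg h1.le (density_nonneg μ y))) h1.le)
    (mul_nonneg (hV0 y) (density_nonneg μ y))

theorem measurable_energyDensity (hd : EnergyDual m φ D S Q c K) (ha : CoeffRegular (coeff g))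
    (hV : Continuous (potential g W)) (μ : ProbabilityMeasure ℝ) :
    Measurable (energyDensity g φ W μ) := by
  have hu : Measurable (fun y => coeff g y * density μ y) :=
    ha.cont.measurable.mul (measurable_density μ)
  refine Measurable.add (Measurable.div ?_ ha.cont.measurable)
    (hV.measurable.mul (measurable_density μ))
  exact hd.measurable_phi_comp hu (fun y =>
    mul_nonneg (zero_le_one.trans (ha.one_le y)) (density_nonneg μ y))

theorem energy_eq_lintegral (hd : EnergyDual m φ D S Q c K) (ha : CoeffRegular (coeff g))
    (hV : Continuous (potential g W)) (hV0 : ∀ y, 0 ≤ potential g W y)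
    {μ : ProbabilityMeasure ℝ} (h : (μ : Measure ℝ) ≪ volume) :
    energy g φ W μ = ∫⁻ y, ENNReal.ofReal (energyDensity g φ W μ y) := by
  rw [energy, if_pos h, ← lintegral_add_right]
  · refine lintegral_congr fun y => ?_
    have h1 : 0 < coeff g y := one_pos.trans_le (ha.one_le y)
    rw [energyDensity, ENNReal.ofReal_add]
    · exact div_nonneg (hd.phi_nonneg _ (mul_nonneg h1.le (density_nonneg μ y))) h1.le
    · exact mul_nonneg (hV0 y) (density_nonneg μ y)
  · exact (hV.measurable.mul (measurable_density μ)).ennreal_ofReal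

theorem absolutelyContinuous_of_energy {μ : ProbabilityMeasure ℝ} (h : energy g φ W μ < ⊤) :
    (μ : Measure ℝ) ≪ volume := by
  by_contra hcon
  rw [energy, if_neg hcon] at h
  exact lt_irrefl _ h

theorem integrable_energyDensity (hd : EnergyDual m φ D S Q c K) (ha : CoeffRegular (coeff g))
    (hV : Continuous (potential g W)) (hV0 : ∀ y, 0 ≤ potential g W y)
    {μ : ProbabilityMeasure ℝ} (h : energy g φ W μ < ⊤) :
    Integrable (energyDensity g φ W μ) := by
  refine ⟨(measurable_energyDensity hd ha hV μ).aestronglyMeasurable, ?_⟩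
  rw [hasFiniteIntegral_iff_ofReal (ae_of_all _ (energyDensity_nonneg hd ha hV0 μ)),
    ← energy_eq_lintegral hd ha hV hV0 (absolutelyContinuous_of_energy h)]
  exact h
end

/-! ### First variation of the penalised energy -/

section
variable {m c K : ℝ} {φ D S Q : ℝ → ℝ} {g W : ℝ → ℝ}

/-- Moving the mass `s α` of `ρ` to `s β` changes the energy by at most
`s (∫ F dβ - ∫ F dα) + o(s)`, where `F = φ'(a ρ) + V`. -/
theorem energy_variation (hd : EnergyDual m φ D S Q c K) (ha : CoeffRegular (coeff g))
    (hV : Continuous (potential g W)) (hV0 : ∀ y, 0 ≤ potential g W y)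
    {ρ : ProbabilityMeasure ℝ} (hE : energy g φ W ρ < ⊤)
    {α β : Measure ℝ} [IsFiniteMeasure α] [IsFiniteMeasure β] {N : ℝ} (hN : 0 < N)
    (hα : α ≤ ENNReal.ofReal N • (ρ : Measure ℝ)) (hβ : β ≤ volume)
    (hαN : ∀ᵐ y ∂α, |y| ≤ N ∧ coeff g y * density ρ y ≤ N)
    (hβN : ∀ᵐ y ∂β, |y| ≤ N ∧ coeff g y * density ρ y ≤ N)
    {s : ℕ → ℝ} (hs0 : ∀ j, 0 < s j) (hs1 : ∀ j, s j ≤ 1) (hs : Tendsto s atTop (𝓝 0))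
    {μ : ℕ → ProbabilityMeasure ℝ}
    (hμ : ∀ j, (μ j : Measure ℝ) + ENNReal.ofReal (s j) • α =
      (ρ : Measure ℝ) + ENNReal.ofReal (s j) • β) :
    ∃ k : ℕ → ℝ, Tendsto k atTop
        (𝓝 (∫ y, (D (coeff g y * density ρ y) + potential g W y) ∂β -
          ∫ y, (D (coeff g y * density ρ y) + potential g W y) ∂α)) ∧
      ∀ j, energy g φ W (μ j) < ⊤ ∧
        ∫ y, energyDensity g φ W (μ j) y ≤ (∫ y, energyDensity g φ W ρ y) + s j * k j := by
  have hρac := absolutelyContinuous_of_energy hE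
  have hβac : β ≪ volume := Measure.absolutelyContinuous_of_le hβ
  have hαac : α ≪ volume :=
    (Measure.absolutelyContinuous_of_le hα).trans (hρac.smul_left _)
  have hμac : ∀ j, (μ j : Measure ℝ) ≪ volume := fun j => by
    have h1 : (μ j : Measure ℝ) ≤ (ρ : Measure ℝ) + ENNReal.ofReal (s j) • β := by
      rw [← hμ j]; exact Measure.le_add_right le_rfl
    exact (Measure.absolutelyContinuous_of_le h1).trans (hρac.add_left (hβac.smul_left _))
  set A : ℝ → ℝ := fun y => (α.rnDeriv volume y).toReal with hA
  set B : ℝ → ℝ := fun y => (β.rnDeriv volume y).toReal with hB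
  set r := density ρ with hr
  set a := coeff g with hadef
  set V := potential g W with hVdef
  have hAm : Measurable A := (Measure.measurable_rnDeriv _ _).ennreal_toReal
  have hBm : Measurable B := (Measure.measurable_rnDeriv _ _).ennreal_toReal
  have hrm : Measurable r := measurable_density ρ
  have ham : Measurable a := ha.cont.measurable
  have ha0 : ∀ y, 0 < a y := fun y => one_pos.trans_le (ha.one_le y)
  have hA0 : ∀ y, 0 ≤ A y := fun y => ENNReal.toReal_nonneg
  have hB0 : ∀ y, 0 ≤ B y := fun y => ENNReal.toReal_nonneg
  have hr0 : ∀ y, 0 ≤ r y := density_nonneg ρ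
  -- Both `α` and `β` are carried by this set, on which `D (a ρ) + V` is bounded; their densities
  -- vanish off it.
  set Kset : Set ℝ := {y | |y| ≤ N ∧ a y * r y ≤ N} with hK
  have hKm : MeasurableSet Kset :=
    (measurableSet_le measurable_norm measurable_const).inter
      (measurableSet_le (ham.mul hrm) measurable_const)
  have hrel : ∀ᵐ y, ∀ j, density (μ j) y + s j * A y = r y + s j * B y := by
    rw [ae_all_iff]
    intro j
    have : IsFiniteMeasure (ENNReal.ofReal (s j) • α) := Measure.smul_finite _ ENNReal.ofReal_ne_top
    have : IsFiniteMeasure (ENNReal.ofReal (s j) • β) := Measure.smul_finite _ ENNReal.ofReal_ne_top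
    filter_upwards [toReal_rnDeriv_add (l := volume) (μ j : Measure ℝ) (ENNReal.ofReal (s j) • α),
      toReal_rnDeriv_add (l := volume) (ρ : Measure ℝ) (ENNReal.ofReal (s j) • β),
      toReal_rnDeriv_smul (l := volume) α (hs0 j).le,
      toReal_rnDeriv_smul (l := volume) β (hs0 j).le] with y h1 h2 h3 h4
    rw [hμ j, h2, h3, h4] at h1
    exact h1.symm
  have hAN : ∀ᵐ y, A y ≤ N * r y := by
    have : IsFiniteMeasure (ENNReal.ofReal N • (ρ : Measure ℝ)) :=
      Measure.smul_finite _ ENNReal.ofReal_ne_top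
    filter_upwards [toReal_rnDeriv_mono (l := volume) hα,
      toReal_rnDeriv_smul (l := volume) (ρ : Measure ℝ) hN.le] with y h1 h2
    rw [h2] at h1
    exact h1
  have hB1 : ∀ᵐ y, B y ≤ 1 := by
    filter_upwards [Measure.rnDeriv_le_one_of_le hβ] with y hy
    exact ENNReal.toReal_le_of_le_ofReal zero_le_one (by simpa using hy)
  have hAK : ∀ᵐ y, y ∈ Ksetᶜ → A y = 0 :=
    toReal_rnDeriv_eq_zero_of_null hKm.compl hαN
  have hBK : ∀ᵐ y, y ∈ Ksetᶜ → B y = 0 :=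
    toReal_rnDeriv_eq_zero_of_null hKm.compl hβN
  obtain ⟨a1, ha1⟩ := (isCompact_Icc (a := -N) (b := N)).bddAbove_image ha.cont.continuousOn
  obtain ⟨V1, hV1⟩ := (isCompact_Icc (a := -N) (b := N)).bddAbove_image hV.continuousOn
  have ha1' : ∀ y, |y| ≤ N → a y ≤ a1 := fun y hy => ha1 (mem_image_of_mem _ (abs_le.1 hy))
  have hV1' : ∀ y, |y| ≤ N → V y ≤ V1 := fun y hy => hV1 (mem_image_of_mem _ (abs_le.1 hy))
  set F : ℕ → ℝ → ℝ := fun j y => D (a y * density (μ j) y) + V y with hF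
  set F0 : ℝ → ℝ := fun y => D (a y * r y) + V y with hF0
  have hFm : ∀ j, Measurable (F j) := fun j =>
    (hd.D_cont.measurable.comp (ham.mul (measurable_density _))).add hV.measurable
  have hF0m : Measurable F0 :=
    (hd.D_cont.measurable.comp (ham.mul hrm)).add hV.measurable
  -- On `Kset` the competitors have density at most `N + 1`, because `s j ≤ 1` and `β` has density
  -- at most `1`. Monotonicity of `D` then bounds all the chemical potentials by `M`.
  set M : ℝ := |D 0| + |D (a1 * (N + 1))| + |V1| with hM
  have hMbound : ∀ y x, |y| ≤ N → 0 ≤ x → x ≤ a1 * (N + 1) → |D x + V y| ≤ M := by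
    intro y x hy hx0 hx
    have h1 := hd.D_mono.monotone hx0
    have h2 := hd.D_mono.monotone hx
    have h3 := hV1' y hy
    have h4 := hV0 y
    rw [abs_le]
    constructor
    · linarith [neg_abs_le (D 0), abs_nonneg (D (a1 * (N + 1))), abs_nonneg V1]
    · linarith [le_abs_self V1, abs_nonneg (D 0), le_abs_self (D (a1 * (N + 1)))]
  have hM0 : 0 ≤ M := by positivity
  set bound : ℝ → ℝ := (Icc (-N) N).indicator (fun _ => M * (1 + N * N)) with hbound
  have hboundint : Integrable bound :=
    (integrable_indicator_iff measurableSet_Icc).2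
      (integrableOn_const measure_Icc_lt_top.ne ENNReal.coe_ne_top)
  have hBA : ∀ᵐ y, y ∈ Kset → |B y - A y| ≤ 1 + N * N := by
    filter_upwards [hAN, hB1] with y h1 h2 hy
    have h3 : r y ≤ N := by
      have := mul_le_mul_of_nonneg_right (ha.one_le y) (hr0 y)
      linarith [hy.2]
    have h4 := mul_le_mul_of_nonneg_left h3 hN.le
    rw [abs_le]
    constructor <;> nlinarith [hA0 y, hB0 y]
  have hkbound : ∀ j, ∀ᵐ y, |F j y * (B y - A y)| ≤ bound y := by
    intro j
    filter_upwards [hrel, hB1, hAK, hBK, hBA] with y h1 h2 h3 h4 h5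
    by_cases hy : y ∈ Kset
    · have hyI : y ∈ Icc (-N) N := abs_le.1 hy.1
      rw [hbound, indicator_of_mem hyI, abs_mul]
      refine mul_le_mul ?_ (h5 hy) (abs_nonneg _) hM0
      refine hMbound y _ hy.1 (mul_nonneg (ha0 y).le (density_nonneg _ _)) ?_
      have h6 : r y ≤ N := by
        have := mul_le_mul_of_nonneg_right (ha.one_le y) (hr0 y)
        linarith [hy.2]
      have h7 : density (μ j) y ≤ N + 1 := by
        have := h1 j
        have h8 : s j * B y ≤ 1 := mul_le_one₀ (hs1 j) (hB0 y) h2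
        have h9 := mul_nonneg (hs0 j).le (hA0 y)
        linarith
      exact mul_le_mul (ha1' y hy.1) h7 (density_nonneg _ _) ((ha0 y).le.trans (ha1' y hy.1))
    · rw [h3 hy, h4 hy]
      simp only [sub_self, mul_zero, abs_zero, hbound]
      exact indicator_nonneg (fun _ _ => by positivity) y
  have hlimpt : ∀ᵐ y, Tendsto (fun j => F j y * (B y - A y)) atTop (𝓝 (F0 y * (B y - A y))) := by
    filter_upwards [hrel] with y h1
    have h2 : Tendsto (fun j => density (μ j) y) atTop (𝓝 (r y)) := by
      have h3 : (fun j => density (μ j) y) = fun j => r y + s j * (B y - A y) := by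
        ext j; linarith [h1 j]
      rw [h3]
      simpa using (hs.mul_const (B y - A y)).const_add (r y)
    exact ((((hd.D_cont.tendsto _).comp (h2.const_mul (a y)))).add_const _).mul_const _
  have hkint : ∀ j, Integrable (fun y => F j y * (B y - A y)) := fun j =>
    hboundint.mono' ((hFm j).mul (hBm.sub hAm)).aestronglyMeasurable (hkbound j)
  have hlim : Tendsto (fun j => ∫ y, F j y * (B y - A y)) atTop
      (𝓝 (∫ y, F0 y * (B y - A y))) := tendsto_integral_of_dominated_convergence bound
    (fun j => ((hFm j).mul (hBm.sub hAm)).aestronglyMeasurable) hboundint hkbound hlimpt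
  refine ⟨fun j => ∫ y, F j y * (B y - A y), ?_, ?_⟩
  · have hFbd : ∀ y ∈ Kset, |F0 y| ≤ M := by
      intro y hy
      refine hMbound y _ hy.1 (mul_nonneg (ha0 y).le (hr0 y)) ?_
      have h6 : r y ≤ N := by
        have := mul_le_mul_of_nonneg_right (ha.one_le y) (hr0 y)
        linarith [hy.2]
      exact mul_le_mul (ha1' y hy.1) (by linarith) (hr0 y) ((ha0 y).le.trans (ha1' y hy.1))
    have hFα : Integrable F0 α :=
      Integrable.of_bound hF0m.aestronglyMeasurable M (hαN.mono fun y hy => hFbd y hy)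
    have hFβ : Integrable F0 β :=
      Integrable.of_bound hF0m.aestronglyMeasurable M (hβN.mono fun y hy => hFbd y hy)
    have e1 := integral_rnDeriv_smul hαac (f := F0)
    have e2 := integral_rnDeriv_smul hβac (f := F0)
    have i1 := (integrable_rnDeriv_smul_iff hαac (f := F0)).2 hFα
    have i2 := (integrable_rnDeriv_smul_iff hβac (f := F0)).2 hFβ
    rw [← e1, ← e2, ← integral_sub i2 i1]
    convert hlim using 2
    refine integral_congr_ae (ae_of_all _ fun y => ?_)
    simp only [smul_eq_mul, hA, hB]
    ring
  · intro j
    have hpt : ∀ᵐ y, energyDensity g φ W (μ j) y ≤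
        energyDensity g φ W ρ y + s j * (F j y * (B y - A y)) := by
      filter_upwards [hrel] with y h1
      have h2 : density (μ j) y - r y = s j * (B y - A y) := by linarith [h1 j]
      -- Convexity bounds the increase of `φ` from above only with the slope at the new density.
      -- This is why the integrals involve `F j`, and `F0` appears only in the limit.
      have h3 := hd.subgrad (a y * density (μ j) y) (a y * r y)
        (mul_nonneg (ha0 y).le (density_nonneg _ _)) (mul_nonneg (ha0 y).le (hr0 y))
      rw [← mul_sub, h2] at h3
      have h4 : φ (a y * density (μ j) y) / a y ≤ φ (a y * r y) / a y +
          D (a y * density (μ j) y) * (s j * (B y - A y)) := by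
        rw [div_add' _ _ _ (ha0 y).ne']
        refine div_le_div_of_nonneg_right ?_ (ha0 y).le
        linarith
      have h5 : V y * density (μ j) y = V y * r y + V y * (s j * (B y - A y)) := by
        rw [← h2]; ring
      simp only [energyDensity, hF]
      change φ (a y * density (μ j) y) / a y + V y * density (μ j) y ≤
        φ (a y * r y) / a y + V y * r y + _
      rw [h5]
      linarith
    have hint := (integrable_energyDensity hd ha hV hV0 hE).add ((hkint j).const_mul (s j))
    have hnn := energyDensity_nonneg hd ha hV0 (μ j)
    have hintj : Integrable (energyDensity g φ W (μ j)) := by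
      refine hint.mono' (measurable_energyDensity hd ha hV _).aestronglyMeasurable ?_
      filter_upwards [hpt] with y hy
      rw [Real.norm_of_nonneg (hnn y)]
      exact hy
    constructor
    · rw [energy_eq_lintegral hd ha hV hV0 (hμac j),
        ← ofReal_integral_eq_lintegral_ofReal hintj (ae_of_all _ hnn)]
      exact ENNReal.ofReal_lt_top
    · rw [← integral_const_mul, ← integral_add (integrable_energyDensity hd ha hV hV0 hE)
        ((hkint j).const_mul (s j))]
      exact integral_mono_ae hintj hint hpt
end

section
variable {m c K : ℝ} {φ D S Q : ℝ → ℝ} {g W : ℝ → ℝ}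

theorem EnergyDual.exists_bound_chemical (hd : EnergyDual m φ D S Q c K)
    {V : ℝ → ℝ} (hV : Continuous V) (N : ℝ) :
    ∃ M, ∀ y x, |y| ≤ N → 0 ≤ x → x ≤ N → |D x + V y| ≤ M := by
  have hc : Continuous (fun p : ℝ × ℝ => D p.1 + V p.2) :=
    (hd.D_cont.comp continuous_fst).add (hV.comp continuous_snd)
  obtain ⟨M, hM⟩ := ((isCompact_Icc (a := 0) (b := N)).prod
    (isCompact_Icc (a := -N) (b := N))).exists_bound_of_continuousOn hc.continuousOn
  exact ⟨M, fun y x hy h0 hx => hM (x, y) ⟨⟨h0, hx⟩, abs_le.1 hy⟩⟩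

/-- The first variation of the penalised energy when mass at `x.1.1` (coupled to `x.1.2`) is
moved to `x.2` with intensity `ω`. -/
noncomputable def transferCost (D V u : ℝ → ℝ) (τ : ℝ) (x : (ℝ × ℝ) × ℝ) : ℝ :=
  (D (u x.2) + V x.2) - (D (u x.1.1) + V x.1.1) +
    ((x.2 - x.1.2) ^ 2 - (x.1.1 - x.1.2) ^ 2) / (2 * τ)

theorem measurable_transferCost {V u : ℝ → ℝ} (hD : Measurable D) (hV : Measurable V)
    (hu : Measurable u) (τ : ℝ) : Measurable (transferCost D V u τ) := by
  unfold transferCost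
  fun_prop

/-- The measure `ω` prescribes which coupled pairs of `γ` have their first point moved, and where.
Replacing the share `s ω1` of `γ` by `s ω2` keeps the second marginal, so the result is a plan
between a competitor and `η`. Minimality, divided by `s` as `s → 0`, gives the sign. The box keeps
all integrands bounded. -/
theorem first_variation_nonneg (hd : EnergyDual m φ D S Q c K) (ha : CoeffRegular (coeff g))
    (hV : Continuous (potential g W)) (hV0 : ∀ y, 0 ≤ potential g W y)
    {ρ η : ProbabilityMeasure ℝ} (hρ2 : FiniteSecondMoment ρ) (hE : energy g φ W ρ < ⊤)
    {τ : ℝ} (hτ : 0 < τ)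
    (hmin : ∀ μ, FiniteSecondMoment μ → penalized g φ W τ ρ η ≤ penalized g φ W τ μ η)
    {γ : Measure (ℝ × ℝ)} [IsProbabilityMeasure γ] (hγ1 : γ.map Prod.fst = (ρ : Measure ℝ))
    (hγ2 : γ.map Prod.snd = (η : Measure ℝ))
    (hopt : ∫⁻ p, ENNReal.ofReal ((p.1 - p.2) ^ 2) ∂γ = W2sq ρ η) (hfin : W2sq ρ η < ⊤)
    {ω : Measure ((ℝ × ℝ) × ℝ)} [IsFiniteMeasure ω] {N : ℝ} (hN : 0 < N)
    (hω1 : ω.map Prod.fst ≤ ENNReal.ofReal N • γ) (hω2 : ω.map Prod.snd ≤ volume)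
    (hbox : ∀ᵐ x ∂ω, |x.1.1| ≤ N ∧ |x.1.2| ≤ N ∧ |x.2| ≤ N ∧
      coeff g x.1.1 * density ρ x.1.1 ≤ N ∧ coeff g x.2 * density ρ x.2 ≤ N) :
    Integrable (transferCost D (potential g W) (fun y => coeff g y * density ρ y) τ) ω ∧
    0 ≤ ∫ x, transferCost D (potential g W) (fun y => coeff g y * density ρ y) τ x ∂ω := by
  set u : ℝ → ℝ := fun y => coeff g y * density ρ y with hu
  set V := potential g W with hVdef
  have hum : Measurable u := ha.cont.measurable.mul (measurable_density ρ)
  have hu0 : ∀ y, 0 ≤ u y := fun y =>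
    mul_nonneg (zero_le_one.trans (ha.one_le y)) (density_nonneg ρ y)
  set F : ℝ → ℝ := fun y => D (u y) + V y with hF
  have hFm : Measurable F := (hd.D_cont.measurable.comp hum).add hV.measurable
  set e1 : (ℝ × ℝ) × ℝ → ℝ × ℝ := fun x => (x.2, x.1.2) with he1
  have he1m : Measurable e1 := by fun_prop
  have hfst : Measurable (fun x : (ℝ × ℝ) × ℝ => x.1.1) := by fun_prop
  set ω1 := ω.map Prod.fst with hω1def
  set ω2 := ω.map e1 with hω2def
  set α := ω.map (fun x => x.1.1) with hα
  set β := ω.map Prod.snd with hβ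
  have hω1fst : ω1.map Prod.fst = α := by
    rw [hω1def, Measure.map_map measurable_fst measurable_fst]; rfl
  have hω2fst : ω2.map Prod.fst = β := by
    rw [hω2def, Measure.map_map measurable_fst he1m]; rfl
  have hω12snd : ω1.map Prod.snd = ω2.map Prod.snd := by
    rw [hω1def, hω2def, Measure.map_map measurable_snd measurable_fst,
      Measure.map_map measurable_snd he1m]; rfl
  have : IsFiniteMeasure ω1 := Measure.isFiniteMeasure_map _ _
  have : IsFiniteMeasure ω2 := Measure.isFiniteMeasure_map _ _
  have : IsFiniteMeasure α := Measure.isFiniteMeasure_map _ _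
  have : IsFiniteMeasure β := Measure.isFiniteMeasure_map _ _
  -- bounds on the box
  obtain ⟨M, hM⟩ := hd.exists_bound_chemical hV N
  have hFi1 : Integrable (fun x : (ℝ × ℝ) × ℝ => F x.1.1) ω :=
    Integrable.of_bound (hFm.comp hfst).aestronglyMeasurable M
      (hbox.mono fun x hx => hM _ _ hx.1 (hu0 _) hx.2.2.2.1)
  have hFi2 : Integrable (fun x : (ℝ × ℝ) × ℝ => F x.2) ω :=
    Integrable.of_bound (hFm.comp measurable_snd).aestronglyMeasurable M
      (hbox.mono fun x hx => hM _ _ hx.2.2.1 (hu0 _) hx.2.2.2.2)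
  have hsqb : ∀ p z : ℝ, |p| ≤ N → |z| ≤ N → ‖(p - z) ^ 2‖ ≤ (2 * N) ^ 2 := by
    intro p z hp hz
    rw [Real.norm_of_nonneg (sq_nonneg _), ← sq_abs (p - z)]
    have h1 : |p - z| ≤ 2 * N := (abs_sub p z).trans (by linarith)
    exact pow_le_pow_left₀ (abs_nonneg _) h1 2
  have hci1 : Integrable (fun x : (ℝ × ℝ) × ℝ => (x.1.1 - x.1.2) ^ 2) ω :=
    Integrable.of_bound (Measurable.aestronglyMeasurable (by fun_prop)) ((2 * N) ^ 2)
      (hbox.mono fun x hx => hsqb _ _ hx.1 hx.2.1)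
  have hci2 : Integrable (fun x : (ℝ × ℝ) × ℝ => (x.2 - x.1.2) ^ 2) ω :=
    Integrable.of_bound (Measurable.aestronglyMeasurable (by fun_prop)) ((2 * N) ^ 2)
      (hbox.mono fun x hx => hsqb _ _ hx.2.2.1 hx.2.1)
  have hGint : Integrable (transferCost D V u τ) ω :=
    (hFi2.sub hFi1).add ((hci2.sub hci1).div_const _)
  refine ⟨hGint, ?_⟩
  set cost : ℝ × ℝ → ℝ := fun p => (p.1 - p.2) ^ 2 with hcost
  have hcostm : Measurable cost := by fun_prop
  have hcost0 : ∀ p, 0 ≤ cost p := fun p => sq_nonneg _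
  have hcω1 : Integrable cost ω1 :=
    (integrable_map_measure hcostm.aestronglyMeasurable measurable_fst.aemeasurable).2 hci1
  have hcω2 : Integrable cost ω2 :=
    (integrable_map_measure hcostm.aestronglyMeasurable he1m.aemeasurable).2 hci2
  have hcγ : Integrable cost γ := by
    refine ⟨hcostm.aestronglyMeasurable, ?_⟩
    rw [hasFiniteIntegral_iff_ofReal (ae_of_all _ hcost0), hopt]
    exact hfin
  have eG : ∫ x, transferCost D V u τ x ∂ω = (∫ y, F y ∂β - ∫ y, F y ∂α) +
      (∫ p, cost p ∂ω2 - ∫ p, cost p ∂ω1) / (2 * τ) := by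
    rw [integral_map measurable_snd.aemeasurable hFm.aestronglyMeasurable,
      integral_map hfst.aemeasurable hFm.aestronglyMeasurable,
      integral_map he1m.aemeasurable hcostm.aestronglyMeasurable,
      integral_map measurable_fst.aemeasurable hcostm.aestronglyMeasurable,
      ← integral_sub hFi2 hFi1, ← integral_sub hci2 hci1, ← integral_div]
    exact integral_add (hFi2.sub hFi1) ((hci2.sub hci1).div_const _)
  -- the competitors
  set s : ℕ → ℝ := fun j => 1 / ((j + 1) * (N + 1)) with hs
  have hs0 : ∀ j, 0 < s j := fun j => by positivity
  have hsN : ∀ j, s j * (N + 1) ≤ 1 := by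
    intro j
    rw [hs]
    have h1 : (0:ℝ) ≤ j := Nat.cast_nonneg j
    have h2 : 1 / (((j:ℝ) + 1) * (N + 1)) * (N + 1) = 1 / ((j:ℝ) + 1) := by
      field_simp
    simp only [h2]
    rw [div_le_one (by positivity)]
    linarith
  have hs1 : ∀ j, s j ≤ 1 := fun j => by nlinarith [hsN j, hs0 j]
  have hslim : Tendsto s atTop (𝓝 0) := by
    have h1 := (tendsto_one_div_add_atTop_nhds_zero_nat (𝕜 := ℝ)).mul_const (1 / (N + 1))
    rw [zero_mul] at h1
    refine h1.congr fun j => ?_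
    rw [hs]
    field_simp
  have hle : ∀ j, ENNReal.ofReal (s j) • ω1 ≤ γ := by
    intro j
    calc ENNReal.ofReal (s j) • ω1 ≤ ENNReal.ofReal (s j) • (ENNReal.ofReal N • γ) := by
          intro t
          simp only [Measure.smul_apply, smul_eq_mul]
          exact mul_le_mul_right (hω1 t) _
      _ = ENNReal.ofReal (s j * N) • γ := by
          rw [smul_smul, ENNReal.ofReal_mul (hs0 j).le]
      _ ≤ (1 : ℝ≥0∞) • γ := by
          intro t
          simp only [Measure.smul_apply, smul_eq_mul]
          refine mul_le_mul_left ?_ _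
          rw [ENNReal.ofReal_le_one]
          nlinarith [hsN j, hs0 j]
      _ = γ := one_smul _ _
  have hfin1 : ∀ j, IsFiniteMeasure (ENNReal.ofReal (s j) • ω1) := fun j =>
    Measure.smul_finite _ ENNReal.ofReal_ne_top
  have hfin2 : ∀ j, IsFiniteMeasure (ENNReal.ofReal (s j) • ω2) := fun j =>
    Measure.smul_finite _ ENNReal.ofReal_ne_top
  set γ' : ℕ → Measure (ℝ × ℝ) := fun j => γ - ENNReal.ofReal (s j) • ω1 with hγ'
  have hγ'add : ∀ j, γ' j + ENNReal.ofReal (s j) • ω1 = γ := fun j =>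
    Measure.sub_add_cancel_of_le (hle j)
  have hγ'le : ∀ j, γ' j ≤ γ := fun j => Measure.sub_le
  set γs : ℕ → Measure (ℝ × ℝ) := fun j => γ' j + ENNReal.ofReal (s j) • ω2 with hγs
  have hsnd : ∀ j, (γs j).map Prod.snd = (η : Measure ℝ) := by
    intro j
    rw [hγs, Measure.map_add _ _ measurable_snd, Measure.map_smul, ← hω12snd, ← Measure.map_smul,
      ← Measure.map_add _ _ measurable_snd, hγ'add, hγ2]
  have hprob : ∀ j, IsProbabilityMeasure ((γs j).map Prod.fst) := by
    intro j
    constructor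
    have h1 : (γs j) univ = 1 := by
      have h2 : (γs j).map Prod.snd univ = 1 := by rw [hsnd j]; exact measure_univ
      rwa [Measure.map_apply measurable_snd MeasurableSet.univ, preimage_univ] at h2
    rw [Measure.map_apply measurable_fst MeasurableSet.univ, preimage_univ, h1]
  set μ : ℕ → ProbabilityMeasure ℝ := fun j => ⟨(γs j).map Prod.fst, hprob j⟩ with hμ
  have hrel : ∀ j, (μ j : Measure ℝ) + ENNReal.ofReal (s j) • α =
      (ρ : Measure ℝ) + ENNReal.ofReal (s j) • β := by
    intro j
    change (γs j).map Prod.fst + _ = _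
    rw [← hγ1, ← hω1fst, ← hω2fst, hγs]
    conv_rhs => rw [← hγ'add j]
    simp only [Measure.map_add _ _ measurable_fst, Measure.map_smul]
    abel
  have hβbox : ∀ᵐ y ∂β, |y| ≤ N ∧ coeff g y * density ρ y ≤ N := by
    have hms : MeasurableSet {y : ℝ | |y| ≤ N ∧ coeff g y * density ρ y ≤ N} :=
      (measurableSet_le measurable_norm measurable_const).inter
        (measurableSet_le hum measurable_const)
    exact (ae_map_iff measurable_snd.aemeasurable hms).2
      (hbox.mono fun x hx => ⟨hx.2.2.1, hx.2.2.2.2⟩)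
  have hαbox : ∀ᵐ y ∂α, |y| ≤ N ∧ coeff g y * density ρ y ≤ N := by
    have hms : MeasurableSet {y : ℝ | |y| ≤ N ∧ coeff g y * density ρ y ≤ N} :=
      (measurableSet_le measurable_norm measurable_const).inter
        (measurableSet_le hum measurable_const)
    exact (ae_map_iff hfst.aemeasurable hms).2
      (hbox.mono fun x hx => ⟨hx.1, hx.2.2.2.1⟩)
  have hαle : α ≤ ENNReal.ofReal N • (ρ : Measure ℝ) := by
    rw [← hω1fst, ← hγ1, ← Measure.map_smul]
    exact Measure.map_mono hω1 measurable_fst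
  obtain ⟨k, hk, hkE⟩ := energy_variation hd ha hV hV0 hE hN hαle hω2 hαbox hβbox hs0 hs1 hslim hrel
  have hfsm : ∀ j, FiniteSecondMoment (μ j) := by
    intro j
    have h1 : (μ j : Measure ℝ) ≤ (ρ : Measure ℝ) + ENNReal.ofReal (s j) • β := by
      rw [← hrel j]; exact Measure.le_add_right le_rfl
    refine (lintegral_mono' h1 le_rfl).trans_lt ?_
    rw [lintegral_add_measure, lintegral_smul_measure]
    refine ENNReal.add_lt_top.2 ⟨hρ2, ENNReal.mul_lt_top ENNReal.ofReal_lt_top ?_⟩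
    calc ∫⁻ y, ENNReal.ofReal (y ^ 2) ∂β ≤ ∫⁻ y, ENNReal.ofReal (N ^ 2) ∂β := by
          refine lintegral_mono_ae (hβbox.mono fun y hy => ENNReal.ofReal_le_ofReal ?_)
          rw [← sq_abs y]
          exact pow_le_pow_left₀ (abs_nonneg _) hy.1 2
      _ < ⊤ := by
          rw [lintegral_const]
          exact ENNReal.mul_lt_top ENNReal.ofReal_lt_top (measure_lt_top _ _)
  -- The unmoved part `γ' j` costs the same on both sides and cancels; what remains is a multiple of
  -- `s j`.
  have hkey : ∀ j, 0 ≤ k j + (∫ p, cost p ∂ω2 - ∫ p, cost p ∂ω1) / (2 * τ) := by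
    intro j
    have hcγ' : Integrable cost (γ' j) := hcγ.mono_measure (hγ'le j)
    have hcs1 : Integrable cost (ENNReal.ofReal (s j) • ω1) :=
      hcω1.smul_measure ENNReal.ofReal_ne_top
    have hcs2 : Integrable cost (ENNReal.ofReal (s j) • ω2) :=
      hcω2.smul_measure ENNReal.ofReal_ne_top
    have hcγs : Integrable cost (γs j) := hcγ'.add_measure hcs2
    have i1 : ∫ p, cost p ∂(γs j) = ∫ p, cost p ∂(γ' j) + s j * ∫ p, cost p ∂ω2 := by
      rw [hγs, integral_add_measure hcγ' hcs2, integral_smul_measure,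
        ENNReal.toReal_ofReal (hs0 j).le, smul_eq_mul]
    have i2 : ∫ p, cost p ∂γ = ∫ p, cost p ∂(γ' j) + s j * ∫ p, cost p ∂ω1 := by
      conv_lhs => rw [← hγ'add j]
      rw [integral_add_measure hcγ' hcs1, integral_smul_measure,
        ENNReal.toReal_ofReal (hs0 j).le, smul_eq_mul]
    have conv : ∀ (θ : Measure (ℝ × ℝ)) (σ : ProbabilityMeasure ℝ), Integrable cost θ →
        energy g φ W σ < ⊤ →
        (∫⁻ p, ENNReal.ofReal ((p.1 - p.2) ^ 2) ∂θ) / ENNReal.ofReal (2 * τ) + energy g φ W σ =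
        ENNReal.ofReal ((∫ p, cost p ∂θ) / (2 * τ) + ∫ y, energyDensity g φ W σ y) := by
      intro θ σ hθ hσ
      rw [ENNReal.ofReal_add (div_nonneg (integral_nonneg hcost0) (by linarith))
        (integral_nonneg (energyDensity_nonneg hd ha hV0 σ)),
        ENNReal.ofReal_div_of_pos (by linarith),
        ofReal_integral_eq_lintegral_ofReal hθ (ae_of_all _ hcost0),
        ofReal_integral_eq_lintegral_ofReal (integrable_energyDensity hd ha hV hV0 hσ)
          (ae_of_all _ (energyDensity_nonneg hd ha hV0 σ)),
        energy_eq_lintegral hd ha hV hV0 (absolutelyContinuous_of_energy hσ)]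
    have h1 := hmin (μ j) (hfsm j)
    have h2 : penalized g φ W τ (μ j) η ≤
        (∫⁻ p, ENNReal.ofReal ((p.1 - p.2) ^ 2) ∂(γs j)) / ENNReal.ofReal (2 * τ) +
          energy g φ W (μ j) :=
      add_le_add_left (ENNReal.div_le_div_right (W2sq_le rfl (hsnd j)) _) _
    have h3 := h1.trans h2
    rw [conv _ _ hcγs (hkE j).1, penalized, ← hopt, conv _ _ hcγ hE] at h3
    rw [ENNReal.ofReal_le_ofReal_iff] at h3
    · have h4 := (hkE j).2
      rw [i1, i2] at h3
      have h5 : 0 ≤ s j * (k j + (∫ p, cost p ∂ω2 - ∫ p, cost p ∂ω1) / (2 * τ)) := by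
        have h6 : (∫ p, cost p ∂(γ' j) + s j * ∫ p, cost p ∂ω2) / (2 * τ) -
            (∫ p, cost p ∂(γ' j) + s j * ∫ p, cost p ∂ω1) / (2 * τ) =
            s j * ((∫ p, cost p ∂ω2 - ∫ p, cost p ∂ω1) / (2 * τ)) := by ring
        rw [mul_add]
        linarith
      exact nonneg_of_mul_nonneg_right h5 (hs0 j)
    · exact add_nonneg (div_nonneg (integral_nonneg hcost0) (by linarith))
        (integral_nonneg (energyDensity_nonneg hd ha hV0 _))
  rw [eG]
  exact ge_of_tendsto' (hk.add_const _) hkey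

/-- The pointwise optimality condition for one step of the scheme. -/
theorem ae_transferCost_nonneg (hd : EnergyDual m φ D S Q c K) (ha : CoeffRegular (coeff g))
    (hV : Continuous (potential g W)) (hV0 : ∀ y, 0 ≤ potential g W y)
    {ρ η : ProbabilityMeasure ℝ} (hρ2 : FiniteSecondMoment ρ) (hE : energy g φ W ρ < ⊤)
    {τ : ℝ} (hτ : 0 < τ)
    (hmin : ∀ μ, FiniteSecondMoment μ → penalized g φ W τ ρ η ≤ penalized g φ W τ μ η)
    {γ : Measure (ℝ × ℝ)} [IsProbabilityMeasure γ] (hγ1 : γ.map Prod.fst = (ρ : Measure ℝ))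
    (hγ2 : γ.map Prod.snd = (η : Measure ℝ))
    (hopt : ∫⁻ p, ENNReal.ofReal ((p.1 - p.2) ^ 2) ∂γ = W2sq ρ η) (hfin : W2sq ρ η < ⊤) :
    ∀ᵐ x ∂γ, ∀ᵐ q, 0 ≤
      transferCost D (potential g W) (fun y => coeff g y * density ρ y) τ (x, q) := by
  set u : ℝ → ℝ := fun y => coeff g y * density ρ y with hu
  set V := potential g W with hVdef
  have hum : Measurable u := ha.cont.measurable.mul (measurable_density ρ)
  have hGm := measurable_transferCost hd.D_cont.measurable hV.measurable hum τ
  set Bad : Set ((ℝ × ℝ) × ℝ) := {x | transferCost D V u τ x < 0} with hBad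
  have hBadm : MeasurableSet Bad := measurableSet_lt hGm measurable_const
  suffices h0 : (γ.prod volume) Bad = 0 by
    have h1 : ∀ᵐ x ∂(γ.prod volume), 0 ≤ transferCost D V u τ x := by
      rw [ae_iff]
      simpa only [not_le] using h0
    exact Measure.ae_ae_of_ae_prod h1
  set Box : ℕ → Set ((ℝ × ℝ) × ℝ) := fun n => {x | |x.1.1| ≤ n + 1 ∧ |x.1.2| ≤ n + 1 ∧
    |x.2| ≤ n + 1 ∧ u x.1.1 ≤ n + 1 ∧ u x.2 ≤ n + 1} with hBox
  have hBoxm : ∀ n, MeasurableSet (Box n) := by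
    intro n
    have habs : ∀ {f : (ℝ × ℝ) × ℝ → ℝ}, Measurable f →
        MeasurableSet {x | |f x| ≤ n + 1} := fun hf =>
      measurableSet_le hf.norm measurable_const
    exact (habs (by fun_prop)).inter ((habs (by fun_prop)).inter ((habs (by fun_prop)).inter
      ((measurableSet_le (hum.comp (measurable_fst.comp measurable_fst)) measurable_const).inter
        (measurableSet_le (hum.comp measurable_snd) measurable_const))))
  have hcover : Bad ⊆ ⋃ n, Bad ∩ Box n := by
    intro x hx
    obtain ⟨n, hn⟩ := exists_nat_ge (|x.1.1| + |x.1.2| + |x.2| + |u x.1.1| + |u x.2|)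
    refine mem_iUnion.2 ⟨n, hx, ?_⟩
    have h1 := abs_nonneg x.1.1
    have h2 := abs_nonneg x.1.2
    have h3 := abs_nonneg x.2
    have h4 := abs_nonneg (u x.1.1)
    have h5 := abs_nonneg (u x.2)
    have h6 := le_abs_self (u x.1.1)
    have h7 := le_abs_self (u x.2)
    refine ⟨?_, ?_, ?_, ?_, ?_⟩ <;> linarith
  refine measure_mono_null hcover (measure_iUnion_null fun n => ?_)
  set E := Bad ∩ Box n with hE'
  have hEm : MeasurableSet E := hBadm.inter (hBoxm n)
  have hn1 : (0:ℝ) < n + 1 := by positivity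
  -- The variation is tested on a bounded piece of the bad set: a strictly negative function has
  -- nonnegative integral over it, so the piece is null.
  set ω := (γ.prod volume).restrict E with hω
  have hωle : ω ≤ γ.prod (volume.restrict (Icc (-((n:ℝ) + 1)) (n + 1))) := by
    have h1 : E ⊆ univ ×ˢ Icc (-((n:ℝ) + 1)) (n + 1) := by
      intro x hx
      exact ⟨mem_univ _, abs_le.1 hx.2.2.2.1⟩
    have h2 := Measure.restrict_mono_set (γ.prod volume) h1
    rwa [← Measure.prod_restrict, Measure.restrict_univ] at h2
  have : IsFiniteMeasure ω := isFiniteMeasure_of_le _ hωle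
  have hω1 : ω.map Prod.fst ≤ ENNReal.ofReal (2 * (n + 1)) • γ := by
    refine (Measure.map_mono hωle measurable_fst).trans ?_
    rw [Measure.map_fst_prod, Measure.restrict_apply_univ, Real.volume_Icc]
    apply le_of_eq
    congr 2
    ring
  have hω2 : ω.map Prod.snd ≤ volume := by
    refine (Measure.map_mono hωle measurable_snd).trans ?_
    rw [Measure.map_snd_prod, measure_univ, one_smul]
    exact Measure.restrict_le_self
  have hEae : ∀ᵐ x ∂ω, x ∈ E := ae_restrict_mem hEm
  obtain ⟨hint, hnn⟩ := first_variation_nonneg hd ha hV hV0 hρ2 hE hτ hmin hγ1 hγ2 hopt hfin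
    (N := 2 * (n + 1)) (by positivity) hω1 hω2 (hEae.mono fun x hx => by
      obtain ⟨h1, h2, h3, h4, h5⟩ := hx.2
      refine ⟨?_, ?_, ?_, ?_, ?_⟩
      · linarith
      · linarith
      · linarith
      · exact h4.trans (by linarith)
      · exact h5.trans (by linarith))
  have hneg : 0 ≤ᵐ[ω] fun x => -transferCost D V u τ x := hEae.mono fun x hx => by
    have := hx.1
    simp only [hBad, mem_ofPred_eq] at this
    simp only [Pi.zero_apply]
    linarith
  have hz : ∫ x, -transferCost D V u τ x ∂ω = 0 := by
    refine le_antisymm ?_ (integral_nonneg_of_ae hneg)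
    rw [integral_neg]
    linarith
  have hz' := (integral_eq_zero_iff_of_nonneg_ae hneg hint.neg).1 hz
  have hfalse : ∀ᵐ x ∂ω, False := by
    filter_upwards [hz', hEae] with x h1 h2
    have := h2.1
    simp only [hBad, mem_ofPred_eq] at this
    simp only [Pi.zero_apply] at h1
    linarith
  have hω0 : ω = 0 := by
    rw [← Measure.measure_univ_eq_zero]
    simpa [ae_iff] using hfalse
  exact Measure.restrict_eq_zero.1 hω0
end
-- Convex envelopes and the chemical potential
/-- The supremum of a family of affine functions, bounded at every point, is convex. -/
theorem convexOn_iSup_affine {P : Set (ℝ × ℝ)} (hP : P.Nonempty)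
    (hb : ∀ q, BddAbove (range fun p : P => (p : ℝ × ℝ).1 + (p : ℝ × ℝ).2 * q)) :
    ConvexOn ℝ univ (fun q => ⨆ p : P, ((p : ℝ × ℝ).1 + (p : ℝ × ℝ).2 * q)) := by
  have : Nonempty P := hP.to_subtype
  refine ⟨convex_univ, fun x _ y _ s t hs ht hst => ?_⟩
  refine ciSup_le fun p => ?_
  have h1 := mul_le_mul_of_nonneg_left (le_ciSup (hb x) p) hs
  have h2 := mul_le_mul_of_nonneg_left (le_ciSup (hb y) p) ht
  simp only [smul_eq_mul]
  calc (p : ℝ × ℝ).1 + (p : ℝ × ℝ).2 * (s * x + t * y)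
      = s * ((p : ℝ × ℝ).1 + (p : ℝ × ℝ).2 * x) + t * ((p : ℝ × ℝ).1 + (p : ℝ × ℝ).2 * y) := by
        linear_combination (- (p : ℝ × ℝ).1) * hst
    _ ≤ _ := add_le_add h1 h2

/-- A measurable function which is, almost everywhere, above each affine function of a family
agrees with a convex function wherever the family touches it. -/
theorem exists_convex_envelope {H : ℝ → ℝ} {P : Set (ℝ × ℝ)} (hP : P.Nonempty)
    (h : ∀ p ∈ P, ∀ᵐ q, p.1 + p.2 * q ≤ H q) :
    ∃ f : ℝ → ℝ, ConvexOn ℝ univ f ∧ (∀ᵐ q, f q ≤ H q) ∧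
      ∀ p ∈ P, ∀ q, p.1 + p.2 * q ≤ f q := by
  have hne : Nonempty P := hP.to_subtype
  -- Each affine function brings its own null set. A countable dense subfamily suffices, since for
  -- fixed `q` the inequality is closed in `p`.
  have hae : ∀ᵐ q, ∀ p : P, (p : ℝ × ℝ).1 + (p : ℝ × ℝ).2 * q ≤ H q := by
    have h1 : ∀ᵐ q, ∀ n, (TopologicalSpace.denseSeq P n : ℝ × ℝ).1 +
        (TopologicalSpace.denseSeq P n : ℝ × ℝ).2 * q ≤ H q :=
      ae_all_iff.2 fun n => h _ (TopologicalSpace.denseSeq P n).2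
    filter_upwards [h1] with q hq
    have hcl : IsClosed {p : P | (p : ℝ × ℝ).1 + (p : ℝ × ℝ).2 * q ≤ H q} :=
      isClosed_le (by fun_prop) continuous_const
    have hdense := (TopologicalSpace.denseRange_denseSeq P).closure_eq
    intro p
    have hsub : closure (range (TopologicalSpace.denseSeq P)) ⊆
        {p : P | (p : ℝ × ℝ).1 + (p : ℝ × ℝ).2 * q ≤ H q} :=
      hcl.closure_subset_iff.2 (by rintro _ ⟨n, rfl⟩; exact hq n)
    exact hsub (hdense ▸ mem_univ p)
  -- Good points exist on both sides of `q`; according to the sign of its slope, each affine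
  -- function is bounded at `q` by its value at one of them.
  have hb : ∀ q, BddAbove (range fun p : P => (p : ℝ × ℝ).1 + (p : ℝ × ℝ).2 * q) := by
    intro q
    obtain ⟨q1, hq1, h1⟩ : ∃ q1, q1 < q ∧ ∀ p : P,
        (p : ℝ × ℝ).1 + (p : ℝ × ℝ).2 * q1 ≤ H q1 := by
      by_contra! hcon
      have h0 : volume (Iio q) = 0 := measure_mono_null
        (fun x hx => by simpa using hcon x hx) (ae_iff.1 hae)
      simp at h0
    obtain ⟨q2, hq2, h2⟩ : ∃ q2, q < q2 ∧ ∀ p : P,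
        (p : ℝ × ℝ).1 + (p : ℝ × ℝ).2 * q2 ≤ H q2 := by
      by_contra! hcon
      have h0 : volume (Ioi q) = 0 := measure_mono_null
        (fun x hx => by simpa using hcon x hx) (ae_iff.1 hae)
      simp at h0
    refine ⟨max (H q1) (H q2), ?_⟩
    rintro _ ⟨p, rfl⟩
    rcases le_total 0 (p : ℝ × ℝ).2 with hp | hp
    · refine le_trans ?_ ((h2 p).trans (le_max_right _ _))
      simpa using mul_le_mul_of_nonneg_left hq2.le hp
    · refine le_trans ?_ ((h1 p).trans (le_max_left _ _))
      simpa using mul_le_mul_of_nonpos_left hq1.le hp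
  refine ⟨_, convexOn_iSup_affine hP hb, ?_, ?_⟩
  · filter_upwards [hae] with q hq using ciSup_le hq
  · intro p hp q
    exact le_ciSup (hb q) ⟨p, hp⟩

/-- A subgradient of a convex function is its right derivative wherever the latter is
continuous. -/
theorem subgradient_eq_rightDeriv {f : ℝ → ℝ} (hf : ConvexOn ℝ univ f) {p s : ℝ}
    (hs : ∀ q, f p + s * (q - p) ≤ f q)
    (hc : ContinuousAt (fun x => derivWithin f (Ioi x) x) p) :
    s = derivWithin f (Ioi p) p := by
  have hint : ∀ x : ℝ, x ∈ interior (univ : Set ℝ) := fun x => by simp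
  apply le_antisymm
  · rw [hf.rightDeriv_eq_sInf_slope_of_mem_interior (hint p)]
    refine le_csInf ⟨slope f p (p + 1), p + 1, by simp, rfl⟩ ?_
    rintro _ ⟨q, hq, rfl⟩
    have hq' : p < q := hq.2
    rw [slope_def_field, le_div_iff₀ (by linarith)]
    linarith [hs q]
  -- The slope `s` dominates the chord slopes ending at `p` from the left, hence the right
  -- derivatives at `q < p`; continuity passes to the limit `q → p`.
  · refine le_of_tendsto (hc.tendsto.mono_left (nhdsWithin_le_nhds (s := Iio p))) ?_
    filter_upwards [self_mem_nhdsWithin] with q hq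
    have hq' : q < p := hq
    refine (hf.rightDeriv_le_slope_of_mem_interior (hint q) (mem_univ p) hq').trans ?_
    rw [slope_def_field, div_le_iff₀ (by linarith)]
    linarith [hs q]

section
variable {m c K : ℝ} {φ D S Q : ℝ → ℝ} {g W : ℝ → ℝ}

/-- The regularity of a minimiser of the penalised energy: `a ρ = S κ` where `κ' = v - V'` and
`∫ ρ v² = W₂² / τ²`. -/
theorem exists_chemical_potential (hd : EnergyDual m φ D S Q c K) (ha : CoeffRegular (coeff g))
    {V' : ℝ → ℝ} {CV : ℝ} (hV : PotentialRegular (potential g W) V' CV)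
    {ρ η : ProbabilityMeasure ℝ} (hρ2 : FiniteSecondMoment ρ) (hE : energy g φ W ρ < ⊤)
    {τ : ℝ} (hτ : 0 < τ)
    (hmin : ∀ μ, FiniteSecondMoment μ → penalized g φ W τ ρ η ≤ penalized g φ W τ μ η)
    (hfin : W2sq ρ η < ⊤) :
    ∃ κ v : ℝ → ℝ, Continuous κ ∧ Measurable v ∧ (∀ x y, IntervalIntegrable v volume x y) ∧
      (∀ y, HasDerivWithinAt κ (v y - V' y) (Ioi y) y) ∧
      (∀ᵐ y, coeff g y * density ρ y = S (κ y)) ∧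
      ∫⁻ y, ENNReal.ofReal (v y ^ 2) ∂(ρ : Measure ℝ) = W2sq ρ η / ENNReal.ofReal (τ ^ 2) := by
  have hVc : Continuous (potential g W) :=
    continuous_iff_continuousAt.2 fun y => (hV.hasDeriv y).continuousAt
  have hρac := absolutelyContinuous_of_energy hE
  obtain ⟨γ, hγ, hγ1, hγ2, hopt⟩ := exists_optimal_plan ρ η
  have hG := ae_transferCost_nonneg hd ha hVc hV.nonneg hρ2 hE hτ hmin hγ1 hγ2 hopt hfin
  set u : ℝ → ℝ := fun y => coeff g y * density ρ y with hu
  set V := potential g W with hVdef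
  have hum : Measurable u := ha.cont.measurable.mul (measurable_density ρ)
  have hu0 : ∀ y, 0 ≤ u y := fun y =>
    mul_nonneg (zero_le_one.trans (ha.one_le y)) (density_nonneg ρ y)
  set H : ℝ → ℝ := fun y => D (u y) + V y + y ^ 2 / (2 * τ) with hH
  have hHm : Measurable H :=
    ((hd.D_cont.measurable.comp hum).add hVc.measurable).add (by fun_prop)
  -- Expanding the squares in `transferCost` cancels `x.2 ^ 2` and leaves `H q` minus an affine
  -- function of `q`, so optimality says that `x.2 / τ` is a subgradient of `H` at `x.1`, up to null
  -- sets of `q`.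
  set Γ : Set (ℝ × ℝ) := {x | ∀ᵐ q, H x.1 + x.2 / τ * (q - x.1) ≤ H q} with hΓ
  have hΓae : ∀ᵐ x ∂γ, x ∈ Γ := by
    filter_upwards [hG] with x hx
    filter_upwards [hx] with q hq
    have : transferCost D V u τ (x, q) = H q - (H x.1 + x.2 / τ * (q - x.1)) := by
      simp only [transferCost, hH]
      field_simp
      ring
    rw [this] at hq
    linarith
  set P : Set (ℝ × ℝ) := (fun x : ℝ × ℝ => (H x.1 - x.2 / τ * x.1, x.2 / τ)) '' Γ with hP
  have hPne : P.Nonempty := by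
    obtain ⟨x, hx⟩ := hΓae.exists
    exact ⟨_, x, hx, rfl⟩
  obtain ⟨f, hf, hfle, hfge⟩ := exists_convex_envelope (H := H) hPne (by
    rintro _ ⟨x, hx, rfl⟩
    filter_upwards [hx] with q hq
    linarith)
  have hfc : Continuous f := continuousOn_univ.1 (hf.continuousOn isOpen_univ)
  have hfge' : ∀ x ∈ Γ, ∀ q, H x.1 + x.2 / τ * (q - x.1) ≤ f q := by
    intro x hx q
    have := hfge _ ⟨x, hx, rfl⟩ q
    simp only at this
    linarith
  have hfst : ∀ {p : ℝ → Prop}, (∀ᵐ y, p y) → ∀ᵐ x ∂γ, p x.1 := by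
    intro p hp
    have h1 : ∀ᵐ y ∂(γ.map Prod.fst), p y := by rw [hγ1]; exact hρac.ae_le hp
    exact ae_of_ae_map measurable_fst.aemeasurable h1
  have htouch : ∀ᵐ x ∂γ, f x.1 = H x.1 := by
    filter_upwards [hΓae, hfst hfle] with x hx h1
    exact le_antisymm h1 (by simpa using hfge' x hx x.1)
  have htouch' : ∀ᵐ y, density ρ y ≠ 0 → f y = H y := by
    have h1 : ∀ᵐ y ∂(ρ : Measure ℝ), f y = H y := by
      rw [← hγ1]
      exact (ae_map_iff measurable_fst.aemeasurable
        (measurableSet_eq_fun hfc.measurable hHm)).2 htouch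
    rw [withDensity_density hρac,
      ae_withDensity_iff (measurable_density ρ).ennreal_ofReal] at h1
    filter_upwards [h1] with y hy hne
    refine hy ?_
    rw [Ne, ENNReal.ofReal_eq_zero, not_le]
    exact lt_of_le_of_ne (density_nonneg ρ y) (Ne.symm hne)
  set f' : ℝ → ℝ := fun x => derivWithin f (Ioi x) x with hf'
  have hf'mono : Monotone f' := by
    have := hf.monotoneOn_rightDeriv
    rw [interior_univ] at this
    exact monotoneOn_univ.1 this
  have hsub : ∀ᵐ x ∂γ, x.2 / τ = f' x.1 := by
    have hcont : ∀ᵐ y, ContinuousAt f' y := by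
      rw [ae_iff]
      exact (hf'mono.countable_not_continuousAt).measure_zero _
    filter_upwards [hΓae, htouch, hfst hcont] with x hx h1 h2
    exact subgradient_eq_rightDeriv hf (fun q => by rw [h1]; exact hfge' x hx q) h2
  set v : ℝ → ℝ := fun y => f' y - y / τ with hv
  have hvm : Measurable v := hf'mono.measurable.sub (by fun_prop)
  refine ⟨fun y => f y - V y - y ^ 2 / (2 * τ), v, ?_, hvm, ?_, ?_, ?_, ?_⟩
  · exact (hfc.sub hVc).sub (by fun_prop)
  · intro x y
    exact hf'mono.intervalIntegrable.sub ((by fun_prop : Continuous fun y : ℝ => y / τ).intervalIntegrable _ _)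
  · intro y
    have h1 := hf.hasDerivWithinAt_rightDeriv_of_mem_interior (x := y) (by simp)
    have h2 : HasDerivAt (fun y : ℝ => y ^ 2 / (2 * τ)) (y / τ) y := by
      refine ((hasDerivAt_pow 2 y).div_const (2 * τ)).congr_deriv ?_
      field_simp
      norm_num
    exact ((h1.sub (hV.hasDeriv y).hasDerivWithinAt).sub h2.hasDerivWithinAt).congr_deriv
      (by simp only [hv, hf']; ring)
  · filter_upwards [htouch', hfle] with y h1 h2
    -- Where the density vanishes there need be no contact, but `f ≤ H` still puts the potential
    -- below `D 0`, where `S` is zero. Elsewhere contact identifies it with `D (u y)`.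
    by_cases hy : density ρ y = 0
    · have hu0' : u y = 0 := by simp [hu, hy]
      change u y = _
      rw [hu0', hd.S_of_le]
      simp only [hH, hu0'] at h2
      linarith
    · have h3 := h1 hy
      change u y = _
      have h4 : f y - V y - y ^ 2 / (2 * τ) = D (u y) := by rw [h3, hH]; ring
      rw [h4, hd.S_D _ (hu0 y)]
  · rw [← hopt, ← hγ1, lintegral_map (by fun_prop) measurable_fst]
    have hτ2 : ENNReal.ofReal (τ ^ 2) ≠ 0 := by
      rw [Ne, ENNReal.ofReal_eq_zero, not_le]; positivity
    rw [ENNReal.div_eq_inv_mul, ← lintegral_const_mul' _ _ (ENNReal.inv_ne_top.2 hτ2)]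
    refine lintegral_congr_ae ?_
    -- Along the plan `v x.1 = (x.2 - x.1) / τ`, so `v²` integrates to the transport cost over `τ²`.
    filter_upwards [hsub] with x hx
    rw [← ENNReal.div_eq_inv_mul, ← ENNReal.ofReal_div_of_pos (by positivity)]
    congr 1
    simp only [hv, ← hx]
    field_simp
    ring
end
-- Pressure estimates: uniform bound and equicontinuity
/-- `κ` is a chemical potential of `ρ` with velocity `v`: `a ρ = S κ` and `κ' = v - V'`. -/
structure HasChemicalPotential (a V' S : ℝ → ℝ) (ρ : ProbabilityMeasure ℝ) (κ v : ℝ → ℝ) :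
    Prop where
  ac : (ρ : Measure ℝ) ≪ volume
  cont : Continuous κ
  meas : Measurable v
  intervalIntegrable : ∀ x y, IntervalIntegrable v volume x y
  hasDeriv : ∀ y, HasDerivWithinAt κ (v y - V' y) (Ioi y) y
  ae_eq : ∀ᵐ y, a y * density ρ y = S (κ y)

section
variable {m c K : ℝ} {φ D S Q : ℝ → ℝ} {a V V' : ℝ → ℝ} {CV : ℝ}
  {ρ : ProbabilityMeasure ℝ} {κ v : ℝ → ℝ}

theorem EnergyDual.Q_mono (hd : EnergyDual m φ D S Q c K) : Monotone Q :=
  monotone_of_hasDerivAt_nonneg hd.Q_deriv (fun k => hd.S_nonneg k)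

theorem EnergyDual.Q_nonneg (hd : EnergyDual m φ D S Q c K) (k : ℝ) : 0 ≤ Q k := by
  rcases le_total k (D 0) with h | h
  · rw [hd.Q_of_le k h]
  · rw [← hd.Q_of_le (D 0) le_rfl]; exact hd.Q_mono h

theorem EnergyDual.Q_le (hd : EnergyDual m φ D S Q c K) {k s : ℝ} (h : S k ≤ s) :
    Q k ≤ Q (D s) := by
  rw [hd.Q_eq k]
  exact hd.Q_mono (hd.D_mono.monotone h)

theorem EnergyDual.rpow_le (hd : EnergyDual m φ D S Q c K) (k : ℝ) : c * S k ^ m ≤ Q k := by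
  have := hd.coercive k (D 0)
  rwa [hd.S_of_le (D 0) le_rfl, hd.Q_of_le (D 0) le_rfl, sub_zero, sub_zero,
    abs_of_nonneg (hd.S_nonneg k), abs_of_nonneg (hd.Q_nonneg k)] at this

/-- The envelope may have corners, so `κ` is differentiable only from the right; the fundamental
theorem for right derivatives is enough. -/
theorem HasChemicalPotential.integral_eq (hd : EnergyDual m φ D S Q c K)
    (hV' : Continuous V') (h : HasChemicalPotential a V' S ρ κ v) (x y : ℝ) :
    IntervalIntegrable (fun t => S (κ t) * (v t - V' t)) volume x y ∧
    Q (κ y) - Q (κ x) = ∫ t in x..y, S (κ t) * (v t - V' t) := by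
  have hQc : Continuous Q := continuous_iff_continuousAt.2 fun k => (hd.Q_deriv k).continuousAt
  have hint : IntervalIntegrable (fun t => S (κ t) * (v t - V' t)) volume x y :=
    ((h.intervalIntegrable x y).sub (hV'.intervalIntegrable x y)).continuousOn_mul
      (hd.S_cont.comp h.cont).continuousOn
  refine ⟨hint, (intervalIntegral.integral_eq_sub_of_hasDeriv_right
    (hQc.comp h.cont).continuousOn ?_ hint).symm⟩
  intro t _
  exact (hd.Q_deriv (κ t)).comp_hasDerivWithinAt t (h.hasDeriv t)

theorem HasChemicalPotential.density_ae_eq (ha : CoeffRegular a)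
    (h : HasChemicalPotential a V' S ρ κ v) : ∀ᵐ y, density ρ y = S (κ y) / a y := by
  filter_upwards [h.ae_eq] with y hy
  have h1 : a y ≠ 0 := (one_pos.trans_le (ha.one_le y)).ne'
  rw [← hy]
  field_simp

/-- Since `S κ / a` is a representative of the density, pointwise bounds for the pressure slope
become moments of `ρ`. -/
theorem HasChemicalPotential.integral_le (hd : EnergyDual m φ D S Q c K) (ha : CoeffRegular a)
    (h : HasChemicalPotential a V' S ρ κ v) {w : ℝ → ℝ} (hw0 : ∀ t, 0 ≤ w t)
    (hw : Integrable w (ρ : Measure ℝ)) {x y A : ℝ} (hA : 0 ≤ A) (hxy : x ≤ y) {f : ℝ → ℝ}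
    (hf : IntervalIntegrable f volume x y)
    (hfw : ∀ t ∈ Icc x y, f t ≤ A * (S (κ t) / a t * w t)) :
    ∫ t in x..y, f t ≤ A * ∫ t, w t ∂(ρ : Measure ℝ) := by
  have ha0 : ∀ y, 0 < a y := fun y => one_pos.trans_le (ha.one_le y)
  have hi1 : Integrable (fun t => S (κ t) / a t * w t) := by
    refine ((integrable_rnDeriv_smul_iff h.ac).2 hw).congr ?_
    filter_upwards [h.density_ae_eq ha] with t ht
    rw [← ht]; rfl
  have he1 : ∫ t, w t ∂(ρ : Measure ℝ) = ∫ t, S (κ t) / a t * w t := by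
    rw [← integral_rnDeriv_smul h.ac]
    refine integral_congr_ae ?_
    filter_upwards [h.density_ae_eq ha] with t ht
    rw [← ht]; rfl
  rw [he1, ← integral_const_mul]
  calc ∫ t in x..y, f t ≤ ∫ t in x..y, A * (S (κ t) / a t * w t) :=
        intervalIntegral.integral_mono_on hxy hf (hi1.const_mul A).intervalIntegrable hfw
    _ = ∫ t in Ioc x y, A * (S (κ t) / a t * w t) := intervalIntegral.integral_of_le hxy
    _ ≤ _ := setIntegral_le_integral (hi1.const_mul A) (ae_of_all _ fun t =>
        mul_nonneg hA (mul_nonneg (div_nonneg (hd.S_nonneg _) (ha0 t).le) (hw0 t)))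

/-- There is a point in every interval of unit length where the density is at most `2`. -/
theorem HasChemicalPotential.exists_le_two (hd : EnergyDual m φ D S Q c K) (ha : CoeffRegular a)
    (h : HasChemicalPotential a V' S ρ κ v) (z : ℝ) :
    ∃ x ∈ Icc z (z + 1), S (κ x) / a x ≤ 2 := by
  by_contra! hcon
  have hi : IntervalIntegrable (fun _ : ℝ => (2:ℝ)) volume z (z + 1) := intervalIntegrable_const
  have := h.integral_le hd ha (w := fun _ => 1) (A := 1) (by simp) (by simp) (by simp)
    (by linarith : z ≤ z + 1) hi (fun t ht => by simpa using (hcon t ht).le)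
  norm_num at this

/-- The slope of `Q κ` is integrated from a point of `[0, 1]` or `[-1, 0]`, on the same side as `y`,
where the density is at most `2`. Going outwards, `a t ≤ a y`, and only the controlled side of `V'`
enters. Going inwards, everything happens in `[-1, 1]`, where `a ≤ R` and `w` dominates `|v - V'|`.
-/
theorem HasChemicalPotential.pressure_le (hd : EnergyDual m φ D S Q c K) (ha : CoeffRegular a)
    (hV : PotentialRegular V V' CV) (h : HasChemicalPotential a V' S ρ κ v)
    {w : ℝ → ℝ} (hw : Integrable w (ρ : Measure ℝ)) {R : ℝ}
    (hw1 : ∀ t, |v t| + CV * (1 + |t|) ≤ w t)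
    (hw2 : ∀ t ∈ Icc (-1 : ℝ) 1, |v t - V' t| ≤ w t) (hR1 : a 1 ≤ R) (hR2 : a (-1) ≤ R) (y : ℝ) :
    Q (κ y) ≤ Q (D (2 * R)) + R * a y * ∫ t, w t ∂(ρ : Measure ℝ) := by
  have ha0 : ∀ y, 0 < a y := fun y => one_pos.trans_le (ha.one_le y)
  have hw0 : ∀ t, 0 ≤ w t := fun t => le_trans
    (add_nonneg (abs_nonneg _) (mul_nonneg hV.const_nonneg (by positivity))) (hw1 t)
  have hR : 1 ≤ R := (ha.one_le 1).trans hR1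
  set I := ∫ t, w t ∂(ρ : Measure ℝ) with hI
  have hI0 : 0 ≤ I := integral_nonneg hw0
  have hUa : ∀ t, S (κ t) = a t * (S (κ t) / a t) := fun t => by
    have := (ha0 t).ne'; field_simp
  have hSa : ∀ t, 0 ≤ S (κ t) / a t := fun t => div_nonneg (hd.S_nonneg _) (ha0 t).le
  have hkey : ∀ t A, a t ≤ A → ∀ b, b ≤ w t → S (κ t) * b ≤ A * (S (κ t) / a t * w t) := by
    intro t A hA b hb
    calc S (κ t) * b ≤ S (κ t) * w t := mul_le_mul_of_nonneg_left hb (hd.S_nonneg _)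
      _ = a t * (S (κ t) / a t * w t) := by rw [← mul_assoc, ← hUa]
      _ ≤ _ := mul_le_mul_of_nonneg_right hA (mul_nonneg (hSa t) (hw0 t))
  have hstart : ∀ x, S (κ x) / a x ≤ 2 → a x ≤ R → Q (κ x) ≤ Q (D (2 * R)) := by
    intro x hx hax
    refine hd.Q_le ?_
    rw [hUa x, mul_comm]
    exact mul_le_mul hx hax (ha0 x).le zero_le_two
  have hloc : ∀ t ∈ Icc (-1 : ℝ) 1, a t ≤ R := by
    intro t ht
    rcases le_total 0 t with h0 | h0
    · exact (ha.mono h0 (by simp) ht.2).trans hR1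
    · exact (ha.anti (by simp) h0 ht.1).trans hR2
  have hRa : ∀ y, R * I ≤ R * a y * I := fun y => by
    refine mul_le_mul_of_nonneg_right ?_ hI0
    nlinarith [ha.one_le y]
  have haR : ∀ y, a y * I ≤ R * a y * I := fun y => by
    refine mul_le_mul_of_nonneg_right ?_ hI0
    nlinarith [ha0 y]
  rcases le_total 0 y with hy | hy
  · obtain ⟨x, hx, hx2⟩ := h.exists_le_two hd ha 0
    rw [zero_add] at hx
    have hx' : x ∈ Icc (-1 : ℝ) 1 := ⟨by linarith [hx.1], hx.2⟩
    have hs := hstart x hx2 (hloc x hx')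
    rcases le_total x y with hxy | hxy
    · obtain ⟨hint, heq⟩ := h.integral_eq hd hV.cont' x y
      have := h.integral_le hd ha hw0 hw (ha0 y).le hxy hint (fun t ht => by
        have ht0 : 0 ≤ t := hx.1.trans ht.1
        refine hkey t _ (ha.mono ht0 hy ht.2) _ ?_
        linarith [hV.lower t ht0, hw1 t, le_abs_self (v t)])
      linarith [haR y]
    · obtain ⟨hint, heq⟩ := h.integral_eq hd hV.cont' y x
      have := h.integral_le hd ha hw0 hw (by linarith : 0 ≤ R) hxy hint.neg (fun t ht => by
        have ht1 : t ∈ Icc (-1 : ℝ) 1 := ⟨by linarith [ht.1], ht.2.trans hx.2⟩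
        have := hkey t _ (hloc t ht1) (-(v t - V' t)) ((neg_le_abs _).trans (hw2 t ht1))
        simpa only [Pi.neg_apply, mul_neg] using this)
      simp only [Pi.neg_apply, intervalIntegral.integral_neg] at this
      linarith [hRa y]
  · obtain ⟨x, hx, hx2⟩ := h.exists_le_two hd ha (-1)
    norm_num at hx
    have hx' : x ∈ Icc (-1 : ℝ) 1 := ⟨hx.1, by linarith [hx.2]⟩
    have hs := hstart x hx2 (hloc x hx')
    rcases le_total y x with hxy | hxy
    · obtain ⟨hint, heq⟩ := h.integral_eq hd hV.cont' y x
      have := h.integral_le hd ha hw0 hw (ha0 y).le hxy hint.neg (fun t ht => by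
        have ht0 : t ≤ 0 := ht.2.trans hx.2
        have := hkey t _ (ha.anti hy ht0 ht.1) (-(v t - V' t)) (by
          linarith [hV.upper t ht0, hw1 t, neg_abs_le (v t)])
        simpa only [Pi.neg_apply, mul_neg] using this)
      simp only [Pi.neg_apply, intervalIntegral.integral_neg] at this
      linarith [haR y]
    · obtain ⟨hint, heq⟩ := h.integral_eq hd hV.cont' x y
      have := h.integral_le hd ha hw0 hw (by linarith : 0 ≤ R) hxy hint (fun t ht => by
        have ht1 : t ∈ Icc (-1 : ℝ) 1 := ⟨hx.1.trans ht.1, by linarith [ht.2]⟩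
        exact hkey t _ (hloc t ht1) (v t - V' t) ((le_abs_self _).trans (hw2 t ht1)))
      linarith [hRa y]

theorem sq_integral_le_integral_sq {Ω : Type*} [MeasurableSpace Ω] {P : Measure Ω}
    [IsProbabilityMeasure P] {f : Ω → ℝ} (hf : Integrable f P)
    (hf2 : Integrable (fun x => f x ^ 2) P) : (∫ x, f x ∂P) ^ 2 ≤ ∫ x, f x ^ 2 ∂P := by
  set I := ∫ x, f x ∂P with hI
  have h1 : 0 ≤ ∫ x, (f x - I) ^ 2 ∂P := integral_nonneg fun x => sq_nonneg _
  have h2 : ∫ x, (f x - I) ^ 2 ∂P = ∫ x, f x ^ 2 ∂P - I ^ 2 := by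
    have h3 : (fun x => (f x - I) ^ 2) = fun x => f x ^ 2 - (2 * I) * f x + I ^ 2 := by
      ext x; ring
    have h4 : Integrable (fun x => f x ^ 2 - (2 * I) * f x) P := hf2.sub (hf.const_mul _)
    rw [h3, integral_add h4 (integrable_const _),
      integral_sub hf2 (hf.const_mul _), integral_const_mul, integral_const]
    simp only [probReal_univ, smul_eq_mul, one_mul, ← hI]
    ring
  linarith

theorem integrable_sq_of_lintegral_le {f : ℝ → ℝ} (hf : Measurable f) {X : ℝ} (hX : 0 ≤ X)
    (h : ∫⁻ y, ENNReal.ofReal (f y ^ 2) ∂(ρ : Measure ℝ) ≤ ENNReal.ofReal X) :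
    Integrable (fun y => f y ^ 2) (ρ : Measure ℝ) ∧ Integrable f (ρ : Measure ℝ) ∧
      ∫ y, f y ^ 2 ∂(ρ : Measure ℝ) ≤ X := by
  have h2 : Integrable (fun y => f y ^ 2) (ρ : Measure ℝ) := by
    refine ⟨(hf.pow_const 2).aestronglyMeasurable, ?_⟩
    rw [hasFiniteIntegral_iff_ofReal (ae_of_all _ fun y => sq_nonneg _)]
    exact h.trans_lt ENNReal.ofReal_lt_top
  refine ⟨h2, ?_, ?_⟩
  · refine ((integrable_const (1 : ℝ)).add h2).mono' hf.aestronglyMeasurable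
      (ae_of_all _ fun y => ?_)
    rw [Real.norm_eq_abs]
    simp only [Pi.add_apply]
    nlinarith [sq_abs (f y), sq_nonneg (|f y| - 1)]
  · rw [integral_eq_lintegral_of_nonneg_ae (ae_of_all _ fun y => sq_nonneg _)
      (hf.pow_const 2).aestronglyMeasurable]
    exact ENNReal.toReal_le_of_le_ofReal hX h

/-- The uniform bound on densities with a chemical potential. -/
theorem exists_density_bound (hd : EnergyDual m φ D S Q c K) (ha : CoeffRegular a)
    (hV : PotentialRegular V V' CV) :
    ∃ C : ℝ, 0 < C ∧ ∀ (ρ : ProbabilityMeasure ℝ) (κ v : ℝ → ℝ) (X M : ℝ),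
      HasChemicalPotential a V' S ρ κ v → 0 ≤ X → 0 ≤ M →
      ∫⁻ y, ENNReal.ofReal (v y ^ 2) ∂(ρ : Measure ℝ) ≤ ENNReal.ofReal X →
      ∫⁻ y, ENNReal.ofReal (y ^ 2) ∂(ρ : Measure ℝ) ≤ ENNReal.ofReal M →
      ∀ y, (S (κ y) / a y) ^ (2 * m) ≤ C * (1 + X + M) := by
  have ha0 : ∀ y, 0 < a y := fun y => one_pos.trans_le (ha.one_le y)
  obtain ⟨Vm, hVm⟩ := (isCompact_Icc (a := (-1 : ℝ)) (b := 1)).exists_bound_of_continuousOn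
    hV.cont'.continuousOn
  have hVm0 : 0 ≤ Vm := (norm_nonneg _).trans (hVm 0 (by norm_num))
  set R := max (a 1) (a (-1)) with hR
  have hR1 : 1 ≤ R := (ha.one_le 1).trans (le_max_left _ _)
  set q := Q (D (2 * R)) with hq
  have hq0 : 0 ≤ q := hd.Q_nonneg _
  set b := CV + Vm with hb
  have hb0 : 0 ≤ b := add_nonneg hV.const_nonneg hVm0
  refine ⟨2 * ((q ^ 2 + R ^ 2 * (3 * (1 + b ^ 2 + CV ^ 2))) / c ^ 2) + 1, by positivity, ?_⟩
  intro ρ κ v X M h hX hM hvX hyM y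
  obtain ⟨iv2, iv, bv⟩ := integrable_sq_of_lintegral_le h.meas hX hvX
  obtain ⟨iy2, iy, by'⟩ := integrable_sq_of_lintegral_le measurable_id hM hyM
  simp only [id] at iy2 iy by'
  set w : ℝ → ℝ := fun t => |v t| + CV * |t| + b with hw
  have hwint : Integrable w (ρ : Measure ℝ) :=
    (iv.abs.add (iy.abs.const_mul CV)).add (integrable_const b)
  have hbound : ∀ t, w t ^ 2 ≤ 3 * (v t ^ 2 + CV ^ 2 * t ^ 2 + b ^ 2) := by
    intro t
    have h1 : v t ^ 2 = |v t| ^ 2 := (sq_abs _).symm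
    have h2 : t ^ 2 = |t| ^ 2 := (sq_abs _).symm
    rw [h1, h2]
    simp only [hw]
    nlinarith [sq_nonneg (|v t| - CV * |t|), sq_nonneg (|v t| - b), sq_nonneg (CV * |t| - b)]
  have hi3 : Integrable (fun t => 3 * (v t ^ 2 + CV ^ 2 * t ^ 2 + b ^ 2)) (ρ : Measure ℝ) :=
    ((iv2.add (iy2.const_mul _)).add (integrable_const _)).const_mul _
  have hw2int : Integrable (fun t => w t ^ 2) (ρ : Measure ℝ) := by
    refine hi3.mono' (hwint.aestronglyMeasurable.pow 2) (ae_of_all _ fun t => ?_)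
    rw [Real.norm_of_nonneg (sq_nonneg _)]
    exact hbound t
  set I := ∫ t, w t ∂(ρ : Measure ℝ) with hI
  have hI2 : I ^ 2 ≤ 3 * (X + CV ^ 2 * M + b ^ 2) := by
    refine (sq_integral_le_integral_sq hwint hw2int).trans ?_
    refine (integral_mono hw2int hi3 hbound).trans ?_
    have h4 : Integrable (fun t => v t ^ 2 + CV ^ 2 * t ^ 2) (ρ : Measure ℝ) :=
      iv2.add (iy2.const_mul _)
    rw [integral_const_mul, integral_add h4 (integrable_const _),
      integral_add iv2 (iy2.const_mul _), integral_const_mul, integral_const]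
    simp only [probReal_univ, smul_eq_mul, one_mul]
    have := mul_le_mul_of_nonneg_left by' (sq_nonneg CV)
    linarith
  have hP := h.pressure_le hd ha hV hwint (R := R) (fun t => by
      simp only [hw, hb]; linarith) (fun t ht => by
      have h1 := hVm t ht
      rw [Real.norm_eq_abs] at h1
      have h2 := abs_sub (v t) (V' t)
      have h3 : 0 ≤ CV * |t| := mul_nonneg hV.const_nonneg (abs_nonneg _)
      simp only [hw, hb]
      linarith [hV.const_nonneg]) (le_max_left _ _) (le_max_right _ _) y
  have hI0 : 0 ≤ I := integral_nonneg fun t => by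
    have h3 : 0 ≤ CV * |t| := mul_nonneg hV.const_nonneg (abs_nonneg _)
    simp only [Pi.zero_apply, hw]
    positivity
  set x := S (κ y) / a y with hx
  have hx0 : 0 ≤ x := div_nonneg (hd.S_nonneg _) (ha0 y).le
  have hxm : c * x ^ m ≤ q + R * I := by
    have h1 := hd.rpow_le (κ y)
    have h2 : S (κ y) = a y * x := by rw [hx]; have := (ha0 y).ne'; field_simp
    -- This absorbs the factor `a y` of the pressure bound: `a ≥ 1` and `m > 1` leave a bound on the
    -- density that is uniform in `y`.
    have h3 : a y ≤ a y ^ m := by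
      simpa using Real.rpow_le_rpow_of_exponent_le (ha.one_le y) hd.one_lt.le
    rw [h2, Real.mul_rpow (ha0 y).le hx0] at h1
    have hxm0 : 0 ≤ x ^ m := Real.rpow_nonneg hx0 m
    have h4 : c * (a y * x ^ m) ≤ c * (a y ^ m * x ^ m) :=
      mul_le_mul_of_nonneg_left (mul_le_mul_of_nonneg_right h3 hxm0) hd.c_pos.le
    have h5 : a y * (c * x ^ m) ≤ a y * (q + R * I) := by
      have : q ≤ a y * q := le_mul_of_one_le_left hq0 (ha.one_le y)
      calc a y * (c * x ^ m) = c * (a y * x ^ m) := by ring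
        _ ≤ q + R * a y * I := h4.trans (h1.trans hP)
        _ ≤ a y * (q + R * I) := by linarith
    exact le_of_mul_le_mul_left h5 (ha0 y)
  have hxm0 : 0 ≤ x ^ m := Real.rpow_nonneg hx0 m
  have hpow : x ^ (2 * m) = (x ^ m) ^ 2 := by
    rw [mul_comm, Real.rpow_mul hx0]; norm_num
  rw [hpow]
  have hc2 : 0 < c ^ 2 := pow_pos hd.c_pos 2
  have h6 : c ^ 2 * (x ^ m) ^ 2 ≤ 2 * (q ^ 2 + R ^ 2 * I ^ 2) := by
    have h7 : (c * x ^ m) ^ 2 ≤ (q + R * I) ^ 2 :=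
      pow_le_pow_left₀ (mul_nonneg hd.c_pos.le hxm0) hxm 2
    nlinarith [sq_nonneg (q - R * I)]
  have h8 : 2 * (q ^ 2 + R ^ 2 * I ^ 2) ≤
      2 * (q ^ 2 + R ^ 2 * (3 * (1 + b ^ 2 + CV ^ 2))) * (1 + X + M) := by
    have h9 : I ^ 2 ≤ 3 * (1 + b ^ 2 + CV ^ 2) * (1 + X + M) := by
      nlinarith [mul_nonneg (sq_nonneg b) hX, mul_nonneg (sq_nonneg b) hM,
        mul_nonneg (sq_nonneg CV) hX, mul_nonneg (sq_nonneg CV) hM, sq_nonneg b, sq_nonneg CV]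
    have h10 : q ^ 2 ≤ q ^ 2 * (1 + X + M) := le_mul_of_one_le_right (sq_nonneg q) (by linarith)
    have h11 := mul_le_mul_of_nonneg_left h9 (sq_nonneg R)
    linarith
  have h12 : (x ^ m) ^ 2 ≤ 2 * ((q ^ 2 + R ^ 2 * (3 * (1 + b ^ 2 + CV ^ 2))) / c ^ 2) *
      (1 + X + M) := by
    rw [show 2 * ((q ^ 2 + R ^ 2 * (3 * (1 + b ^ 2 + CV ^ 2))) / c ^ 2) * (1 + X + M) =
      (2 * (q ^ 2 + R ^ 2 * (3 * (1 + b ^ 2 + CV ^ 2))) * (1 + X + M)) / c ^ 2 by ring,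
      le_div_iff₀ hc2]
    linarith
  linarith
end

section
variable {m c K : ℝ} {φ D S Q : ℝ → ℝ} {a V V' : ℝ → ℝ} {CV : ℝ}

theorem le_max_one_of_rpow_le {x p E : ℝ} (hp : 1 ≤ p) (h : x ^ p ≤ E) : x ≤ max 1 E := by
  rcases le_total x 1 with h1 | h1
  · exact h1.trans (le_max_left _ _)
  · refine le_trans ?_ (h.trans (le_max_right _ _))
    simpa using Real.rpow_le_rpow_of_exponent_le h1 hp

/-- Local equicontinuity of densities with a chemical potential. -/
theorem exists_density_modulus (hd : EnergyDual m φ D S Q c K) (ha : CoeffRegular a)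
    (hV : PotentialRegular V V' CV) {X M : ℝ} (hX : 0 ≤ X) (hM : 0 ≤ M) (R : ℝ) {ε : ℝ}
    (hε : 0 < ε) :
    ∃ δ : ℝ, 0 < δ ∧ ∀ (ρ : ProbabilityMeasure ℝ) (κ v : ℝ → ℝ),
      HasChemicalPotential a V' S ρ κ v →
      ∫⁻ y, ENNReal.ofReal (v y ^ 2) ∂(ρ : Measure ℝ) ≤ ENNReal.ofReal X →
      ∫⁻ y, ENNReal.ofReal (y ^ 2) ∂(ρ : Measure ℝ) ≤ ENNReal.ofReal M →
      ∀ x ∈ Icc (-R) R, ∀ y ∈ Icc (-R) R, |x - y| < δ →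
        |S (κ x) / a x - S (κ y) / a y| < ε := by
  have ha0 : ∀ y, 0 < a y := fun y => one_pos.trans_le (ha.one_le y)
  have hm0 : 0 < m := one_pos.trans hd.one_lt
  obtain ⟨C, hC, hbd⟩ := exists_density_bound hd ha hV
  set b := max 1 (C * (1 + X + M)) with hb
  have hb1 : 1 ≤ b := le_max_left _ _
  obtain ⟨A0, hA0⟩ := (isCompact_Icc (a := -R) (b := R)).exists_bound_of_continuousOn
    ha.cont.continuousOn
  obtain ⟨B0, hB0⟩ := (isCompact_Icc (a := -R) (b := R)).exists_bound_of_continuousOn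
    hV.cont'.continuousOn
  set A := max 1 A0 with hA
  set B := max 0 B0 with hB
  have hA1 : 1 ≤ A := le_max_left _ _
  have hBnn : 0 ≤ B := le_max_left _ _
  have hAb : ∀ t ∈ Icc (-R) R, a t ≤ A := fun t ht =>
    (le_abs_self _).trans ((hA0 t ht).trans (le_max_right _ _))
  have hBb : ∀ t ∈ Icc (-R) R, |V' t| ≤ B := fun t ht => (hB0 t ht).trans (le_max_right _ _)
  obtain ⟨δ1, hδ1, hac⟩ := Metric.uniformContinuousOn_iff.1
    ((isCompact_Icc (a := -R) (b := R)).uniformContinuousOn_of_continuous ha.cont.continuousOn)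
    (ε / (2 * b)) (by positivity)
  set e := c * (ε / 2) ^ m with he
  have he0 : 0 < e := mul_pos hd.c_pos (Real.rpow_pos_of_pos (by linarith) m)
  -- The slope is split by `|v| ≤ θ v² + 1 / θ`. This `θ` makes the `v²` part at most `e / 2` on any
  -- interval, and the rest costs at most `L` per unit length.
  set θ := e / (2 * A * (X + 1)) with hθ
  have hθ0 : 0 < θ := by positivity
  set L := A * b * (1 / θ + B) with hL
  have hL0 : 0 < L := by positivity
  refine ⟨min δ1 (e / (2 * L)), lt_min hδ1 (by positivity), ?_⟩
  intro ρ κ v h hvX hyM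
  obtain ⟨iv2, -, bv⟩ := integrable_sq_of_lintegral_le h.meas hX hvX
  have hr0 : ∀ t, 0 ≤ S (κ t) / a t := fun t => div_nonneg (hd.S_nonneg _) (ha0 t).le
  have hrb : ∀ t, S (κ t) / a t ≤ b := fun t =>
    le_max_one_of_rpow_le (by linarith [hd.one_lt]) (hbd ρ κ v X M h hX hM hvX hyM t)
  have hUa : ∀ t, S (κ t) = a t * (S (κ t) / a t) := fun t => by
    have := (ha0 t).ne'; field_simp
  have hpress : ∀ x ∈ Icc (-R) R, ∀ y ∈ Icc (-R) R, x ≤ y → y - x < e / (2 * L) →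
      |Q (κ y) - Q (κ x)| < e := by
    intro x hx y hy hxy hδ
    obtain ⟨hint, heq⟩ := h.integral_eq hd hV.cont' x y
    have h1 := h.integral_le hd ha (w := fun t => v t ^ 2) (fun t => sq_nonneg _) iv2
      (A := A * θ) (by positivity) hxy (hint.abs.sub (intervalIntegrable_const (c := L)))
      (fun t ht => by
        have htR : t ∈ Icc (-R) R := ⟨hx.1.trans ht.1, ht.2.trans hy.2⟩
        have h2 : |v t - V' t| ≤ θ * v t ^ 2 + (1 / θ + B) := by
          have h3 := abs_sub (v t) (V' t)
          have h4 := hBb t htR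
          have h5 : |v t| ≤ θ * v t ^ 2 + 1 / θ := by
            have h6 : 0 ≤ θ * (|v t| - 1 / (2 * θ)) ^ 2 := by positivity
            have h7 : θ * (|v t| - 1 / (2 * θ)) ^ 2 = θ * |v t| ^ 2 - |v t| + 1 / (4 * θ) := by
              field_simp; ring
            rw [h7, sq_abs] at h6
            have h8 : 1 / (4 * θ) ≤ 1 / θ :=
              one_div_le_one_div_of_le hθ0 (by linarith)
            linarith
          linarith
        simp only [abs_mul, abs_of_nonneg (hd.S_nonneg _)]
        have h9 : S (κ t) * |v t - V' t| ≤
            (A * (S (κ t) / a t)) * (θ * v t ^ 2 + (1 / θ + B)) := by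
          refine mul_le_mul ?_ h2 (abs_nonneg _) (mul_nonneg (by linarith) (hr0 t))
          conv_lhs => rw [hUa t]
          exact mul_le_mul_of_nonneg_right (hAb t htR) (hr0 t)
        have h10 : (A * (S (κ t) / a t)) * (1 / θ + B) ≤ L := by
          rw [hL]
          refine mul_le_mul_of_nonneg_right ?_ (by positivity)
          exact mul_le_mul_of_nonneg_left (hrb t) (by linarith)
        linarith)
    rw [intervalIntegral.integral_sub hint.abs intervalIntegrable_const,
      intervalIntegral.integral_const, smul_eq_mul] at h1
    have h2 : |Q (κ y) - Q (κ x)| ≤ ∫ t in x..y, |S (κ t) * (v t - V' t)| := by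
      rw [heq]; exact intervalIntegral.abs_integral_le_integral_abs hxy
    have h3 : (y - x) * L < e / 2 := by
      rw [lt_div_iff₀ (by positivity)] at hδ
      linarith
    have h4 : A * θ * ∫ t, v t ^ 2 ∂(ρ : Measure ℝ) ≤ e / 2 := by
      have h5 : A * θ * ∫ t, v t ^ 2 ∂(ρ : Measure ℝ) ≤ A * θ * (X + 1) :=
        mul_le_mul_of_nonneg_left (by linarith) (by positivity)
      have h6 : A * θ * (X + 1) = e / 2 := by
        rw [hθ]; field_simp
      linarith
    linarith
  intro x hx y hy hxy
  have hpr : |Q (κ x) - Q (κ y)| < e := by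
    have h1 : |x - y| < e / (2 * L) := hxy.trans_le (min_le_right _ _)
    rcases le_total x y with hle | hle
    · rw [abs_sub_comm]
      exact hpress x hx y hy hle (by rw [abs_sub_comm] at h1; exact (le_abs_self _).trans_lt h1)
    · exact hpress y hy x hx hle ((le_abs_self _).trans_lt h1)
  -- Coercivity: an oscillation of the pressure below `c (ε / 2) ^ m` forces one of `S κ` below `ε /
  -- 2`.
  have hu : |S (κ x) - S (κ y)| < ε / 2 := by
    by_contra! hcon
    have h1 := Real.rpow_le_rpow (by linarith) hcon hm0.le
    have h2 := mul_le_mul_of_nonneg_left h1 hd.c_pos.le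
    linarith [hd.coercive (κ x) (κ y)]
  have haxy : |a x - a y| < ε / (2 * b) := hac x hx y hy (hxy.trans_le (min_le_left _ _))
  have hsplit : S (κ x) / a x - S (κ y) / a y =
      (S (κ x) - S (κ y)) / a x - (S (κ y) / a y) * ((a x - a y) / a x) := by
    have := (ha0 x).ne'
    have := (ha0 y).ne'
    field_simp
    ring
  have hdiv : ∀ z, |z / a x| ≤ |z| := fun z => by
    rw [abs_div, abs_of_pos (ha0 x)]
    exact div_le_self (abs_nonneg _) (ha.one_le x)
  rw [hsplit]
  calc _ ≤ |(S (κ x) - S (κ y)) / a x| + |(S (κ y) / a y) * ((a x - a y) / a x)| := abs_sub _ _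
    _ ≤ |S (κ x) - S (κ y)| + b * |a x - a y| := by
        refine add_le_add (hdiv _) ?_
        rw [abs_mul, abs_of_nonneg (hr0 y)]
        exact mul_le_mul (hrb y) (hdiv _) (abs_nonneg _) (by linarith)
    _ < ε / 2 + b * (ε / (2 * b)) := add_lt_add_of_lt_of_le hu
        (mul_le_mul_of_nonneg_left haxy.le (by linarith))
    _ = ε := by field_simp; ring
end

/-! ### From narrow convergence to convergence in `L¹` -/

theorem integral_density_eq_one {μ : ProbabilityMeasure ℝ} (h : (μ : Measure ℝ) ≪ volume) :
    Integrable (density μ) ∧ ∫ y, density μ y = 1 :=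
  ⟨Measure.integrable_toReal_rnDeriv, by
    have := Measure.integral_toReal_rnDeriv h
    rw [probReal_univ] at this
    exact this⟩

/-- Scheffé's lemma for probability densities. -/
theorem tendsto_integral_abs_sub_of_ae_tendsto {ι : Type*} {l : Filter ι}
    [l.IsCountablyGenerated] {p : ι → ℝ → ℝ} {q : ℝ → ℝ}
    (hp : ∀ i, Integrable (p i)) (hq : Integrable q) (hp0 : ∀ i y, 0 ≤ p i y)
    (hq0 : ∀ y, 0 ≤ q y) (hpq : ∀ i, ∫ y, p i y = ∫ y, q y)
    (hlim : ∀ᵐ y, Tendsto (fun i => p i y) l (𝓝 (q y))) :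
    Tendsto (fun i => ∫ y, |p i y - q y|) l (𝓝 0) := by
  -- Equal masses reduce the `L¹` distance to the positive part of `q - p i`, which is dominated by
  -- `q`.
  have h1 : ∀ i, ∫ y, |p i y - q y| = 2 * ∫ y, max (q y - p i y) 0 := by
    intro i
    have hpart : Integrable (fun y => max (q y - p i y) 0) := (hq.sub (hp i)).pos_part
    have h2 : (fun y => |p i y - q y|) = fun y => 2 * max (q y - p i y) 0 + (p i y - q y) := by
      ext y
      rcases le_total (p i y) (q y) with h | h
      · rw [abs_of_nonpos (by linarith), max_eq_left (by linarith)]; ring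
      · rw [abs_of_nonneg (by linarith), max_eq_right (by linarith)]; ring
    have h3 : Integrable (fun y => p i y - q y) := (hp i).sub hq
    rw [h2, integral_add (hpart.const_mul 2) h3, integral_const_mul, integral_sub (hp i) hq,
      hpq i]
    ring
  have h2 : Tendsto (fun i => ∫ y, max (q y - p i y) 0) l (𝓝 (∫ _ : ℝ, (0 : ℝ))) := by
    refine tendsto_integral_filter_of_dominated_convergence q
      (Eventually.of_forall fun i => ((hq.sub (hp i)).pos_part).aestronglyMeasurable)
      (Eventually.of_forall fun i => ae_of_all _ fun y => ?_) hq ?_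
    · rw [Real.norm_of_nonneg (le_max_right _ _)]
      exact max_le (by linarith [hp0 i y]) (hq0 y)
    · filter_upwards [hlim] with y hy
      have := (tendsto_const_nhds (x := q y)).sub hy
      rw [sub_self] at this
      simpa using this.max (tendsto_const_nhds (x := (0 : ℝ)))
  simp only [integral_zero] at h2
  simp_rw [h1]
  simpa using h2.const_mul 2

/-- Narrow convergence of locally equicontinuous densities implies convergence in `L¹`. -/
theorem tendsto_density_of_equicontinuous {ι : Type*} {l : Filter ι} [l.IsCountablyGenerated]
    {μ : ι → ProbabilityMeasure ℝ} {ρ : ProbabilityMeasure ℝ} (hμ : Tendsto μ l (𝓝 ρ))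
    (hμac : ∀ i, (μ i : Measure ℝ) ≪ volume) (hρ : (ρ : Measure ℝ) ≪ volume)
    {r : ι → ℝ → ℝ} (hr0 : ∀ i y, 0 ≤ r i y) (hrc : ∀ i, Continuous (r i))
    (hr : ∀ i, ∀ᵐ y, density (μ i) y = r i y)
    (hmod : ∀ R ε : ℝ, 0 < ε → ∃ δ : ℝ, 0 < δ ∧ ∀ i, ∀ x ∈ Icc (-R) R, ∀ y ∈ Icc (-R) R,
      |x - y| < δ → |r i x - r i y| < ε) :
    Tendsto (fun i => ∫ y, |density (μ i) y - density ρ y|) l (𝓝 0) := by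
  have hmass : ∀ i (x y : ℝ), (μ i : Measure ℝ).real (Icc x y) = ∫ t in Icc x y, r i t := by
    intro i x y
    rw [← Measure.setIntegral_toReal_rnDeriv (hμac i)]
    refine integral_congr_ae (ae_restrict_of_ae ?_)
    filter_upwards [hr i] with t ht using ht
  -- At a Lebesgue point of the limit, its density is close to the mean of `ρ` over a small
  -- interval. That mean is the limit of the means of `μ i`, because the end points are null, and by
  -- equicontinuity these are close to `r i y`.
  have hpt : ∀ᵐ y, Tendsto (fun i => r i y) l (𝓝 (density ρ y)) := by
    filter_upwards [Besicovitch.ae_tendsto_rnDeriv (ρ : Measure ℝ) volume,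
      Measure.rnDeriv_lt_top (ρ : Measure ℝ) volume] with y hy hlt
    have hy' : Tendsto (fun δ : ℝ => (ρ : Measure ℝ).real (Icc (y - δ) (y + δ)) / (2 * δ))
        (𝓝[>] 0) (𝓝 (density ρ y)) := by
      have h1 := (ENNReal.tendsto_toReal hlt.ne).comp hy
      refine h1.congr' ?_
      filter_upwards [self_mem_nhdsWithin] with δ hδ
      have hδ' : (0:ℝ) < δ := hδ
      simp only [Function.comp_apply, Real.closedBall_eq_Icc, ENNReal.toReal_div, Real.volume_Icc]
      rw [ENNReal.toReal_ofReal (by linarith)]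
      congr 1
      ring
    rw [Metric.tendsto_nhds]
    intro ε hε
    obtain ⟨δ0, hδ0, hmodδ⟩ := hmod (|y| + 1) (ε / 3) (by linarith)
    have h1 := Metric.tendsto_nhds.1 hy' (ε / 3) (by linarith)
    have h2 : ∀ᶠ δ : ℝ in 𝓝[>] 0, δ ∈ Ioo 0 (min δ0 1) :=
      Ioo_mem_nhdsGT (lt_min hδ0 one_pos)
    obtain ⟨δ, hδ1, hδ2⟩ := (h1.and h2).exists
    have hδpos : 0 < δ := hδ2.1
    have hδlt : δ < δ0 := hδ2.2.trans_le (min_le_left _ _)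
    have hδle : δ < 1 := hδ2.2.trans_le (min_le_right _ _)
    have hfront : (ρ : Measure ℝ) (frontier (Icc (y - δ) (y + δ))) = 0 := by
      refine hρ ?_
      rw [frontier_Icc (by linarith)]
      exact (Set.toFinite _).measure_zero _
    have h3 := ProbabilityMeasure.tendsto_measure_of_null_frontier_of_tendsto' hμ hfront
    have h4 := ((ENNReal.tendsto_toReal (measure_ne_top _ _)).comp h3).div_const (2 * δ)
    have h5 := Metric.tendsto_nhds.1 h4 (ε / 3) (by linarith)
    filter_upwards [h5] with i hi
    have hclose : |(μ i : Measure ℝ).real (Icc (y - δ) (y + δ)) / (2 * δ) - r i y| ≤ ε / 3 := by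
      rw [hmass i, integral_Icc_eq_integral_Ioc,
        ← intervalIntegral.integral_of_le (by linarith : y - δ ≤ y + δ)]
      have e1 : (∫ t in (y - δ)..(y + δ), r i t) / (2 * δ) - r i y =
          (∫ t in (y - δ)..(y + δ), (r i t - r i y)) / (2 * δ) := by
        rw [intervalIntegral.integral_sub ((hrc i).intervalIntegrable _ _)
          intervalIntegrable_const, intervalIntegral.integral_const, smul_eq_mul]
        field_simp
        ring
      rw [e1, abs_div, abs_of_pos (by linarith : 0 < 2 * δ), div_le_iff₀ (by linarith)]
      have e2 := intervalIntegral.norm_integral_le_of_norm_le_const (a := y - δ) (b := y + δ)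
        (f := fun t => r i t - r i y) (C := ε / 3) (fun t ht => by
          rw [uIoc_of_le (by linarith)] at ht
          have hty : |t - y| ≤ δ := abs_le.2 ⟨by linarith [ht.1], by linarith [ht.2]⟩
          have hy1 : y ∈ Icc (-(|y| + 1)) (|y| + 1) :=
            ⟨by linarith [neg_abs_le y], by linarith [le_abs_self y]⟩
          have ht1 : t ∈ Icc (-(|y| + 1)) (|y| + 1) :=
            ⟨by linarith [neg_abs_le y, ht.1], by linarith [le_abs_self y, ht.2]⟩
          exact (hmodδ i t ht1 y hy1 (hty.trans_lt hδlt)).le)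
      rw [Real.norm_eq_abs, abs_of_pos (by linarith : 0 < y + δ - (y - δ))] at e2
      linarith
    have hi' : |(μ i : Measure ℝ).real (Icc (y - δ) (y + δ)) / (2 * δ) -
        (ρ : Measure ℝ).real (Icc (y - δ) (y + δ)) / (2 * δ)| < ε / 3 := hi
    rw [Real.dist_eq] at hδ1 ⊢
    rw [abs_le] at hclose
    rw [abs_lt] at hδ1 hi' ⊢
    constructor <;> linarith [hclose.1, hclose.2, hδ1.1, hδ1.2, hi'.1, hi'.2]
  have hint : ∀ i, Integrable (r i) ∧ ∫ y, r i y = 1 := by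
    intro i
    obtain ⟨h1, h2⟩ := integral_density_eq_one (hμac i)
    exact ⟨h1.congr (hr i), by rw [← h2]; exact integral_congr_ae (by filter_upwards [hr i] with y hy using hy.symm)⟩
  obtain ⟨hi0, hi1⟩ := integral_density_eq_one hρ
  have := tendsto_integral_abs_sub_of_ae_tendsto (fun i => (hint i).1) hi0 hr0 (density_nonneg ρ)
    (fun i => by rw [(hint i).2, hi1]) hpt
  refine this.congr fun i => integral_congr_ae ?_
  filter_upwards [hr i] with y hy
  rw [hy]
-- A priori estimates for the scheme
-- Young's inequality under an optimal plan, with weight `τ`: iteration multiplies by `1 + τ`, while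
-- the factor `1 + 1 / τ` is compensated by a sum of squared distances of order `τ`.
theorem secondMoment_le (μ η : ProbabilityMeasure ℝ) {τ : ℝ} (hτ : 0 < τ) :
    ∫⁻ x, ENNReal.ofReal (x ^ 2) ∂(μ : Measure ℝ) ≤
      ENNReal.ofReal (1 + τ) * ∫⁻ x, ENNReal.ofReal (x ^ 2) ∂(η : Measure ℝ) +
        ENNReal.ofReal (1 + 1 / τ) * W2sq μ η := by
  obtain ⟨γ, _, h1, h2, h3⟩ := exists_optimal_plan μ η
  have hm : Measurable fun x : ℝ => ENNReal.ofReal (x ^ 2) := by fun_prop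
  rw [← h3, ← h1, ← h2, lintegral_map hm measurable_fst, lintegral_map hm measurable_snd,
    ← lintegral_const_mul _ (by fun_prop), ← lintegral_const_mul _ (by fun_prop),
    ← lintegral_add_left (by fun_prop)]
  refine lintegral_mono fun p => ?_
  rw [← ENNReal.ofReal_mul (by positivity), ← ENNReal.ofReal_mul (by positivity),
    ← ENNReal.ofReal_add (by positivity) (by positivity)]
  refine ENNReal.ofReal_le_ofReal ?_
  have h : (1 + τ) * p.2 ^ 2 + (1 + 1 / τ) * (p.1 - p.2) ^ 2 - p.1 ^ 2 =
      (τ * p.2 - (p.1 - p.2)) ^ 2 / τ := by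
    field_simp
    ring
  have : 0 ≤ (τ * p.2 - (p.1 - p.2)) ^ 2 / τ := by positivity
  linarith

section scheme

variable {g φ W : ℝ → ℝ} {ρ₀ : ProbabilityMeasure ℝ} {τ : ℝ} {σ : ℕ → ProbabilityMeasure ℝ}

theorem IsJKOSequence.finiteSecondMoment (h : IsJKOSequence g φ W ρ₀ τ σ)
    (hρ₀ : FiniteSecondMoment ρ₀) : ∀ n, FiniteSecondMoment (σ n)
  | 0 => by rw [h.init]; exact hρ₀
  | n + 1 => h.mem n

/-- The previous iterate is itself a competitor, at distance zero. -/
theorem IsJKOSequence.penalized_le (h : IsJKOSequence g φ W ρ₀ τ σ)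
    (hρ₀ : FiniteSecondMoment ρ₀) (n : ℕ) :
    W2sq (σ (n + 1)) (σ n) / ENNReal.ofReal (2 * τ) + energy g φ W (σ (n + 1)) ≤
      energy g φ W (σ n) := by
  have := h.isMin n (σ n) (h.finiteSecondMoment hρ₀ n)
  simpa [penalized, W2sq_self] using this

theorem IsJKOSequence.energy_le (h : IsJKOSequence g φ W ρ₀ τ σ) (hρ₀ : FiniteSecondMoment ρ₀) :
    ∀ n, energy g φ W (σ n) ≤ energy g φ W ρ₀
  | 0 => by rw [h.init]
  | n + 1 => (le_add_self.trans (h.penalized_le hρ₀ n)).trans (h.energy_le hρ₀ n)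

theorem IsJKOSequence.W2sq_lt_top (h : IsJKOSequence g φ W ρ₀ τ σ) (hρ₀ : FiniteSecondMoment ρ₀)
    (hE : energy g φ W ρ₀ < ⊤) (n : ℕ) : W2sq (σ (n + 1)) (σ n) < ⊤ := by
  have h1 := ((le_self_add.trans (h.penalized_le hρ₀ n)).trans (h.energy_le hρ₀ n)).trans_lt hE
  by_contra h2
  rw [not_lt_top_iff] at h2
  rw [h2, ENNReal.top_div_of_ne_top ENNReal.ofReal_ne_top] at h1
  exact lt_irrefl _ h1

theorem IsJKOSequence.toReal_penalized_le (h : IsJKOSequence g φ W ρ₀ τ σ) (hτ : 0 < τ)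
    (hρ₀ : FiniteSecondMoment ρ₀) (hE : energy g φ W ρ₀ < ⊤) (n : ℕ) :
    (W2sq (σ (n + 1)) (σ n)).toReal / (2 * τ) + (energy g φ W (σ (n + 1))).toReal ≤
      (energy g φ W (σ n)).toReal := by
  have hfin := fun k => ((h.energy_le hρ₀ k).trans_lt hE).ne
  have h1 := ENNReal.toReal_mono (hfin n) (h.penalized_le hρ₀ n)
  have h2 : W2sq (σ (n + 1)) (σ n) / ENNReal.ofReal (2 * τ) ≠ ⊤ :=
    ((le_self_add.trans (h.penalized_le hρ₀ n)).trans_lt (hfin n).lt_top).ne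
  rwa [ENNReal.toReal_add h2 (hfin _), ENNReal.toReal_div,
    ENNReal.toReal_ofReal (by positivity)] at h1

theorem IsJKOSequence.sum_W2sq_le (h : IsJKOSequence g φ W ρ₀ τ σ) (hτ : 0 < τ)
    (hρ₀ : FiniteSecondMoment ρ₀) (hE : energy g φ W ρ₀ < ⊤) (N : ℕ) :
    ∑ n ∈ Finset.range N, (W2sq (σ (n + 1)) (σ n)).toReal ≤
      2 * τ * (energy g φ W ρ₀).toReal := by
  have h1 : ∑ n ∈ Finset.range N, (W2sq (σ (n + 1)) (σ n)).toReal / (2 * τ) +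
      (energy g φ W (σ N)).toReal ≤ (energy g φ W ρ₀).toReal := by
    induction N with
    | zero => simp [h.init]
    | succ N ih =>
      rw [Finset.sum_range_succ]
      linarith [h.toReal_penalized_le hτ hρ₀ hE N]
  rw [← Finset.sum_div] at h1
  have h2 := ENNReal.toReal_nonneg (a := energy g φ W (σ N))
  have h3 : (∑ n ∈ Finset.range N, (W2sq (σ (n + 1)) (σ n)).toReal) / (2 * τ) ≤
    (energy g φ W ρ₀).toReal := by linarith
  rw [div_le_iff₀ (by positivity)] at h3
  linarith

theorem IsJKOSequence.secondMoment_le (h : IsJKOSequence g φ W ρ₀ τ σ) (hτ : 0 < τ)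
    (hρ₀ : FiniteSecondMoment ρ₀) (hE : energy g φ W ρ₀ < ⊤) (n : ℕ) :
    ∫⁻ x, ENNReal.ofReal (x ^ 2) ∂(σ n : Measure ℝ) ≤
      ENNReal.ofReal (Real.exp (n * τ) *
        ((∫⁻ x, ENNReal.ofReal (x ^ 2) ∂(ρ₀ : Measure ℝ)).toReal +
          2 * (1 + τ) * (energy g φ W ρ₀).toReal)) := by
  set M := (∫⁻ x, ENNReal.ofReal (x ^ 2) ∂(ρ₀ : Measure ℝ)).toReal with hM
  have hM0 : 0 ≤ M := ENNReal.toReal_nonneg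
  have hw : ∀ k, 0 ≤ (W2sq (σ (k + 1)) (σ k)).toReal := fun k => ENNReal.toReal_nonneg
  -- A discrete Grönwall argument: `1 + τ ≤ exp τ` at each step, and the exponential may multiply
  -- the accumulated distances too, being at least one.
  have h1 : ∫⁻ x, ENNReal.ofReal (x ^ 2) ∂(σ n : Measure ℝ) ≤
      ENNReal.ofReal (Real.exp (n * τ) * (M + (1 + 1 / τ) *
        ∑ k ∈ Finset.range n, (W2sq (σ (k + 1)) (σ k)).toReal)) := by
    induction n with
    | zero => rw [h.init]; simp [hM, ENNReal.ofReal_toReal hρ₀.ne]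
    | succ n ih =>
      refine (DegenerateMobility.secondMoment_le (σ (n + 1)) (σ n) hτ).trans ?_
      have hs : 0 ≤ ∑ k ∈ Finset.range n, (W2sq (σ (k + 1)) (σ k)).toReal :=
        Finset.sum_nonneg fun k _ => hw k
      have hA : 0 ≤ M + (1 + 1 / τ) * ∑ k ∈ Finset.range n, (W2sq (σ (k + 1)) (σ k)).toReal := by
        positivity
      have hB : 0 ≤ (1 + 1 / τ) * (W2sq (σ (n + 1)) (σ n)).toReal := by positivity
      rw [← ENNReal.ofReal_toReal (h.W2sq_lt_top hρ₀ hE n).ne, ← ENNReal.ofReal_mul (by positivity)]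
      refine (add_le_add (mul_le_mul' le_rfl ih) le_rfl).trans ?_
      rw [← ENNReal.ofReal_mul (by positivity), ← ENNReal.ofReal_add (by positivity) hB]
      refine ENNReal.ofReal_le_ofReal ?_
      rw [Finset.sum_range_succ, mul_add (1 + 1 / τ), ← add_assoc, mul_add (Real.exp (↑(n + 1) * τ))]
      refine add_le_add ?_ ?_
      · rw [← mul_assoc]
        refine mul_le_mul_of_nonneg_right ?_ hA
        push_cast
        rw [add_mul _ _ τ, one_mul, Real.exp_add, mul_comm]
        exact mul_le_mul_of_nonneg_left (by linarith [Real.add_one_le_exp τ]) (Real.exp_nonneg _)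
      · exact le_mul_of_one_le_left hB (Real.one_le_exp (by positivity))
  refine h1.trans (ENNReal.ofReal_le_ofReal ?_)
  refine mul_le_mul_of_nonneg_left ?_ (Real.exp_nonneg _)
  have h2 := mul_le_mul_of_nonneg_left (h.sum_W2sq_le hτ hρ₀ hE n)
    (show 0 ≤ 1 + 1 / τ by positivity)
  have h3 : (1 + 1 / τ) * (2 * τ * (energy g φ W ρ₀).toReal) =
    2 * (1 + τ) * (energy g φ W ρ₀).toReal := by field_simp; ring
  linarith

variable {m c K CV : ℝ} {D S Q V' : ℝ → ℝ}

/-- The squared `L²` norm of the discrete velocity on the `n`-th time interval. -/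
noncomputable def discreteSpeedSq (τ : ℝ) (σ : ℕ → ProbabilityMeasure ℝ) (n : ℕ) : ℝ :=
  (W2sq (σ n) (σ (n - 1))).toReal / τ ^ 2

theorem discreteSpeedSq_nonneg (τ : ℝ) (σ : ℕ → ProbabilityMeasure ℝ) (n : ℕ) :
    0 ≤ discreteSpeedSq τ σ n := by
  unfold discreteSpeedSq; positivity

theorem IsJKOSequence.sum_discreteSpeedSq_le (h : IsJKOSequence g φ W ρ₀ τ σ) (hτ : 0 < τ)
    (hρ₀ : FiniteSecondMoment ρ₀) (hE : energy g φ W ρ₀ < ⊤) (N : ℕ) :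
    ∑ n ∈ Finset.range N, τ * discreteSpeedSq τ σ (n + 1) ≤ 2 * (energy g φ W ρ₀).toReal := by
  have h1 := h.sum_W2sq_le hτ hρ₀ hE N
  have h2 : ∑ n ∈ Finset.range N, τ * discreteSpeedSq τ σ (n + 1) =
      (∑ n ∈ Finset.range N, (W2sq (σ (n + 1)) (σ n)).toReal) / τ := by
    rw [Finset.sum_div]
    refine Finset.sum_congr rfl fun n _ => ?_
    simp only [discreteSpeedSq, Nat.add_sub_cancel]
    field_simp
  rw [h2, div_le_iff₀ hτ]
  linarith

theorem IsJKOSequence.exists_chemical_potential (h : IsJKOSequence g φ W ρ₀ τ σ) (hτ : 0 < τ)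
    (hρ₀ : FiniteSecondMoment ρ₀) (hE : energy g φ W ρ₀ < ⊤)
    (hd : EnergyDual m φ D S Q c K) (ha : CoeffRegular (coeff g))
    (hV : PotentialRegular (potential g W) V' CV) {n : ℕ} (hn : n ≠ 0) :
    ∃ κ v, HasChemicalPotential (coeff g) V' S (σ n) κ v ∧
      ∫⁻ y, ENNReal.ofReal (v y ^ 2) ∂(σ n : Measure ℝ) ≤
        ENNReal.ofReal (discreteSpeedSq τ σ n) := by
  obtain ⟨n, rfl⟩ := Nat.exists_eq_succ_of_ne_zero hn
  have hfin := (h.energy_le hρ₀ (n + 1)).trans_lt hE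
  obtain ⟨κ, v, h1, h2, h3, h4, h5, h6⟩ := DegenerateMobility.exists_chemical_potential hd ha hV
    (h.mem n) hfin hτ (h.isMin n) (h.W2sq_lt_top hρ₀ hE n)
  refine ⟨κ, v, ⟨absolutelyContinuous_of_energy hfin, h1, h2, h3, h4, h5⟩, h6.le.trans ?_⟩
  simp only [discreteSpeedSq, Nat.succ_eq_add_one, Nat.add_sub_cancel]
  rw [ENNReal.ofReal_div_of_pos (by positivity),
    ENNReal.ofReal_toReal (h.W2sq_lt_top hρ₀ hE n).ne]

end scheme

/-! ### Integrability and measurability of densities and of the narrow limit -/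

/-- A bound on the energy controls the `L^m` norm of the density. -/
theorem lintegral_rpow_le {g φ W : ℝ → ℝ} {m c K CV : ℝ} {D S Q V' : ℝ → ℝ}
    (hd : EnergyDual m φ D S Q c K) (ha : CoeffRegular (coeff g))
    (hV : PotentialRegular (potential g W) V' CV)
    {μ : ProbabilityMeasure ℝ} (h : energy g φ W μ < ⊤) :
    ∫⁻ y, ENNReal.ofReal (density μ y ^ m) ≤
      ENNReal.ofReal (K * ((energy g φ W μ).toReal + 1)) := by
  have hac := absolutelyContinuous_of_energy h
  have hVc : Continuous (potential g W) :=
    continuous_iff_continuousAt.2 fun y => (hV.hasDeriv y).continuousAt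
  have h1 : ∀ y, density μ y ^ m ≤ K * (energyDensity g φ W μ y + density μ y) := by
    intro y
    have hay := ha.one_le y
    have hr := density_nonneg μ y
    have h2 := hd.growth (coeff g y * density μ y) (by positivity)
    -- Again `a ≤ a ^ m`: the weighted energy controls the unweighted power.
    have h3 : density μ y ^ m * coeff g y ≤ (coeff g y * density μ y) ^ m := by
      rw [Real.mul_rpow (by linarith) hr, mul_comm]
      refine mul_le_mul_of_nonneg_right ?_ (by positivity)
      exact Real.self_le_rpow_of_one_le hay hd.one_lt.le
    have h4 : density μ y ^ m ≤ K * (φ (coeff g y * density μ y) / coeff g y + density μ y) := by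
      have h5 : K * (φ (coeff g y * density μ y) / coeff g y + density μ y) =
          K * (φ (coeff g y * density μ y) + coeff g y * density μ y) / coeff g y := by
        field_simp
      rw [h5, le_div_iff₀ (by linarith)]
      exact h3.trans h2
    refine h4.trans (mul_le_mul_of_nonneg_left ?_ hd.K_pos.le)
    have := mul_nonneg (hV.nonneg y) hr
    simp only [energyDensity]
    linarith
  have h0 := fun y => energyDensity_nonneg hd ha hV.nonneg μ y
  calc ∫⁻ y, ENNReal.ofReal (density μ y ^ m)
      ≤ ∫⁻ y, ENNReal.ofReal K * (ENNReal.ofReal (energyDensity g φ W μ y) +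
          ENNReal.ofReal (density μ y)) := by
        refine lintegral_mono fun y => ?_
        rw [← ENNReal.ofReal_add (h0 y) (density_nonneg μ y), ← ENNReal.ofReal_mul hd.K_pos.le]
        exact ENNReal.ofReal_le_ofReal (h1 y)
    _ = ENNReal.ofReal K * (energy g φ W μ + 1) := by
        have hm := (measurable_density μ).ennreal_ofReal
        rw [lintegral_const_mul' _ _ ENNReal.ofReal_ne_top, lintegral_add_right _ hm,
          ← energy_eq_lintegral hd ha hVc hV.nonneg hac]
        have := lintegral_density hac (f := fun _ => 1) measurable_const
        simp only [lintegral_const, measure_univ, mul_one] at this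
        rw [← this]
    _ = _ := by
        rw [ENNReal.ofReal_mul hd.K_pos.le, ENNReal.ofReal_add ENNReal.toReal_nonneg zero_le_one,
          ENNReal.ofReal_toReal h.ne, ENNReal.ofReal_one]

/-- Narrow limits of measures whose densities are bounded in `L^m` are absolutely continuous. -/
theorem absolutelyContinuous_of_tendsto {ι : Type*} {l : Filter ι} [l.NeBot] {m : ℝ} (hm : 1 < m)
    {μ : ι → ProbabilityMeasure ℝ} {ρ : ProbabilityMeasure ℝ} (hμ : Tendsto μ l (𝓝 ρ))
    (hac : ∀ i, (μ i : Measure ℝ) ≪ volume) {B : ℝ≥0∞} (hB : B ≠ ⊤)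
    (hbd : ∀ i, ∫⁻ y, ENNReal.ofReal (density (μ i) y ^ m) ≤ B) :
    (ρ : Measure ℝ) ≪ volume := by
  have hpq := Real.HolderConjugate.conjExponent hm
  set q := m.conjExponent
  have hq : 0 < 1 / q := by have := hpq.symm.pos; positivity
  -- Hölder's inequality gives absolute continuity on open sets, uniformly in `i`. The portmanteau
  -- theorem passes it to the limit, and outer regularity carries it to null sets.
  have h1 : ∀ i, ∀ U : Set ℝ, IsOpen U →
      (μ i : Measure ℝ) U ≤ B ^ (1 / m) * volume U ^ (1 / q) := by
    intro i U hU
    have hmeas := (measurable_density (μ i)).ennreal_ofReal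
    have h2 := ENNReal.lintegral_mul_le_Lp_mul_Lq volume hpq hmeas.aemeasurable
      (g := U.indicator 1) (measurable_one.indicator hU.measurableSet).aemeasurable
    have h3 : (μ i : Measure ℝ) U = ∫⁻ y, ENNReal.ofReal (density (μ i) y) * U.indicator 1 y := by
      rw [← lintegral_density (hac i) (measurable_one.indicator hU.measurableSet),
        lintegral_indicator_one hU.measurableSet]
    have h4 : ∫⁻ y, (U.indicator (1 : ℝ → ℝ≥0∞) y) ^ q = volume U := by
      rw [← lintegral_indicator_one hU.measurableSet]
      refine lintegral_congr fun y => ?_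
      by_cases hy : y ∈ U <;> simp [hy, hpq.symm.pos]
    rw [h3]
    refine h2.trans ?_
    rw [h4]
    have := hpq.pos
    gcongr
    refine le_trans (le_of_eq (lintegral_congr fun y => ?_)) (hbd i)
    rw [ENNReal.ofReal_rpow_of_nonneg (density_nonneg _ _) hpq.pos.le]
  have h2 : ∀ U : Set ℝ, IsOpen U → (ρ : Measure ℝ) U ≤ B ^ (1 / m) * volume U ^ (1 / q) := by
    intro U hU
    refine (ProbabilityMeasure.le_liminf_measure_open_of_tendsto hμ hU).trans ?_
    refine (liminf_le_liminf (Eventually.of_forall fun i => h1 i U hU)).trans ?_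
    simp
  intro s hs
  have h3 : Tendsto (fun ε : ℝ≥0∞ => B ^ (1 / m) * ε ^ (1 / q)) (𝓝[>] 0) (𝓝 0) := by
    have h4 : Tendsto (fun ε : ℝ≥0∞ => ε ^ (1 / q)) (𝓝[>] 0) (𝓝 0) := by
      have := (ENNReal.continuous_rpow_const (y := 1 / q)).tendsto 0
      rw [ENNReal.zero_rpow_of_pos hq] at this
      exact this.mono_left nhdsWithin_le_nhds
    simpa using ENNReal.Tendsto.const_mul h4 (Or.inr
      (ENNReal.rpow_ne_top_of_nonneg (by have := hpq.pos; positivity) hB))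
  refine le_antisymm (ge_of_tendsto h3 ?_) bot_le
  filter_upwards [self_mem_nhdsWithin] with ε (hε : 0 < ε)
  obtain ⟨U, hsU, hU, hUε⟩ := s.exists_isOpen_lt_of_lt ε (hs.trans_lt hε)
  refine ((measure_mono hsU).trans (h2 U hU)).trans ?_
  gcongr

/-- Half-lines generate the Borel sets and their boundary point is null for the limit, so the masses
of half-lines are pointwise limits of measurable functions of `t`. -/
theorem measurable_of_tendsto_narrow {μ : ℕ → ℝ → ProbabilityMeasure ℝ}
    {ρ : ℝ → ProbabilityMeasure ℝ} (hμ : ∀ k, Measurable fun t => (μ k t : Measure ℝ))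
    (h : ∀ t, Tendsto (fun k => μ k t) atTop (𝓝 (ρ t)))
    (hac : ∀ t, (ρ t : Measure ℝ) ≪ volume) : Measurable fun t => (ρ t : Measure ℝ) := by
  refine .measure_of_isPiSystem_of_isProbabilityMeasure (borel_eq_generateFrom_Iic ℝ)
    isPiSystem_Iic ?_
  rintro _ ⟨x, rfl⟩
  refine measurable_of_tendsto_metrizable (f := fun k t => (μ k t : Measure ℝ) (Iic x))
    (fun k => (Measure.measurable_coe measurableSet_Iic).comp (hμ k))
    (tendsto_pi_nhds.2 fun t => ?_)
  refine ProbabilityMeasure.tendsto_measure_of_null_frontier_of_tendsto' (h t) ?_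
  refine hac t ?_
  simp

/-- A measurable family of absolutely continuous probability measures has a jointly measurable
density. -/
theorem exists_jointly_measurable_density {ρ : ℝ → ProbabilityMeasure ℝ}
    (hρ : Measurable fun t => (ρ t : Measure ℝ)) (hac : ∀ t, (ρ t : Measure ℝ) ≪ volume) :
    ∃ r : ℝ × ℝ → ℝ, Measurable r ∧ (∀ p, 0 ≤ r p) ∧ ∀ t,
      (ρ t : Measure ℝ) = volume.withDensity (fun y => ENNReal.ofReal (r (t, y))) := by
  let κ : ProbabilityTheory.Kernel ℝ ℝ := ⟨fun t => (ρ t : Measure ℝ), hρ⟩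
  have : ProbabilityTheory.IsMarkovKernel κ := ⟨fun t => (ρ t).2⟩
  -- A probability measure equivalent to Lebesgue measure: the kernel derivative is taken between
  -- finite kernels and then multiplied by the Gaussian density.
  let γ := ProbabilityTheory.gaussianReal 0 1
  let η : ProbabilityTheory.Kernel ℝ ℝ := ProbabilityTheory.Kernel.const ℝ γ
  have hm1 := ProbabilityTheory.Kernel.measurable_rnDeriv κ η
  have hm2 : Measurable (ProbabilityTheory.gaussianPDF 0 1) :=
    ProbabilityTheory.measurable_gaussianPDF 0 1
  refine ⟨fun p => (ProbabilityTheory.gaussianPDF 0 1 p.2 * κ.rnDeriv η p.1 p.2).toReal,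
    ((hm2.comp measurable_snd).mul hm1).ennreal_toReal, fun p => ENNReal.toReal_nonneg,
    fun t => ?_⟩
  have h1 : (ρ t : Measure ℝ) ≪ γ :=
    (hac t).trans (ProbabilityTheory.gaussianReal_absolutelyContinuous' 0 one_ne_zero)
  have h2 : (ρ t : Measure ℝ) = γ.withDensity (κ.rnDeriv η t) := by
    conv_lhs => rw [← Measure.withDensity_rnDeriv_eq _ _ h1]
    exact withDensity_congr_ae
      (ProbabilityTheory.Kernel.rnDeriv_eq_rnDeriv_measure (κ := κ) (η := η) (a := t)).symm
  have hγ : γ = volume.withDensity (ProbabilityTheory.gaussianPDF 0 1) :=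
    ProbabilityTheory.gaussianReal_of_var_ne_zero 0 one_ne_zero
  rw [h2, hγ, ← withDensity_mul _ hm2 (ProbabilityTheory.Kernel.measurable_rnDeriv_right κ η t)]
  have h3 : ∀ᵐ y ∂γ, κ.rnDeriv η t y < ⊤ :=
    ProbabilityTheory.Kernel.rnDeriv_lt_top κ η
  have h4 : ∀ᵐ y : ℝ, κ.rnDeriv η t y < ⊤ :=
    (ProbabilityTheory.gaussianReal_absolutelyContinuous' 0 one_ne_zero).ae_le h3
  refine withDensity_congr_ae ?_
  filter_upwards [h4] with y hy
  rw [ENNReal.ofReal_toReal (ENNReal.mul_ne_top (show ProbabilityTheory.gaussianPDF 0 1 y ≠ ⊤ from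
    ENNReal.ofReal_ne_top) hy.ne)]
  rfl

/-! ### Interpolation between `L¹` and `L^p` -/

section interpolation

/-- The first term suffices for `x ≤ A`, the second for `x ≥ A`. When `q < p`, a large `A` makes the
coefficient of `x ^ p` small. -/
theorem rpow_le_add_rpow {A x p q : ℝ} (hA : 0 < A) (hx : 0 ≤ x) (hq : 1 ≤ q) (hqp : q ≤ p) :
    x ^ q ≤ A ^ (q - 1) * x + A ^ (q - p) * x ^ p := by
  have h1 : 0 ≤ A ^ (q - 1) * x := by positivity
  have h2 : 0 ≤ A ^ (q - p) * x ^ p := by positivity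
  rcases hx.eq_or_lt with rfl | hx
  · rw [Real.zero_rpow (by linarith)]; linarith
  rcases le_total x A with h | h
  · have h3 : x ^ q = x ^ (q - 1) * x := by
      rw [← Real.rpow_add_one hx.ne']; ring_nf
    have := mul_le_mul_of_nonneg_right
      (Real.rpow_le_rpow hx.le h (by linarith : 0 ≤ q - 1)) hx.le
    linarith
  · have h3 : x ^ q = x ^ (q - p) * x ^ p := by
      rw [← Real.rpow_add hx]; ring_nf
    have := mul_le_mul_of_nonneg_right
      (Real.rpow_le_rpow_of_nonpos hA h (by linarith : q - p ≤ 0)) (Real.rpow_nonneg hx.le p)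
    linarith

variable {α : Type*} [MeasurableSpace α] {μ : Measure α}

theorem lintegral_rpow_enorm_le {f : α → ℝ} (hf : Measurable f) {A p q : ℝ} (hA : 0 < A)
    (hq : 1 ≤ q) (hqp : q ≤ p) :
    ∫⁻ x, ‖f x‖ₑ ^ q ∂μ ≤ ENNReal.ofReal (A ^ (q - 1)) * ∫⁻ x, ‖f x‖ₑ ∂μ +
      ENNReal.ofReal (A ^ (q - p)) * ∫⁻ x, ‖f x‖ₑ ^ p ∂μ := by
  rw [← lintegral_const_mul _ (by fun_prop), ← lintegral_const_mul _ (by fun_prop),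
    ← lintegral_add_left (by fun_prop)]
  refine lintegral_mono fun x => ?_
  rw [← ofReal_norm, ENNReal.ofReal_rpow_of_nonneg (norm_nonneg _) (by linarith),
    ENNReal.ofReal_rpow_of_nonneg (norm_nonneg _) (by linarith),
    ← ENNReal.ofReal_mul (by positivity), ← ENNReal.ofReal_mul (by positivity),
    ← ENNReal.ofReal_add (by positivity) (by positivity)]
  exact ENNReal.ofReal_le_ofReal (rpow_le_add_rpow hA (norm_nonneg _) hq hqp)

/-- Convergence in `L¹` and boundedness in `L^p` give convergence in `L^q` for `1 ≤ q < p`. -/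
theorem tendsto_eLpNorm_of_tendsto_lintegral {f : ℕ → α → ℝ} {r : α → ℝ} {p : ℝ} {B : ℝ≥0∞}
    (hf : ∀ k, Measurable (f k)) (hr : Measurable r) (hB : B ≠ ⊤)
    (hf1 : ∀ k, ∫⁻ x, ‖f k x‖ₑ ∂μ ≠ ⊤) (hr1 : ∫⁻ x, ‖r x‖ₑ ∂μ ≠ ⊤)
    (hfp : ∀ k, ∫⁻ x, ‖f k x‖ₑ ^ p ∂μ ≤ B)
    (hlim : Tendsto (fun k => ∫⁻ x, ‖f k x - r x‖ₑ ∂μ) atTop (𝓝 0))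
    {q : ℝ} (hq : 1 ≤ q) (hqp : q < p) :
    (∀ k, MemLp (f k) (ENNReal.ofReal q) μ) ∧ MemLp r (ENNReal.ofReal q) μ ∧
      Tendsto (fun k => eLpNorm (fun x => f k x - r x) (ENNReal.ofReal q) μ) atTop (𝓝 0) := by
  have hp : 0 < p := by linarith
  have hq0 : ENNReal.ofReal q ≠ 0 := by simp; linarith
  have hp0 : ENNReal.ofReal p ≠ 0 := by simp; linarith
  have hqr : (ENNReal.ofReal q).toReal = q := ENNReal.toReal_ofReal (by linarith)
  have hpr : (ENNReal.ofReal p).toReal = p := ENNReal.toReal_ofReal hp.le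
  have hq' : ∀ h : α → ℝ, eLpNorm h (ENNReal.ofReal q) μ = (∫⁻ x, ‖h x‖ₑ ^ q ∂μ) ^ (1 / q) :=
    fun h => by rw [eLpNorm_eq_lintegral_rpow_enorm_toReal hq0 ENNReal.ofReal_ne_top, hqr]
  have hp' : ∀ h : α → ℝ, eLpNorm h (ENNReal.ofReal p) μ = (∫⁻ x, ‖h x‖ₑ ^ p ∂μ) ^ (1 / p) :=
    fun h => by rw [eLpNorm_eq_lintegral_rpow_enorm_toReal hp0 ENNReal.ofReal_ne_top, hpr]
  -- membership in `L^q`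
  have hmem : ∀ h : α → ℝ, Measurable h → ∫⁻ x, ‖h x‖ₑ ∂μ ≠ ⊤ → ∫⁻ x, ‖h x‖ₑ ^ p ∂μ ≤ B →
      MemLp h (ENNReal.ofReal q) μ := by
    intro h hh h1 h2
    refine ⟨hh.aestronglyMeasurable, ?_⟩
    rw [hq']
    refine ENNReal.rpow_lt_top_of_nonneg (by positivity)
      (ne_top_of_le_ne_top ?_ (lintegral_rpow_enorm_le hh one_pos hq hqp.le))
    exact ENNReal.add_ne_top.2 ⟨ENNReal.mul_ne_top ENNReal.ofReal_ne_top h1,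
      ENNReal.mul_ne_top ENNReal.ofReal_ne_top (ne_top_of_le_ne_top hB h2)⟩
  -- the limit is in `L^p`
  have hrp : ∫⁻ x, ‖r x‖ₑ ^ p ∂μ ≤ B := by
    have h1 : TendstoInMeasure μ f atTop r := by
      refine tendstoInMeasure_of_tendsto_eLpNorm (p := 1) one_ne_zero
        (fun k => (hf k).aestronglyMeasurable) hr.aestronglyMeasurable ?_
      simpa [eLpNorm_one_eq_lintegral_enorm] using hlim
    obtain ⟨ns, -, h2⟩ := h1.exists_seq_tendsto_ae
    calc ∫⁻ x, ‖r x‖ₑ ^ p ∂μ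
        = ∫⁻ x, liminf (fun i => ‖f (ns i) x‖ₑ ^ p) atTop ∂μ := by
          refine lintegral_congr_ae ?_
          filter_upwards [h2] with x hx
          exact ((ENNReal.continuous_rpow_const.tendsto _).comp hx.enorm).liminf_eq.symm
      _ ≤ liminf (fun i => ∫⁻ x, ‖f (ns i) x‖ₑ ^ p ∂μ) atTop :=
          lintegral_liminf_le fun i => (hf (ns i)).enorm.pow_const p
      _ ≤ liminf (fun _ => B) atTop :=
          liminf_le_liminf (Eventually.of_forall fun i => hfp (ns i))
      _ = B := by simp
  refine ⟨fun k => hmem _ (hf k) (hf1 k) (hfp k), hmem r hr hr1 hrp, ?_⟩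
  have hdp : ∃ C : ℝ≥0∞, C ≠ ⊤ ∧ ∀ k, ∫⁻ x, ‖f k x - r x‖ₑ ^ p ∂μ ≤ C := by
    refine ⟨(B ^ (1 / p) + B ^ (1 / p)) ^ p, ?_, fun k => ?_⟩
    · have := ENNReal.rpow_ne_top_of_nonneg (show 0 ≤ 1 / p by positivity) hB
      exact ENNReal.rpow_ne_top_of_nonneg hp.le (ENNReal.add_ne_top.2 ⟨this, this⟩)
    · have h1 : eLpNorm (fun x => f k x - r x) (ENNReal.ofReal p) μ ≤
          B ^ (1 / p) + B ^ (1 / p) := by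
        refine (eLpNorm_sub_le (hf k).aestronglyMeasurable hr.aestronglyMeasurable
          (ENNReal.one_le_ofReal.2 (by linarith))).trans ?_
        rw [hp', hp']
        gcongr
        exact hfp k
      rw [hp'] at h1
      have h2 := ENNReal.rpow_le_rpow h1 hp.le
      rwa [← ENNReal.rpow_mul, one_div_mul_cancel hp.ne', ENNReal.rpow_one] at h2
  obtain ⟨C, hC, hdp⟩ := hdp
  have hmain : Tendsto (fun k => ∫⁻ x, ‖f k x - r x‖ₑ ^ q ∂μ) atTop (𝓝 0) := by
    rw [ENNReal.tendsto_nhds_zero]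
    intro ε hε
    have h1 : Tendsto (fun A : ℝ => ENNReal.ofReal (A ^ (q - p)) * C) atTop (𝓝 0) := by
      have h2 := tendsto_rpow_neg_atTop (show 0 < p - q by linarith)
      rw [neg_sub] at h2
      have h3 := ENNReal.tendsto_ofReal h2
      rw [ENNReal.ofReal_zero] at h3
      simpa using ENNReal.Tendsto.mul_const h3 (Or.inr hC)
    -- The threshold is fixed first, making the `L^p` term small uniformly in `k`; `L¹` convergence
    -- then handles the other term.
    obtain ⟨A, hA1, hA⟩ := ((ENNReal.tendsto_nhds_zero.1 h1 (ε / 2)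
      (ENNReal.half_pos hε.ne')).and (eventually_gt_atTop 0)).exists
    have h4 : Tendsto (fun k => ENNReal.ofReal (A ^ (q - 1)) * ∫⁻ x, ‖f k x - r x‖ₑ ∂μ)
        atTop (𝓝 0) := by
      simpa using ENNReal.Tendsto.const_mul hlim (Or.inr ENNReal.ofReal_ne_top)
    filter_upwards [ENNReal.tendsto_nhds_zero.1 h4 (ε / 2) (ENNReal.half_pos hε.ne')] with k hk
    refine (lintegral_rpow_enorm_le ((hf k).sub hr) hA hq hqp.le).trans ?_
    rw [← ENNReal.add_halves ε]
    refine add_le_add hk ((mul_le_mul' le_rfl (hdp k)).trans hA1)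
  have h5 := (ENNReal.continuous_rpow_const (y := 1 / q)).tendsto 0
  rw [ENNReal.zero_rpow_of_pos (by positivity)] at h5
  simp only [hq']
  exact h5.comp hmain

end interpolation

/-! ### Space-time bounds for the interpolants -/

section interpolants

variable {g φ W : ℝ → ℝ} {ρ₀ : ProbabilityMeasure ℝ} {τ : ℝ} {σ : ℕ → ProbabilityMeasure ℝ}

theorem measurable_interpolant (τ : ℝ) (σ : ℕ → ProbabilityMeasure ℝ) :
    Measurable fun t => (interpolant τ σ t : Measure ℝ) :=
  (measurable_from_nat (f := fun n => (σ n : Measure ℝ))).comp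
    (Nat.measurable_ceil.comp (measurable_id.div_const τ))

theorem measurable_density_interpolant (τ : ℝ) (σ : ℕ → ProbabilityMeasure ℝ) :
    Measurable fun p : ℝ × ℝ => density (interpolant τ σ p.1) p.2 := by
  have h1 : Measurable fun q : ℕ × ℝ => density (σ q.1) q.2 :=
    measurable_from_prod_countable_right fun n => measurable_density (σ n)
  have h2 : Measurable fun p : ℝ × ℝ => (⌈p.1 / τ⌉₊, p.2) :=
    (Nat.measurable_ceil.comp (measurable_fst.div_const τ)).prodMk measurable_snd
  exact h1.comp h2

/-- On `(n τ, (n + 1) τ]` the ceiling equals `n + 1`, which explains the shift; the sum thus starts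
at the first actual minimiser. -/
theorem lintegral_ceil_div_le (hτ : 0 < τ) (F : ℕ → ℝ≥0∞) :
    ∫⁻ t in Ioi 0, F ⌈t / τ⌉₊ ≤ ∑' n : ℕ, ENNReal.ofReal τ * F (n + 1) := by
  have h1 : Ioi (0 : ℝ) ⊆ ⋃ n : ℕ, Ioc (n * τ) ((n + 1) * τ) := by
    intro t (ht : 0 < t)
    have h2 : 0 < ⌈t / τ⌉₊ := Nat.ceil_pos.2 (by positivity)
    obtain ⟨n, hn⟩ := Nat.exists_eq_succ_of_ne_zero h2.ne'
    have h3 := (Nat.ceil_eq_iff (Nat.succ_ne_zero n)).1 hn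
    rw [Nat.succ_eq_add_one, Nat.add_sub_cancel, lt_div_iff₀ hτ, div_le_iff₀ hτ] at h3
    push_cast at h3
    exact mem_iUnion.2 ⟨n, h3⟩
  refine (lintegral_mono_set h1).trans ((lintegral_iUnion_le _ _).trans ?_)
  refine ENNReal.tsum_le_tsum fun n => le_of_eq ?_
  have h2 : ∀ t ∈ Ioc ((n : ℝ) * τ) ((n + 1) * τ), F ⌈t / τ⌉₊ = F (n + 1) := by
    intro t ht
    congr 1
    rw [Nat.ceil_eq_iff (Nat.add_one_ne_zero n), Nat.add_sub_cancel, lt_div_iff₀ hτ,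
      div_le_iff₀ hτ]
    exact_mod_cast ht
  rw [setLIntegral_congr_fun measurableSet_Ioc h2, setLIntegral_const, Real.volume_Ioc, mul_comm]
  congr 2
  ring

theorem IsJKOSequence.lintegral_discreteSpeedSq_le (h : IsJKOSequence g φ W ρ₀ τ σ) (hτ : 0 < τ)
    (hρ₀ : FiniteSecondMoment ρ₀) (hE : energy g φ W ρ₀ < ⊤) :
    ∫⁻ t in Ioi 0, ENNReal.ofReal (discreteSpeedSq τ σ ⌈t / τ⌉₊) ≤
      ENNReal.ofReal (2 * (energy g φ W ρ₀).toReal) := by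
  refine (lintegral_ceil_div_le hτ fun n => ENNReal.ofReal (discreteSpeedSq τ σ n)).trans ?_
  refine ENNReal.tsum_le_of_sum_range_le fun N => ?_
  simp_rw [← ENNReal.ofReal_mul hτ.le]
  rw [← ENNReal.ofReal_sum_of_nonneg fun n _ =>
    mul_nonneg hτ.le (discreteSpeedSq_nonneg τ σ (n + 1))]
  exact ENNReal.ofReal_le_ofReal (h.sum_discreteSpeedSq_le hτ hρ₀ hE N)

theorem IsJKOSequence.secondMoment_interpolant_le (h : IsJKOSequence g φ W ρ₀ τ σ) (hτ : 0 < τ)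
    (hρ₀ : FiniteSecondMoment ρ₀) (hE : energy g φ W ρ₀ < ⊤) {Θ T t : ℝ} (hΘ : τ ≤ Θ)
    (ht : t ∈ Icc 0 T) :
    ∫⁻ x, ENNReal.ofReal (x ^ 2) ∂(interpolant τ σ t : Measure ℝ) ≤
      ENNReal.ofReal (Real.exp (T + Θ) *
        ((∫⁻ x, ENNReal.ofReal (x ^ 2) ∂(ρ₀ : Measure ℝ)).toReal +
          2 * (1 + Θ) * (energy g φ W ρ₀).toReal)) := by
  refine (h.secondMoment_le hτ hρ₀ hE ⌈t / τ⌉₊).trans (ENNReal.ofReal_le_ofReal ?_)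
  have h1 : (⌈t / τ⌉₊ : ℝ) * τ ≤ T + Θ := by
    have h2 := (Nat.ceil_lt_add_one (div_nonneg ht.1 hτ.le)).le
    have h3 := mul_le_mul_of_nonneg_right h2 hτ.le
    rw [add_mul, div_mul_cancel₀ _ hτ.ne'] at h3
    linarith [ht.2]
  gcongr

theorem ceil_div_ne_zero (hτ : 0 < τ) {t : ℝ} (ht : 0 < t) : ⌈t / τ⌉₊ ≠ 0 :=
  (Nat.ceil_pos.2 (by positivity)).ne'

variable {m c K CV : ℝ} {D S Q V' : ℝ → ℝ}

theorem IsJKOSequence.absolutelyContinuous (h : IsJKOSequence g φ W ρ₀ τ σ)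
    (hρ₀ : FiniteSecondMoment ρ₀) (hE : energy g φ W ρ₀ < ⊤) (n : ℕ) :
    (σ n : Measure ℝ) ≪ volume :=
  absolutelyContinuous_of_energy ((h.energy_le hρ₀ n).trans_lt hE)

theorem IsJKOSequence.lintegral_rpow_le (h : IsJKOSequence g φ W ρ₀ τ σ)
    (hρ₀ : FiniteSecondMoment ρ₀) (hE : energy g φ W ρ₀ < ⊤)
    (hd : EnergyDual m φ D S Q c K) (ha : CoeffRegular (coeff g))
    (hV : PotentialRegular (potential g W) V' CV) (n : ℕ) :
    ∫⁻ y, ENNReal.ofReal (density (σ n) y ^ m) ≤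
      ENNReal.ofReal (K * ((energy g φ W ρ₀).toReal + 1)) := by
  refine (DegenerateMobility.lintegral_rpow_le hd ha hV ((h.energy_le hρ₀ n).trans_lt hE)).trans
    (ENNReal.ofReal_le_ofReal (mul_le_mul_of_nonneg_left ?_ hd.K_pos.le))
  have := ENNReal.toReal_mono hE.ne (h.energy_le hρ₀ n)
  linarith

/-- Bound for the `L^{3m}` norm in space and time, uniform in the time step. -/
theorem exists_strip_bound (hρ₀ : FiniteSecondMoment ρ₀) (hE : energy g φ W ρ₀ < ⊤)
    (hd : EnergyDual m φ D S Q c K) (ha : CoeffRegular (coeff g))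
    (hV : PotentialRegular (potential g W) V' CV) {Θ T : ℝ} (hΘ0 : 0 ≤ Θ) :
    ∃ B : ℝ≥0∞, B ≠ ⊤ ∧ ∀ τ σ, 0 < τ → τ ≤ Θ → IsJKOSequence g φ W ρ₀ τ σ →
      ∫⁻ p, ‖density (interpolant τ σ p.1) p.2‖ₑ ^ (3 * m) ∂(strip T) ≤ B := by
  obtain ⟨C, hC, hbd⟩ := exists_density_bound hd ha hV
  set F := (energy g φ W ρ₀).toReal
  have hF : 0 ≤ F := ENNReal.toReal_nonneg
  set M := Real.exp (T + Θ) * ((∫⁻ x, ENNReal.ofReal (x ^ 2) ∂(ρ₀ : Measure ℝ)).toReal +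
    2 * (1 + Θ) * F) with hM
  have hM0 : 0 ≤ M := by positivity
  have hm0 : 0 < m := one_pos.trans hd.one_lt
  refine ⟨ENNReal.ofReal (K * (F + 1)) * (ENNReal.ofReal C * (ENNReal.ofReal (1 + M) *
    volume (Ioc 0 T) + ENNReal.ofReal (2 * F))), ?_, fun τ σ hτ hΘ h => ?_⟩
  · refine ENNReal.mul_ne_top ENNReal.ofReal_ne_top (ENNReal.mul_ne_top ENNReal.ofReal_ne_top
      (ENNReal.add_ne_top.2 ⟨ENNReal.mul_ne_top ENNReal.ofReal_ne_top ?_, ENNReal.ofReal_ne_top⟩))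
    simp
  have hmeas := measurable_density_interpolant τ σ
  have h1 : ∀ t ∈ Ioc 0 T, ∫⁻ y, ‖density (interpolant τ σ t) y‖ₑ ^ (3 * m) ≤
      ENNReal.ofReal (K * (F + 1)) * (ENNReal.ofReal C * (ENNReal.ofReal (1 + M) +
        ENNReal.ofReal (discreteSpeedSq τ σ ⌈t / τ⌉₊))) := by
    intro t ht
    obtain ⟨κ, v, h2, h3⟩ := h.exists_chemical_potential hτ hρ₀ hE hd ha hV
      (ceil_div_ne_zero hτ ht.1)
    have hX := discreteSpeedSq_nonneg τ σ ⌈t / τ⌉₊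
    have h4 := hbd _ κ v _ M h2 hX hM0 h3
      (h.secondMoment_interpolant_le hτ hρ₀ hE hΘ ⟨ht.1.le, ht.2⟩)
    have h5 : ∀ᵐ y, ‖density (interpolant τ σ t) y‖ₑ ^ (3 * m) ≤
        ENNReal.ofReal (density (interpolant τ σ t) y ^ m) *
          (ENNReal.ofReal C * (ENNReal.ofReal (1 + M) +
            ENNReal.ofReal (discreteSpeedSq τ σ ⌈t / τ⌉₊))) := by
      filter_upwards [h2.density_ae_eq ha] with y hy
      have hr := density_nonneg (interpolant τ σ t) y
      rw [Real.enorm_eq_ofReal hr, ENNReal.ofReal_rpow_of_nonneg hr (by positivity),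
        ← ENNReal.ofReal_add (by positivity) hX, ← ENNReal.ofReal_mul hC.le,
        ← ENNReal.ofReal_mul (by positivity)]
      refine ENNReal.ofReal_le_ofReal ?_
      -- The factor `ρ ^ m` is kept for integration in `y`, and `ρ ^ (2 m)` is bounded by its
      -- supremum, which is linear in the squared speed and so integrable in time.
      rw [show 3 * m = m + 2 * m by ring, Real.rpow_add_of_nonneg hr hm0.le (by positivity)]
      refine mul_le_mul_of_nonneg_left ?_ (by positivity)
      have h6 := h4 y
      rw [← hy] at h6
      refine h6.trans (le_of_eq ?_)
      ring
    refine (lintegral_mono_ae h5).trans ?_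
    rw [lintegral_mul_const' _ _ (by finiteness)]
    exact mul_le_mul' (h.lintegral_rpow_le hρ₀ hE hd ha hV _) le_rfl
  -- The time `0` is discarded: the initial datum is not the outcome of a minimisation, so no
  -- chemical potential is available for it.
  rw [strip, lintegral_prod _ (hmeas.enorm.pow_const _).aemeasurable,
    ← Measure.restrict_congr_set Ioc_ae_eq_Icc]
  refine (setLIntegral_mono' measurableSet_Ioc h1).trans ?_
  rw [lintegral_const_mul' _ _ ENNReal.ofReal_ne_top,
    lintegral_const_mul' _ _ ENNReal.ofReal_ne_top, lintegral_add_left measurable_const,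
    setLIntegral_const]
  gcongr
  exact (lintegral_mono_set Ioc_subset_Ioi_self).trans
    (h.lintegral_discreteSpeedSq_le hτ hρ₀ hE)

end interpolants

/-! ### Strong convergence on strips -/

/-- Narrow convergence upgrades to `L¹` convergence along the times where the discrete velocities
stay bounded. -/
theorem tendsto_lintegral_enorm_sub_density {g φ W : ℝ → ℝ} {ρ₀ : ProbabilityMeasure ℝ}
    {m c K CV : ℝ} {D S Q V' : ℝ → ℝ} (hρ₀ : FiniteSecondMoment ρ₀) (hE : energy g φ W ρ₀ < ⊤)
    (hd : EnergyDual m φ D S Q c K) (ha : CoeffRegular (coeff g))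
    (hV : PotentialRegular (potential g W) V' CV) {τ : ℕ → ℝ} {σ : ℕ → ℕ → ProbabilityMeasure ℝ}
    (hτ : ∀ k, 0 < τ k) {Θ : ℝ} (hΘ : ∀ k, τ k ≤ Θ)
    (hσ : ∀ k, IsJKOSequence g φ W ρ₀ (τ k) (σ k)) {t : ℝ} (ht : 0 < t)
    {η : ProbabilityMeasure ℝ} (hη : Tendsto (fun k => interpolant (τ k) (σ k) t) atTop (𝓝 η))
    (hac : (η : Measure ℝ) ≪ volume) {N : ℝ} (hN : 0 ≤ N) :
    Tendsto (fun k => ∫⁻ y, ‖density (interpolant (τ k) (σ k) t) y - density η y‖ₑ)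
      (atTop ⊓ 𝓟 {k | discreteSpeedSq (τ k) (σ k) ⌈t / τ k⌉₊ ≤ N}) (𝓝 0) := by
  set s := {k | discreteSpeedSq (τ k) (σ k) ⌈t / τ k⌉₊ ≤ N} with hs
  set M := Real.exp (t + Θ) * ((∫⁻ x, ENNReal.ofReal (x ^ 2) ∂(ρ₀ : Measure ℝ)).toReal +
    2 * (1 + Θ) * (energy g φ W ρ₀).toReal) with hM
  have hΘ0 : 0 ≤ Θ := (hτ 0).le.trans (hΘ 0)
  have hM0 : 0 ≤ M := by positivity
  have hmom := fun k => (hσ k).secondMoment_interpolant_le (hτ k) hρ₀ hE (hΘ k)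
    (right_mem_Icc.2 ht.le)
  choose κ v h1 h2 using fun k => (hσ k).exists_chemical_potential (hτ k) hρ₀ hE hd ha hV
    (ceil_div_ne_zero (hτ k) ht)
  have hkac := fun k => (hσ k).absolutelyContinuous hρ₀ hE ⌈t / τ k⌉₊
  have ha0 : ∀ y, 0 < coeff g y := fun y => one_pos.trans_le (ha.one_le y)
  -- Restricting to the subtype of slow indices makes the modulus uniform over all remaining
  -- indices. The filter may be trivial, when slow indices are not cofinal; the claim is then empty.
  have hmain : Tendsto (fun i : s => ∫ y, |density (interpolant (τ i) (σ i) t) y - density η y|)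
      (comap Subtype.val atTop) (𝓝 0) := by
    refine tendsto_density_of_equicontinuous (μ := fun i : s => interpolant (τ i) (σ i) t)
      (hη.comp tendsto_comap) (fun i => hkac i) hac
      (r := fun i y => S (κ i y) / coeff g y) ?_ ?_ ?_ ?_
    · exact fun i y => div_nonneg (hd.S_nonneg _) (ha0 y).le
    · exact fun i => (hd.S_cont.comp (h1 i).cont).div ha.cont fun y => (ha0 y).ne'
    · exact fun i => (h1 i).density_ae_eq ha
    · intro R ε hε
      obtain ⟨δ, hδ, hδ'⟩ := exists_density_modulus hd ha hV hN hM0 R hε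
      exact ⟨δ, hδ, fun i => hδ' _ _ _ (h1 i) ((h2 i).trans (ENNReal.ofReal_le_ofReal i.2))
        (hmom i)⟩
  have hconv : ∀ k, ∫⁻ y, ‖density (interpolant (τ k) (σ k) t) y - density η y‖ₑ =
      ENNReal.ofReal (∫ y, |density (interpolant (τ k) (σ k) t) y - density η y|) := fun k =>
    (ofReal_integral_norm_eq_lintegral_enorm
      ((integral_density_eq_one (hkac k)).1.sub (integral_density_eq_one hac).1)).symm
  simp_rw [hconv]
  rw [← ENNReal.ofReal_zero]
  refine ENNReal.tendsto_ofReal ?_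
  have h3 : atTop ⊓ 𝓟 s = map Subtype.val (comap (Subtype.val : s → ℕ) atTop) := by
    rw [map_comap, Subtype.range_val]
  rw [h3, tendsto_map'_iff]
  exact hmain

theorem lintegral_enorm_density {μ : ProbabilityMeasure ℝ} (h : (μ : Measure ℝ) ≪ volume) :
    ∫⁻ y, ‖density μ y‖ₑ = 1 := by
  have := lintegral_density h (f := fun _ => 1) measurable_const
  simp only [lintegral_const, measure_univ, mul_one] at this
  rw [this]
  exact lintegral_congr fun y => Real.enorm_eq_ofReal (density_nonneg μ y)

section convergence

variable {g φ W : ℝ → ℝ} {ρ₀ : ProbabilityMeasure ℝ} {m c K CV : ℝ} {D S Q V' : ℝ → ℝ}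
  {τ : ℕ → ℝ} {σ : ℕ → ℕ → ProbabilityMeasure ℝ}

/-- `L¹` convergence on the strips. -/
theorem tendsto_lintegral_strip (hρ₀ : FiniteSecondMoment ρ₀) (hE : energy g φ W ρ₀ < ⊤)
    (hd : EnergyDual m φ D S Q c K) (ha : CoeffRegular (coeff g))
    (hV : PotentialRegular (potential g W) V' CV)
    (hτ : ∀ k, 0 < τ k) {Θ : ℝ} (hΘ : ∀ k, τ k ≤ Θ)
    (hσ : ∀ k, IsJKOSequence g φ W ρ₀ (τ k) (σ k)) {ρ : ℝ → ProbabilityMeasure ℝ}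
    (hρ : ∀ t, 0 ≤ t → Tendsto (fun k => interpolant (τ k) (σ k) t) atTop (𝓝 (ρ t)))
    {r : ℝ × ℝ → ℝ} (hr : Measurable r)
    (hac : ∀ t, 0 ≤ t → (ρ t : Measure ℝ) ≪ volume)
    (hrρ : ∀ t, 0 ≤ t → ∀ᵐ y, r (t, y) = density (ρ t) y) (T : ℝ) :
    Tendsto (fun k => ∫⁻ p, ‖density (interpolant (τ k) (σ k) p.1) p.2 - r p‖ₑ ∂(strip T))
      atTop (𝓝 0) := by
  set X : ℕ → ℝ → ℝ := fun k t => discreteSpeedSq (τ k) (σ k) ⌈t / τ k⌉₊ with hX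
  have hXm : ∀ k, Measurable (X k) := fun k =>
    (measurable_from_nat (f := discreteSpeedSq (τ k) (σ k))).comp
      (Nat.measurable_ceil.comp (measurable_id.div_const (τ k)))
  set E : ℕ → ℝ → ℝ≥0∞ := fun k t =>
    ∫⁻ y, ‖density (interpolant (τ k) (σ k) t) y - r (t, y)‖ₑ with hEdef
  have hmeas : ∀ k, Measurable fun p : ℝ × ℝ =>
      ‖density (interpolant (τ k) (σ k) p.1) p.2 - r p‖ₑ := fun k => ((measurable_density_interpolant (τ k) (σ k)).sub hr).enorm
  have hEm : ∀ k, Measurable (E k) := fun k => (hmeas k).lintegral_prod_right'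
  have hkac : ∀ k t, (interpolant (τ k) (σ k) t : Measure ℝ) ≪ volume :=
    fun k t => (hσ k).absolutelyContinuous hρ₀ hE ⌈t / τ k⌉₊
  have hEeq : ∀ k t, 0 ≤ t →
      E k t = ∫⁻ y, ‖density (interpolant (τ k) (σ k) t) y - density (ρ t) y‖ₑ := by
    intro k t ht
    refine lintegral_congr_ae ?_
    filter_upwards [hrρ t ht] with y hy
    rw [hy]
  have hE2 : ∀ k t, 0 ≤ t → E k t ≤ 2 := by
    intro k t ht
    rw [hEeq k t ht]
    refine (lintegral_mono fun y => enorm_sub_le).trans ?_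
    rw [lintegral_add_left (measurable_density _).enorm, lintegral_enorm_density (hkac k t),
      lintegral_enorm_density (hac t ht), one_add_one_eq_two]
  set F := (energy g φ W ρ₀).toReal
  have hF : 0 ≤ F := ENNReal.toReal_nonneg
  have hstrip : ∀ k, ∫⁻ p, ‖density (interpolant (τ k) (σ k) p.1) p.2 - r p‖ₑ ∂(strip T) =
      ∫⁻ t in Ioc 0 T, E k t := by
    intro k
    rw [strip, lintegral_prod _ (hmeas k).aemeasurable,
      ← Measure.restrict_congr_set Ioc_ae_eq_Icc]
  simp_rw [hstrip]
  rw [ENNReal.tendsto_nhds_zero]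
  intro ε hε
  have h1 : Tendsto (fun N : ℝ => ENNReal.ofReal (2 / N) * ENNReal.ofReal (2 * F)) atTop
      (𝓝 0) := by
    have h2 := ENNReal.tendsto_ofReal ((tendsto_const_nhds (x := (2 : ℝ))).div_atTop tendsto_id)
    rw [ENNReal.ofReal_zero] at h2
    have h3 := ENNReal.Tendsto.mul_const h2
      (Or.inr (ENNReal.ofReal_ne_top (r := 2 * F)))
    rwa [zero_mul] at h3
  -- Chebyshev's inequality: `E k t ≤ 2` always, so the times with `X k t > N` contribute at most `2
  -- / N` times the integral of `X k`, which is bounded by `2 * F`.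
  obtain ⟨N, hN1, hN⟩ := ((ENNReal.tendsto_nhds_zero.1 h1 (ε / 2)
    (ENNReal.half_pos hε.ne')).and (eventually_gt_atTop 0)).exists
  -- The set of slow times varies with `k`. At fixed `t`, `G k t` is zero for the fast indices and
  -- tends to zero along the slow ones, so dominated convergence applies to the whole sequence.
  set G : ℕ → ℝ → ℝ≥0∞ := fun k => {t | X k t ≤ N}.indicator (E k) with hG
  have hset : ∀ k, MeasurableSet {t | X k t ≤ N} :=
    fun k => measurableSet_le (hXm k) measurable_const
  have hsplit : ∀ k, ∀ t ∈ Ioc 0 T,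
      E k t ≤ G k t + ENNReal.ofReal (2 / N) * ENNReal.ofReal (X k t) := by
    intro k t ht
    by_cases h : X k t ≤ N
    · have : G k t = E k t := indicator_of_mem (s := {t | X k t ≤ N}) h (E k)
      rw [this]
      exact le_self_add
    · refine (hE2 k t ht.1.le).trans (le_trans ?_ le_add_self)
      rw [← ENNReal.ofReal_mul (by positivity), ← ENNReal.ofReal_ofNat 2]
      refine ENNReal.ofReal_le_ofReal ?_
      rw [div_mul_eq_mul_div, le_div_iff₀ hN]
      linarith
  have hGlim : Tendsto (fun k => ∫⁻ t in Ioc 0 T, G k t) atTop (𝓝 0) := by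
    have h3 : Tendsto (fun k => ∫⁻ t in Ioc 0 T, G k t) atTop
        (𝓝 (∫⁻ _ in Ioc (0 : ℝ) T, 0)) := by
      refine tendsto_lintegral_of_dominated_convergence (fun _ => 2)
        (fun k => (hEm k).indicator (hset k)) (fun k => ?_) ?_ ?_
      · filter_upwards [ae_restrict_mem measurableSet_Ioc] with t ht
        exact (indicator_le_self' (fun _ _ => bot_le) t).trans (hE2 k t ht.1.le)
      · rw [setLIntegral_const, Real.volume_Ioc]
        finiteness
      · filter_upwards [ae_restrict_mem measurableSet_Ioc] with t ht
        have h4 := tendsto_lintegral_enorm_sub_density hρ₀ hE hd ha hV hτ hΘ hσ ht.1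
          (hρ t ht.1.le) (hac t ht.1.le) hN.le
        rw [ENNReal.tendsto_nhds_zero] at h4 ⊢
        intro δ hδ
        filter_upwards [eventually_inf_principal.1 (h4 δ hδ)] with k hk
        refine indicator_apply_le' (fun h => ?_) fun _ => bot_le
        rw [hEeq k t ht.1.le]
        exact hk h
    simpa using h3
  filter_upwards [ENNReal.tendsto_nhds_zero.1 hGlim (ε / 2) (ENNReal.half_pos hε.ne')] with k hk
  calc ∫⁻ t in Ioc 0 T, E k t
      ≤ ∫⁻ t in Ioc 0 T, (G k t + ENNReal.ofReal (2 / N) * ENNReal.ofReal (X k t)) :=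
        setLIntegral_mono' measurableSet_Ioc (hsplit k)
    _ = (∫⁻ t in Ioc 0 T, G k t) +
          ENNReal.ofReal (2 / N) * ∫⁻ t in Ioc 0 T, ENNReal.ofReal (X k t) := by
        rw [lintegral_add_left ((hEm k).indicator (hset k)),
          lintegral_const_mul' _ _ ENNReal.ofReal_ne_top]
    _ ≤ ε / 2 + ε / 2 := by
        refine add_le_add hk (le_trans (mul_le_mul' le_rfl ?_) hN1)
        exact (lintegral_mono_set Ioc_subset_Ioi_self).trans
          ((hσ k).lintegral_discreteSpeedSq_le (hτ k) hρ₀ hE)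
    _ = ε := ENNReal.add_halves ε

end convergence

theorem density_ae_eq_of_eq_withDensity {μ : ProbabilityMeasure ℝ} {f : ℝ → ℝ} (hf : Measurable f)
    (hf0 : ∀ y, 0 ≤ f y)
    (h : (μ : Measure ℝ) = volume.withDensity (fun y => ENNReal.ofReal (f y))) :
    ∀ᵐ y, f y = density μ y := by
  have h1 := Measure.rnDeriv_withDensity volume hf.ennreal_ofReal
  rw [← h] at h1
  filter_upwards [h1] with y hy
  rw [density, hy, ENNReal.toReal_ofReal (hf0 y)]

theorem lintegral_enorm_strip_ne_top {f : ℝ × ℝ → ℝ} (hf : Measurable f) (T : ℝ)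
    (h : ∀ t, 0 ≤ t → ∫⁻ y, ‖f (t, y)‖ₑ = 1) : ∫⁻ p, ‖f p‖ₑ ∂(strip T) ≠ ⊤ := by
  rw [strip, lintegral_prod _ hf.enorm.aemeasurable,
    setLIntegral_congr_fun measurableSet_Icc fun t ht => h t ht.1, setLIntegral_const,
    Real.volume_Icc]
  finiteness

end DegenerateMobility

/-! ### Conclusion -/

open DegenerateMobility
theorem proposition3p5 (g φ W : ℝ → ℝ) (m ν : ℝ) (hm : 1 < m) (hν : ν ∈ Ico m (3 * m))
    (hg : IsMobility g) (hφ : IsInternalEnergy m ν φ) (hW : IsPotential g W)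
    (ρ₀ : ProbabilityMeasure ℝ) (hρ₀ : FiniteSecondMoment ρ₀) (hE : energy g φ W ρ₀ < ⊤)
    (τ : ℕ → ℝ) (hτ : ∀ k, 0 < τ k) (hτ0 : Tendsto τ atTop (𝓝 0))
    (σ : ℕ → ℕ → ProbabilityMeasure ℝ) (hσ : ∀ k, IsJKOSequence g φ W ρ₀ (τ k) (σ k))
    (ρ : ℝ → ProbabilityMeasure ℝ)
    (hρ : ∀ t, 0 ≤ t → Tendsto (fun k => interpolant (τ k) (σ k) t) atTop (𝓝 (ρ t))) :
    ∃ r : ℝ × ℝ → ℝ, Measurable r ∧ (∀ p, 0 ≤ r p) ∧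
      (∀ t, 0 ≤ t →
        (ρ t : Measure ℝ) = volume.withDensity (fun y => ENNReal.ofReal (r (t, y)))) ∧
      ∀ T : ℝ, 0 < T → ∀ q : ℝ, 1 ≤ q → q < 3 * m →
        (∀ k, MemLp (fun p : ℝ × ℝ => density (interpolant (τ k) (σ k) p.1) p.2)
          (ENNReal.ofReal q) (strip T)) ∧
        MemLp r (ENNReal.ofReal q) (strip T) ∧
        Tendsto (fun k => eLpNorm
          (fun p : ℝ × ℝ => density (interpolant (τ k) (σ k) p.1) p.2 - r p)
          (ENNReal.ofReal q) (strip T)) atTop (𝓝 0) := by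
  obtain ⟨D, S, Q, c, K, hd⟩ := hφ.exists_dual hm hν.1
  have ha := hg.coeffRegular
  obtain ⟨V', CV, hV⟩ := hW.exists_regular hg
  -- A common bound for the time steps makes the moment estimates uniform in `k`.
  obtain ⟨Θ, hΘ⟩ := hτ0.bddAbove_range
  replace hΘ : ∀ k, τ k ≤ Θ := fun k => hΘ (mem_range_self k)
  have hkac := fun k t => (hσ k).absolutelyContinuous hρ₀ hE ⌈t / τ k⌉₊
  have hac : ∀ t, 0 ≤ t → (ρ t : Measure ℝ) ≪ volume := fun t ht =>
    absolutelyContinuous_of_tendsto hm (hρ t ht) (fun k => hkac k t) ENNReal.ofReal_ne_top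
      fun k => (hσ k).lintegral_rpow_le hρ₀ hE hd ha hV _
  -- Nothing is known for negative times, so the family is frozen at `ρ 0` there to be measurable on
  -- the whole line.
  have hρm : Measurable fun t => (ρ (max t 0) : Measure ℝ) :=
    measurable_of_tendsto_narrow
      (fun k => (measurable_interpolant (τ k) (σ k)).comp (measurable_id.max measurable_const))
      (fun t => hρ _ (le_max_right t 0)) fun t => hac _ (le_max_right t 0)
  obtain ⟨r, hr, hr0, hrρ⟩ := exists_jointly_measurable_density hρm
    fun t => hac _ (le_max_right t 0)
  replace hrρ : ∀ t, 0 ≤ t →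
      (ρ t : Measure ℝ) = volume.withDensity (fun y => ENNReal.ofReal (r (t, y))) := by
    intro t ht
    have := hrρ t
    rwa [max_eq_left ht] at this
  refine ⟨r, hr, hr0, hrρ, fun T _ q hq hq3 => ?_⟩
  have hrd : ∀ t, 0 ≤ t → ∀ᵐ y, r (t, y) = density (ρ t) y := fun t ht =>
    density_ae_eq_of_eq_withDensity (hr.comp measurable_prodMk_left) (fun y => hr0 _) (hrρ t ht)
  obtain ⟨B, hB, hbd⟩ := exists_strip_bound (Θ := Θ) (T := T) hρ₀ hE hd ha hV
    ((hτ 0).le.trans (hΘ 0))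
  refine tendsto_eLpNorm_of_tendsto_lintegral (fun k => measurable_density_interpolant _ _) hr hB
    (fun k => lintegral_enorm_strip_ne_top (measurable_density_interpolant _ _) T
      fun t _ => lintegral_enorm_density (hkac k t))
    (lintegral_enorm_strip_ne_top hr T fun t ht => ?_)
    (fun k => hbd (τ k) (σ k) (hτ k) (hΘ k) (hσ k))
    (tendsto_lintegral_strip hρ₀ hE hd ha hV hτ hΘ hσ hρ hr hac hrd T) hq hq3
  rw [← lintegral_enorm_density (hac t ht)]
  refine lintegral_congr_ae ?_
  filter_upwards [hrd t ht] with y hy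
  rw [hy]
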